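/- Let $(S,d)$ be a complete separable metric space, let $\Lambda$ be Lebesgue measure on $[0,\infty)$, and let $h_1,h_2,\ldots$ be continuous functions on $S$ with $0\le h_k\le 1$ and $\bigcup_k\{x: h_k(x)>0\}=S$. Let $\mathcal M_{\{h_k\}}(S)$ be the set of Borel measures $\nu$ on $S$ with $\int_S h_k\,d\nu<\infty$ for all $k$, with the coarsest topology for which $\nu\mapsto\int_S f h_k\,d\nu$ is continuous for every $k$ and every bounded continuous $f$ on $S$. Let $\mathcal M_{\{h_k\}}(S\times[0,\infty))$ be the set of Borel measures $\mu$ on $S\times[0,\infty)$ with $\int_{S\times[0,K]}h_k(x)\,\mu(dx\times du)<\infty$ for all $k$ and $K>0$, with the coarsest topology for which $\mu\mapsto\int f(x,u)h_k(x)\,\mu(dx\times du)$ is continuous for every $k$ and every bounded continuous $f$ on $S\times[0,\infty)$ supported in $S\times[0,K]$ for some $K>0$. Both spaces carry their Borel $\sigma$-algebras. A Poisson random measure with ($\sigma$-finite) mean measure $\nu$ is a random counting measure $N$ such that $N(A)$ is Poisson distributed with parameter $\nu(A)$ whenever $\nu(A)<\infty$, and $N(A_1),N(A_2),\ldots$ are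 independent for disjoint measurable $A_1,A_2,\ldots$. For random elements $\xi$ of $\mathcal M_{\{h_k\}}(S\times[0,\infty))$ and $\Xi$ of $\mathcal M_{\{h_k\}}(S)$ on one probability space, $\xi$ is conditionally Poisson with Cox measure $\Xi\times\Lambda$ if, conditioned on $\Xi$, $\xi$ is a Poisson random measure with mean measure $\Xi\times\Lambda$. If only the laws of $\xi$ and $\Xi$ are given, this means that some coupling of the two laws has this property. For $n=1,2,\ldots$ let $\xi^n$, with values in $\mathcal M_{\{h_k\}}(S\times[0,\infty))$, be conditionally Poisson with Cox measure $\Xi^n\times\Lambda$, where $\Xi^n$ has values in $\mathcal M_{\{h_k\}}(S)$. Then: 1. $(\xi^n)$ converges in distribution in $\mathcal M_{\{h_k\}}(S\times[0,\infty))$ if and only if $(\Xi^n)$ converges in distribution in $\mathcal M_{\{h_k\}}(S)$. 2. If $\xi^n\Rightarrow\xi$ and $\Xi^n\Rightarrow\Xi$, then $\xi$ is conditionally Poisson with Cox measure $\Xi\times\Lambda$ (in the sense of laws). 3. If $\xi$ is conditionally Poisson with Cox measure $\Xi\times\Lambda$ (in the sense of laws), then $\xi^n\Rightarrow\xi$ if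 and only if $\Xi^n\Rightarrow\Xi$. -/

import Mathlib

open MeasureTheory ProbabilityTheory Filter Topology
open scoped ENNReal NNReal BoundedContinuousFunction

noncomputable section

/-- Lebesgue measure on `[0, ∞)`. -/
def lebesgueHalfLine : Measure ℝ≥0 :=
  Measure.comap (fun u : ℝ≥0 => (u : ℝ)) volume

section MeasureSpaces

variable {S : Type*} [TopologicalSpace S] [MeasurableSpace S]

/-- The Borel measures `ν` on `S` with `∫ h_k dν < ∞` for all `k`. -/
def MBase (h : ℕ → S →ᵇ ℝ) : Type _ :=
  {ν : Measure S // ∀ k, ∫⁻ x, ENNReal.ofReal (h k x) ∂ν < ∞}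

/-- The Borel measures `μ` on `S × [0, ∞)` with `∫_{S × [0, K]} h_k dμ < ∞` for all `k` and `K`. -/
def MStrip (h : ℕ → S →ᵇ ℝ) : Type _ :=
  {μ : Measure (S × ℝ≥0) //
    ∀ (k : ℕ) (K : ℝ≥0), ∫⁻ p in Set.univ ×ˢ Set.Iic K, ENNReal.ofReal (h k p.1) ∂μ < ∞}

/-- Bounded continuous functions on `S × [0, ∞)` vanishing outside some `S × [0, K]`. -/
def StripTest (S : Type*) [TopologicalSpace S] : Type _ :=
  {f : (S × ℝ≥0) →ᵇ ℝ // ∃ K : ℝ≥0, ∀ (x : S) (u : ℝ≥0), K < u → f (x, u) = 0}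

/-- The coarsest topology for which `ν ↦ ∫ f h_k dν` is continuous for all `k` and all bounded
continuous `f`. -/
instance MBase.topologicalSpace (h : ℕ → S →ᵇ ℝ) : TopologicalSpace (MBase h) :=
  TopologicalSpace.induced
    (fun (ν : MBase h) (q : ℕ × (S →ᵇ ℝ)) => ∫ x, q.2 x * h q.1 x ∂ν.1) inferInstance

/-- The coarsest topology for which `μ ↦ ∫ f h_k dμ` is continuous for all `k` and all bounded
continuous `f` supported in some `S × [0, K]`. -/
instance MStrip.topologicalSpace (h : ℕ → S →ᵇ ℝ) : TopologicalSpace (MStrip h) :=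
  TopologicalSpace.induced
    (fun (μ : MStrip h) (q : ℕ × StripTest S) => ∫ p, q.2.1 p * h q.1 p.1 ∂μ.1) inferInstance

instance MBase.measurableSpace (h : ℕ → S →ᵇ ℝ) : MeasurableSpace (MBase h) :=
  borel (MBase h)

instance MStrip.measurableSpace (h : ℕ → S →ᵇ ℝ) : MeasurableSpace (MStrip h) :=
  borel (MStrip h)

instance MBase.borelSpace (h : ℕ → S →ᵇ ℝ) : BorelSpace (MBase h) := ⟨rfl⟩

instance MStrip.borelSpace (h : ℕ → S →ᵇ ℝ) : BorelSpace (MStrip h) := ⟨rfl⟩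

end MeasureSpaces

/-- Under the probability measure `P`, `N` is a Poisson random measure with mean measure `ν`. -/
structure IsPoissonRandomMeasure {Ω X : Type*} [MeasurableSpace Ω] [MeasurableSpace X]
    (P : Measure Ω) (N : Ω → Measure X) (ν : Measure X) : Prop where
  /-- `N` is almost surely a counting measure, that is, has values in `{0, 1, 2, …, ∞}`. -/
  counting : ∀ᵐ ω ∂P, ∀ A, MeasurableSet A → ∃ n : ℕ∞, N ω A = (n : ℝ≥0∞)
  /-- `N A` is Poisson distributed with parameter `ν A` whenever `ν A < ∞`. -/
  poisson : ∀ A, MeasurableSet A → ν A < ∞ →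
    P.map (fun ω => N ω A) =
      (poissonMeasure (ν A).toNNReal).map (fun n : ℕ => (n : ℝ≥0∞))
  /-- `N A₁, N A₂, …` are independent for disjoint `A₁, A₂, …`. -/
  indep : ∀ A : ℕ → Set X, (∀ i, MeasurableSet (A i)) → Pairwise (Function.onFun Disjoint A) →
    iIndepFun (fun i ω => N ω (A i)) P

section Cox

variable {S : Type*} [TopologicalSpace S] [MeasurableSpace S]

/-- `ξ` is conditionally Poisson with Cox measure `Ξ × Λ` (`Λ` Lebesgue measure on `[0, ∞)`):
there is a regular conditional distribution `κ` of `ξ` given `Ξ` such that, for almost every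
value `ν` of `Ξ`, `κ ν` is the law of a Poisson random measure with mean measure `ν × Λ`. -/
def IsConditionallyPoisson {Ω : Type*} [MeasurableSpace Ω] (P : Measure Ω) {h : ℕ → S →ᵇ ℝ}
    (ξ : Ω → MStrip h) (Ξ : Ω → MBase h) : Prop :=
  AEMeasurable ξ P ∧ AEMeasurable Ξ P ∧
    ∃ κ : Kernel (MBase h) (MStrip h), IsMarkovKernel κ ∧
      P.map (fun ω => (Ξ ω, ξ ω)) = (P.map Ξ) ⊗ₘ κ ∧
      ∀ᵐ ν ∂(P.map Ξ),
        IsPoissonRandomMeasure (κ ν) (fun μ : MStrip h => μ.1) (ν.1.prod lebesgueHalfLine)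

/-- The version of `IsConditionallyPoisson` for random measures of which only the laws
`Q` (of `ξ`) and `R` (of `Ξ`) are given: some coupling of `R` and `Q` is conditionally Poisson. -/
def IsConditionallyPoissonLaw {h : ℕ → S →ᵇ ℝ}
    (Q : Measure (MStrip h)) (R : Measure (MBase h)) : Prop :=
  ∃ ρ : Measure (MBase h × MStrip h),
    ρ.map Prod.fst = R ∧ ρ.map Prod.snd = Q ∧ IsConditionallyPoisson ρ Prod.snd Prod.fst

end Cox

end

/-! The proof rests on Laplace functionals. If `ξ` is Poisson with mean measure `ν × Λ` and `f ≥ 0`,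
then E exp(-∫ f dξ) = exp(-∫ ψ dν) with ψ(x) = ∫ (1 - exp(-f(x,u))) du. Averaging over `Ξ` gives E
exp(-∫ f dξ) = E exp(-∫ ψ dΞ) for a conditionally Poisson pair; this relation between the two laws
is `LaplaceLinked`. The transform f ↦ ψ sends test functions on the strip to test functions on the
base (`exists_isStripTransform`). It is also onto: ψ is the transform of f(x,u) = -log(1 - c ψ(x)
χ(u)), where χ is a cutoff on the half-line with integral 1/c, so wide that cψ ≤ 1/2
(`exists_neg_log_isStripTransform`). Such wide cutoffs exist because the half-line has infinite
length. So the Laplace functionals of `ξ n` converge exactly when those of `Ξ n` do, and the law of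
`ξ` determines that of `Ξ`.

Two facts turn this into convergence in distribution. When a candidate limit law is at hand,
convergence of Laplace functionals suffices: they form a multiplicative family, countably many of
them induce the topology, and a Stone–Weierstrass argument on a cube applies
(`tendsto_of_isInducing`). This gives the passage from `Ξ n` to `ξ n`, the candidate being the
mixture of Poisson laws over the limit of `Ξ n`. For the mixture, Poisson random measures are built
by superposing finite point configurations, and their laws depend continuously on `ν`, hence form a
kernel (`exists_poissonKernel`).

When only `ξ n` is known to converge, the limit of `Ξ n` must be produced. This is a Lévy continuity
theorem (`MBase.exists_tendsto_of_laplace`): the limiting Laplace functional, expressed through the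
limit of `ξ n`, tends to 1 as ψ decreases to 0, by dominated convergence. This makes the laws of `Ξ
n` tight, and all limit points have the same Laplace functional.

The space of measures on the strip is homeomorphic to the base space for the weights h_k(x) χ_m(u),
so its topology needs no separate study. Statements 2 and 3 then follow from uniqueness of limits
and of Laplace functionals. -/

noncomputable section

/-! ### Multiplicative families that determine convergence in distribution -/

section ConvergenceDetermining

variable {E : Type*} [TopologicalSpace E] [MeasurableSpace E] [BorelSpace E]

/-- Integrals converge on the algebra spanned by a multiplicative family on which they converge. -/
lemma tendsto_integral_of_mem_adjoin (M : Submonoid (E →ᵇ ℝ)) {Q : ℕ → ProbabilityMeasure E}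
    {Q₀ : ProbabilityMeasure E}
    (hM : ∀ m ∈ M, Tendsto (fun n => ∫ x, m x ∂(Q n : Measure E)) atTop
      (𝓝 (∫ x, m x ∂(Q₀ : Measure E))))
    {b : E →ᵇ ℝ} (hb : b ∈ Algebra.adjoin ℝ (M : Set (E →ᵇ ℝ))) :
    Tendsto (fun n => ∫ x, b x ∂(Q n : Measure E)) atTop (𝓝 (∫ x, b x ∂(Q₀ : Measure E))) := by
  -- A multiplicatively closed set spans its own algebra, so linearity of the integral is all that
  -- is needed.
  have hb' : b ∈ Submodule.span ℝ (M : Set (E →ᵇ ℝ)) := by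
    have := Algebra.adjoin_eq_span (R := ℝ) (s := (M : Set (E →ᵇ ℝ)))
    rw [Submonoid.closure_eq] at this
    rw [← this]
    exact hb
  induction hb' using Submodule.span_induction with
  | mem x hx => exact hM x hx
  | zero => simp
  | add x y hx hy ihx ihy =>
    have key (R : ProbabilityMeasure E) : ∫ z, (x + y) z ∂(R : Measure E)
        = ∫ z, x z ∂(R : Measure E) + ∫ z, y z ∂(R : Measure E) := by
      simp only [BoundedContinuousFunction.coe_add, Pi.add_apply]
      exact integral_add (x.integrable _) (y.integrable _)
    simp only [key]
    refine (ihx ?_).add (ihy ?_)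
    · exact Algebra.span_le_adjoin ℝ _ hx
    · exact Algebra.span_le_adjoin ℝ _ hy
  | smul a x hx ih =>
    simp only [BoundedContinuousFunction.coe_smul, smul_eq_mul, integral_const_mul]
    exact (ih (Algebra.span_le_adjoin ℝ _ hx)).const_mul a

/-- A multiplicative family of bounded continuous functions which contains a countable family
inducing the topology is convergence determining. -/
theorem tendsto_of_isInducing {ι : Type*} [Countable ι] (g : ι → E →ᵇ ℝ)
    (hg : ∀ i x, g i x ∈ Set.Icc (0 : ℝ) 1) (hind : IsInducing fun x i => g i x)
    (M : Submonoid (E →ᵇ ℝ)) (hgM : ∀ i, g i ∈ M) {Q : ℕ → ProbabilityMeasure E}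
    {Q₀ : ProbabilityMeasure E}
    (hM : ∀ m ∈ M, Tendsto (fun n => ∫ x, m x ∂(Q n : Measure E)) atTop
      (𝓝 (∫ x, m x ∂(Q₀ : Measure E)))) :
    Tendsto Q atTop (𝓝 Q₀) := by
  -- The values of the `g i` map `E` into a compact metrizable cube, where tightness is automatic.
  let e : E → (ι → unitInterval) := fun x i => ⟨g i x, hg i x⟩
  have he : IsInducing e := by
    have h1 : IsInducing (fun (y : ι → unitInterval) i => (y i : ℝ)) :=
      IsInducing.piMap (f := fun (_ : ι) (y : unitInterval) => (y : ℝ))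
        (fun _ => IsInducing.subtypeVal)
    exact IsInducing.of_comp (f := e) (g := fun (y : ι → unitInterval) i => (y i : ℝ))
      (by fun_prop) h1.continuous hind
  have hec : Continuous e := he.continuous
  have hpush : Tendsto (fun n => (Q n).map hec.measurable.aemeasurable) atTop
      (𝓝 (Q₀.map hec.measurable.aemeasurable)) := by
    let pull : ((ι → unitInterval) →ᵇ ℝ) →ₐ[ℝ] (E →ᵇ ℝ) :=
      { toFun := fun b => b.compContinuous ⟨e, hec⟩
        map_one' := rfl
        map_mul' := fun _ _ => rfl
        map_zero' := rfl
        map_add' := fun _ _ => rfl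
        commutes' := fun _ => rfl }
    let B := Algebra.adjoin ℝ (M : Set (E →ᵇ ℝ))
    -- The functions on the cube whose pullback lies in the algebra generated by `M`. The
    -- coordinates are among them, since they pull back to the `g i`, so points are separated.
    let A : StarSubalgebra ℝ ((ι → unitInterval) →ᵇ ℝ) :=
      { B.comap pull with
        star_mem' := by
          intro a ha
          have : star a = a := by ext x; simp
          rw [this]; exact ha }
    refine ProbabilityMeasure.tendsto_of_tight_of_separatesPoints ℝ
      IsTightMeasureSet.of_compactSpace (A := A) ?_ ?_
    · intro x y hxy
      obtain ⟨i, hi⟩ := Function.ne_iff.mp hxy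
      let c : (ι → unitInterval) →ᵇ ℝ :=
        BoundedContinuousFunction.mkOfCompact ⟨fun z => (z i : ℝ), by fun_prop⟩
      refine ⟨c, ⟨_, ⟨c, ?_, rfl⟩, rfl⟩, ?_⟩
      · change pull c ∈ B
        have : pull c = g i := by ext z; rfl
        rw [this]
        exact Algebra.subset_adjoin (hgM i)
      · intro hc
        exact hi (Subtype.ext hc)
    · intro b hb
      have := tendsto_integral_of_mem_adjoin M hM (b := pull b) hb
      have key (R : ProbabilityMeasure E) :
          ∫ x, b x ∂((R.map hec.measurable.aemeasurable : ProbabilityMeasure _) : Measure _)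
            = ∫ x, pull b x ∂(R : Measure E) := by
        rw [ProbabilityMeasure.toMeasure_map, integral_map hec.measurable.aemeasurable
          (by fun_prop)]
        rfl
      simpa only [key] using this
  -- Return to `E`: every open set is the preimage of an open set of the cube, so the portmanteau
  -- inequality transfers. Neither injectivity of `e` nor closedness of its image is needed.
  refine tendsto_of_forall_isOpen_le_liminf_nat' fun G hG => ?_
  obtain ⟨V, hV, rfl⟩ := he.isOpen_iff.mp hG
  have := ProbabilityMeasure.le_liminf_measure_open_of_tendsto hpush hV
  simpa only [ProbabilityMeasure.toMeasure_map, Measure.map_apply hec.measurable hV.measurableSet]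
    using this

end ConvergenceDetermining

/-- A family of finite measures is measurable as soon as the integrals of the bounded continuous
functions are. -/
lemma measurable_measure_of_lintegral {α X : Type*} [MeasurableSpace α] [TopologicalSpace X]
    [HasOuterApproxClosed X] [MeasurableSpace X] [BorelSpace X] {κ : α → Measure X}
    [∀ a, IsFiniteMeasure (κ a)]
    (h : ∀ f : X →ᵇ ℝ≥0, Measurable fun a => ∫⁻ x, f x ∂κ a) : Measurable κ := by
  refine Measurable.measure_of_isPiSystem (S := {s | IsClosed s})
    (BorelSpace.measurable_eq.trans borel_eq_generateFrom_isClosed) isPiSystem_isClosed ?_ ?_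
  · intro F hF
    refine measurable_of_tendsto_metrizable (fun n => h (IsClosed.apprSeq hF n)) ?_
    rw [tendsto_pi_nhds]
    intro a
    exact measure_of_cont_bdd_of_tendsto_indicator (κ a) (IsClosed.measurableSet hF)
      (IsClosed.apprSeq hF) (HasOuterApproxClosed.apprSeq_apply_le_one hF)
      (HasOuterApproxClosed.tendsto_apprSeq hF)
  · simpa using h 1

/-! ### A countable family that determines weak convergence of finite measures -/

section CountableFamily

variable {X : Type*} [TopologicalSpace X] [MeasurableSpace X] [BorelSpace X]

/-- Weak convergence of finite measures from lower bounds on open sets and convergence of the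
total masses. -/
lemma tendsto_integral_of_forall_isOpen_le_liminf {m : ℕ → Measure X} {m₀ : Measure X}
    [∀ n, IsFiniteMeasure (m n)] [IsFiniteMeasure m₀]
    (hopen : ∀ G, IsOpen G → m₀ G ≤ atTop.liminf fun n => m n G)
    (huniv : Tendsto (fun n => m n Set.univ) atTop (𝓝 (m₀ Set.univ))) (f : X →ᵇ ℝ) :
    Tendsto (fun n => ∫ x, f x ∂m n) atTop (𝓝 (∫ x, f x ∂m₀)) := by
  set c : ℝ := ‖f‖
  have hfc (x : X) : |f x| ≤ c := f.norm_coe_le_norm x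
  have hp (x : X) : 0 ≤ c + f x := by linarith [neg_abs_le (f x), hfc x]
  have hq (x : X) : 0 ≤ c - f x := by linarith [le_abs_self (f x), hfc x]
  -- The integrands `c + f` and `c - f` are both nonnegative, so `A` and `B` are lower
  -- semicontinuous along the sequence. Their sum is a multiple of the total mass and converges,
  -- which forces each of them to converge.
  set A : Measure X → ℝ≥0∞ := fun μ => ∫⁻ x, ENNReal.ofReal (c + f x) ∂μ with hA
  set B : Measure X → ℝ≥0∞ := fun μ => ∫⁻ x, ENNReal.ofReal (c - f x) ∂μ with hB
  have hAB (μ : Measure X) : A μ + B μ = ENNReal.ofReal (2 * c) * μ Set.univ := by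
    rw [hA, hB, ← lintegral_add_left (by fun_prop), ← lintegral_const]
    refine lintegral_congr fun x => ?_
    rw [← ENNReal.ofReal_add (hp x) (hq x)]
    congr 1; ring
  have hlA : A m₀ ≤ atTop.liminf fun n => A (m n) :=
    lintegral_le_liminf_lintegral_of_forall_isOpen_measure_le_liminf_measure (by fun_prop) hp hopen
  have hlB : B m₀ ≤ atTop.liminf fun n => B (m n) :=
    lintegral_le_liminf_lintegral_of_forall_isOpen_measure_le_liminf_measure (by fun_prop) hq hopen
  have hsum : Tendsto (fun n => A (m n) + B (m n)) atTop (𝓝 (A m₀ + B m₀)) := by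
    simp only [hAB]
    exact ENNReal.Tendsto.const_mul huniv (Or.inr ENNReal.ofReal_ne_top)
  have hfin (μ : Measure X) [IsFiniteMeasure μ] : A μ + B μ ≠ ∞ := by
    rw [hAB]; exact ENNReal.mul_ne_top ENNReal.ofReal_ne_top (measure_ne_top _ _)
  have hAfin (μ : Measure X) [IsFiniteMeasure μ] : A μ ≠ ∞ :=
    ne_top_of_le_ne_top (hfin μ) le_self_add
  have hBfin (μ : Measure X) [IsFiniteMeasure μ] : B μ ≠ ∞ :=
    ne_top_of_le_ne_top (hfin μ) le_add_self
  have hconv : Tendsto (fun n => A (m n)) atTop (𝓝 (A m₀)) := by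
    refine tendsto_of_le_liminf_of_limsup_le hlA ?_
    have hAe (μ : Measure X) [IsFiniteMeasure μ] : A μ = (A μ + B μ) - B μ :=
      (ENNReal.add_sub_cancel_right (hBfin μ)).symm
    refine ENNReal.le_of_forall_pos_le_add fun ε hε _ => ?_
    have hε' : (0 : ℝ≥0∞) < ε / 2 := by simp [hε.ne']
    have h1 : ∀ᶠ n in atTop, A (m n) + B (m n) < A m₀ + B m₀ + ε / 2 :=
      hsum.eventually_lt_const (ENNReal.lt_add_right (hfin m₀) hε'.ne')
    have h2 : ∀ᶠ n in atTop, B m₀ ≤ B (m n) + ε / 2 := by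
      by_cases hb : B m₀ = 0
      · simp [hb]
      · have : B m₀ - ε / 2 < atTop.liminf fun n => B (m n) :=
          (ENNReal.sub_lt_self (hBfin m₀) hb hε'.ne').trans_le hlB
        filter_upwards [eventually_lt_of_lt_liminf this] with n hn
        exact tsub_le_iff_right.mp hn.le
    refine limsup_le_of_le (by isBoundedDefault) ?_
    filter_upwards [h1, h2] with n hn1 hn2
    have h3 : A (m n) + B (m n) ≤ A m₀ + ε + B (m n) := by
      calc A (m n) + B (m n) ≤ A m₀ + B m₀ + ε / 2 := hn1.le
        _ ≤ A m₀ + (B (m n) + ε / 2) + ε / 2 := by gcongr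
        _ = A m₀ + (ε / 2 + ε / 2) + B (m n) := by ring
        _ = A m₀ + ε + B (m n) := by rw [ENNReal.add_halves]
    exact (ENNReal.add_le_add_iff_right (hBfin (m n))).mp h3
  have hint (μ : Measure X) [IsFiniteMeasure μ] :
      ∫ x, f x ∂μ = (A μ).toReal - c * (μ Set.univ).toReal := by
    have : ∫ x, (c + f x) ∂μ = (A μ).toReal :=
      integral_eq_lintegral_of_nonneg_ae (Eventually.of_forall hp) (by fun_prop)
    rw [← this, integral_add (integrable_const _) (f.integrable μ)]
    simp [Measure.real, mul_comm]
  simp only [hint]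
  exact ((ENNReal.tendsto_toReal (hAfin m₀)).comp hconv).sub
    (((ENNReal.tendsto_toReal (measure_ne_top _ _)).comp huniv).const_mul c)

/-- There is a countable family of bounded continuous functions that determines weak convergence of
finite measures. -/
lemma exists_countable_convergenceDetermining (X : Type*) [TopologicalSpace X]
    [SecondCountableTopology X] [HasOuterApproxClosed X] [MeasurableSpace X] [BorelSpace X] :
    ∃ φ : ℕ → X →ᵇ ℝ, (∀ i x, 0 ≤ φ i x) ∧
      ∀ (m : ℕ → Measure X) (m₀ : Measure X), (∀ n, IsFiniteMeasure (m n)) → IsFiniteMeasure m₀ →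
        (∀ i, Tendsto (fun n => ∫ x, φ i x ∂m n) atTop (𝓝 (∫ x, φ i x ∂m₀))) →
        ∀ f : X →ᵇ ℝ, Tendsto (fun n => ∫ x, f x ∂m n) atTop (𝓝 (∫ x, f x ∂m₀)) := by
  have hb := TopologicalSpace.countable_countableBasis X
  have : Countable (TopologicalSpace.countableBasis X) := hb.to_subtype
  -- Finite unions of basic open sets: countably many, and every open set is a directed union of
  -- them. The functions `ψ (F, j)` lie below the indicator of `U F` and tend to it as `j → ∞`.
  let U : Finset (TopologicalSpace.countableBasis X) → Set X := fun F => ⋃ b ∈ F, (b : Set X)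
  have hU (F) : IsOpen (U F) := isOpen_biUnion fun b _ =>
    TopologicalSpace.isOpen_of_mem_countableBasis b.2
  let a : Finset (TopologicalSpace.countableBasis X) → ℕ → X →ᵇ ℝ≥0 :=
    fun F j => (hU F).isClosed_compl.apprSeq j
  let ψ : Finset (TopologicalSpace.countableBasis X) × ℕ → X →ᵇ ℝ :=
    fun q => 1 - (a q.1 q.2).comp (fun r : ℝ≥0 => (r : ℝ)) isometry_subtype_coe.lipschitz
  have hψ (q) (x : X) : ψ q x = 1 - (a q.1 q.2 x : ℝ) := rfl
  have ha1 (F j) (x : X) : (a F j x : ℝ) ≤ 1 :=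
    HasOuterApproxClosed.apprSeq_apply_le_one (hU F).isClosed_compl j x
  have hψ0 (q) (x : X) : 0 ≤ ψ q x := by rw [hψ]; linarith [ha1 q.1 q.2 x]
  have hψU (q) (x : X) : ψ q x ≤ (U q.1).indicator (fun _ => (1 : ℝ)) x := by
    by_cases hx : x ∈ U q.1
    · simp only [hx, Set.indicator_of_mem, hψ]; linarith [(a q.1 q.2 x).2]
    · have : a q.1 q.2 x = 1 :=
        HasOuterApproxClosed.apprSeq_apply_eq_one (hU q.1).isClosed_compl q.2 hx
      simp [hx, hψ, this]
  -- The extra element `none` stands for the constant function `1`, which controls the total masses.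
  obtain ⟨enum, henum⟩ := exists_surjective_nat
    (Option (Finset (TopologicalSpace.countableBasis X) × ℕ))
  refine ⟨fun i => (enum i).elim 1 ψ, ?_, ?_⟩
  · intro i x
    change 0 ≤ ((enum i).elim 1 ψ) x
    cases enum i with
    | none => simp
    | some q => exact hψ0 q x
  intro m m₀ hm hm₀ hconv
  have hone : Tendsto (fun n => m n Set.univ) atTop (𝓝 (m₀ Set.univ)) := by
    obtain ⟨i, hi⟩ := henum none
    have := hconv i
    simp only [hi, Option.elim_none, BoundedContinuousFunction.coe_one, Pi.one_apply,
      integral_const, smul_eq_mul, mul_one] at this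
    exact (ENNReal.tendsto_toReal_iff (fun n => measure_ne_top _ _) (measure_ne_top _ _)).mp this
  have hψc (q) : Tendsto (fun n => ∫ x, ψ q x ∂m n) atTop (𝓝 (∫ x, ψ q x ∂m₀)) := by
    obtain ⟨i, hi⟩ := henum (some q)
    simpa only [hi, Option.elim_some] using hconv i
  refine tendsto_integral_of_forall_isOpen_le_liminf (fun G hG => ?_) hone
  refine le_of_forall_lt fun c hc => ?_
  obtain ⟨F, hFG, hF⟩ : ∃ F, U F ⊆ G ∧ c < m₀ (U F) := by
    have hcov : G = ⋃ F : {F // U F ⊆ G}, U F.1 := by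
      refine Set.Subset.antisymm (fun x hx => ?_) (Set.iUnion_subset fun F => F.2)
      obtain ⟨b, hb, hxb, hbG⟩ :=
        (TopologicalSpace.isBasis_countableBasis X).exists_subset_of_mem_open hx hG
      have hUb : U {⟨b, hb⟩} = b := Finset.set_biUnion_singleton _ _
      exact Set.mem_iUnion.mpr ⟨⟨{⟨b, hb⟩}, hUb.symm ▸ hbG⟩, hUb.symm ▸ hxb⟩
    have hdir : Directed (· ⊆ ·) fun F : {F // U F ⊆ G} => U F.1 := by
      classical
      intro F F'
      have hun : U (F.1 ∪ F'.1) = U F.1 ∪ U F'.1 := Finset.set_biUnion_union _ _ _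
      refine ⟨⟨F.1 ∪ F'.1, hun ▸ Set.union_subset F.2 F'.2⟩, ?_, ?_⟩
      · simp only [hun]; exact Set.subset_union_left
      · simp only [hun]; exact Set.subset_union_right
    rw [hcov, hdir.measure_iUnion] at hc
    obtain ⟨F, hF⟩ := lt_iSup_iff.mp hc
    exact ⟨F.1, F.2, hF⟩
  have hreal (μ : Measure X) [IsFiniteMeasure μ] (q) :
      ENNReal.ofReal (∫ x, ψ q x ∂μ) ≤ μ (U q.1) := by
    calc ENNReal.ofReal (∫ x, ψ q x ∂μ)
        ≤ ENNReal.ofReal (∫ x, (U q.1).indicator (fun _ => (1 : ℝ)) x ∂μ) := by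
          refine ENNReal.ofReal_le_ofReal (integral_mono ((ψ q).integrable μ) ?_ (hψU q))
          exact (integrable_const _).indicator (hU q.1).measurableSet
      _ = μ (U q.1) := by
          rw [integral_indicator_const _ (hU q.1).measurableSet]
          simp
  obtain ⟨j, hj⟩ : ∃ j, c < ENNReal.ofReal (∫ x, ψ (F, j) x ∂m₀) := by
    have h1 := measure_of_cont_bdd_of_tendsto_indicator m₀ (hU F).isClosed_compl.measurableSet
      ((hU F).isClosed_compl.apprSeq) (HasOuterApproxClosed.apprSeq_apply_le_one _)
      (HasOuterApproxClosed.tendsto_apprSeq (hU F).isClosed_compl)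
    have h2 : Tendsto (fun j => ENNReal.ofReal (∫ x, ψ (F, j) x ∂m₀)) atTop (𝓝 (m₀ (U F))) := by
      have h3 (j) : ENNReal.ofReal (∫ x, ψ (F, j) x ∂m₀)
          = m₀ Set.univ - ∫⁻ x, a F j x ∂m₀ := by
        have hai : Integrable (fun x => (a F j x : ℝ)) m₀ :=
          ((a F j).comp (fun r : ℝ≥0 => (r : ℝ)) isometry_subtype_coe.lipschitz).integrable m₀
        simp only [hψ]
        rw [integral_sub (integrable_const _) hai, ENNReal.ofReal_sub _
          (integral_nonneg fun x => NNReal.coe_nonneg _), lintegral_coe_eq_integral _ hai]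
        simp
      simp only [h3]
      have h4 : m₀ (U F) = m₀ Set.univ - m₀ (U F)ᶜ := by
        rw [measure_compl (hU F).measurableSet (measure_ne_top _ _)]
        exact (ENNReal.sub_sub_cancel (measure_ne_top _ _) (measure_mono (Set.subset_univ _))).symm
      rw [h4]
      exact ENNReal.Tendsto.sub tendsto_const_nhds h1 (Or.inl (measure_ne_top _ _))
    exact (h2.eventually_const_lt hF).exists
  obtain ⟨c', hcc', hc'⟩ := exists_between hj
  refine hcc'.trans_le (le_liminf_of_le (by isBoundedDefault) ?_)
  filter_upwards [(ENNReal.tendsto_ofReal (hψc (F, j))).eventually_const_lt hc'] with n hn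
  exact hn.le.trans ((hreal (m n) (F, j)).trans (measure_mono hFG))

end CountableFamily

/-! ### The cone of test functions -/

section TestCone

variable {X : Type*} [TopologicalSpace X]

/-- The finite sums of functions `φ * h k` with `φ` nonnegative, bounded and continuous. -/
def testCone (h : ℕ → X →ᵇ ℝ) : AddSubmonoid (X →ᵇ ℝ) :=
  AddSubmonoid.closure {ψ | ∃ (k : ℕ) (φ : X →ᵇ ℝ), (∀ x, 0 ≤ φ x) ∧ ψ = φ * h k}

variable {h : ℕ → X →ᵇ ℝ}

lemma mul_mem_testCone_of_generator (k : ℕ) {φ : X →ᵇ ℝ} (hφ : ∀ x, 0 ≤ φ x) :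
    φ * h k ∈ testCone h :=
  AddSubmonoid.subset_closure ⟨k, φ, hφ, rfl⟩

/-- Stability under nonnegative multipliers puts nonlinear expressions such as `-log (1 - y)` into
the cone: they are a bounded continuous multiple of `y`. -/
lemma mul_mem_testCone {φ ψ : X →ᵇ ℝ} (hφ : ∀ x, 0 ≤ φ x) (hψ : ψ ∈ testCone h) :
    φ * ψ ∈ testCone h := by
  induction hψ using AddSubmonoid.closure_induction with
  | mem ψ hψ =>
    obtain ⟨k, f, hf, rfl⟩ := hψ
    rw [← mul_assoc]
    exact mul_mem_testCone_of_generator k fun x => mul_nonneg (hφ x) (hf x)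
  | zero => rw [mul_zero]; exact zero_mem _
  | add x y _ _ hx hy => rw [mul_add]; exact add_mem hx hy

lemma nonneg_of_mem_testCone (h0 : ∀ k x, 0 ≤ h k x) {ψ : X →ᵇ ℝ} (hψ : ψ ∈ testCone h) (x : X) :
    0 ≤ ψ x := by
  induction hψ using AddSubmonoid.closure_induction with
  | mem ψ hψ =>
    obtain ⟨k, f, hf, rfl⟩ := hψ
    exact mul_nonneg (hf x) (h0 k x)
  | zero => simp
  | add f g _ _ hf hg => exact add_nonneg hf hg

end TestCone

/-! ### Measures on the base: reconstruction from weighted measures, topology, Laplace functionals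
-/

namespace MBase

section FirstPositive

variable {X : Type*} [TopologicalSpace X] {h : ℕ → X →ᵇ ℝ}

/-- The points at which `k` is the first index with `h k > 0`. -/
def firstPos (h : ℕ → X →ᵇ ℝ) (k : ℕ) : Set X := disjointed (fun k => {x | 0 < h k x}) k

lemma pairwise_disjoint_firstPos : Pairwise (Function.onFun Disjoint (firstPos h)) :=
  disjoint_disjointed _

lemma iUnion_firstPos (hpos : ∀ x, ∃ k, 0 < h k x) : ⋃ k, firstPos h k = Set.univ := by
  unfold firstPos
  rw [iUnion_disjointed, Set.iUnion_eq_univ_iff]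
  exact hpos

lemma pos_of_mem_firstPos {k : ℕ} {x : X} (hx : x ∈ firstPos h k) : 0 < h k x :=
  disjointed_subset (fun k => {x | 0 < h k x}) k hx

end FirstPositive

variable {X : Type*} [TopologicalSpace X] [MeasurableSpace X] {h : ℕ → X →ᵇ ℝ}

lemma continuous_integral_mul_weight (k : ℕ) (f : X →ᵇ ℝ) :
    Continuous fun ν : MBase h => ∫ x, f x * h k x ∂ν.1 := by
  have : Continuous fun (ν : MBase h) (q : ℕ × (X →ᵇ ℝ)) => ∫ x, q.2 x * h q.1 x ∂ν.1 :=
    continuous_induced_dom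
  exact (continuous_apply (k, f)).comp this

variable [BorelSpace X]

section Basic

lemma integrable_weight (h0 : ∀ k x, 0 ≤ h k x) (ν : MBase h) (k : ℕ) :
    Integrable (h k) ν.1 := by
  refine ⟨(h k).continuous.aestronglyMeasurable, ?_⟩
  rw [hasFiniteIntegral_iff_ofReal (Eventually.of_forall (h0 k))]
  exact ν.2 k

lemma integrable_mul_weight (h0 : ∀ k x, 0 ≤ h k x) (ν : MBase h) (k : ℕ) (f : X →ᵇ ℝ) :
    Integrable (fun x => f x * h k x) ν.1 :=
  (ν.integrable_weight h0 k).bdd_mul (c := ‖f‖) f.continuous.aestronglyMeasurable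
    (Eventually.of_forall f.norm_coe_le_norm)

lemma integrable_of_mem_testCone (h0 : ∀ k x, 0 ≤ h k x) (ν : MBase h) {ψ : X →ᵇ ℝ}
    (hψ : ψ ∈ testCone h) : Integrable ψ ν.1 := by
  induction hψ using AddSubmonoid.closure_induction with
  | mem ψ hψ =>
    obtain ⟨k, f, hf, rfl⟩ := hψ
    exact ν.integrable_mul_weight h0 k f
  | zero => exact integrable_zero _ _ _
  | add f g _ _ hf hg => exact hf.add hg

lemma continuous_integral_of_mem_testCone (h0 : ∀ k x, 0 ≤ h k x) {ψ : X →ᵇ ℝ}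
    (hψ : ψ ∈ testCone h) : Continuous fun ν : MBase h => ∫ x, ψ x ∂ν.1 := by
  induction hψ using AddSubmonoid.closure_induction with
  | mem ψ hψ =>
    obtain ⟨k, f, hf, rfl⟩ := hψ
    exact continuous_integral_mul_weight k f
  | zero => simpa using continuous_const
  | add f g hf' hg' hf hg =>
    simp only [BoundedContinuousFunction.coe_add, Pi.add_apply, integral_add
      (integrable_of_mem_testCone h0 _ hf') (integrable_of_mem_testCone h0 _ hg')]
    exact hf.add hg

/-- The function `ν ↦ exp (-∫ ψ dν)`. -/
def laplace (h0 : ∀ k x, 0 ≤ h k x) (ψ : testCone h) : MBase h →ᵇ ℝ :=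
  BoundedContinuousFunction.ofNormedAddCommGroup (fun ν => Real.exp (-∫ x, ψ.1 x ∂ν.1))
    (Real.continuous_exp.comp (continuous_integral_of_mem_testCone h0 ψ.2).neg) 1 (fun ν => by
      rw [Real.norm_of_nonneg (Real.exp_pos _).le, Real.exp_le_one_iff, neg_nonpos]
      exact integral_nonneg (nonneg_of_mem_testCone h0 ψ.2))

@[simp] lemma laplace_apply (h0 : ∀ k x, 0 ≤ h k x) (ψ : testCone h) (ν : MBase h) :
    laplace h0 ψ ν = Real.exp (-∫ x, ψ.1 x ∂ν.1) := rfl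

lemma laplace_mem_Icc (h0 : ∀ k x, 0 ≤ h k x) (ψ : testCone h) (ν : MBase h) :
    laplace h0 ψ ν ∈ Set.Icc (0 : ℝ) 1 := by
  refine ⟨(Real.exp_pos _).le, ?_⟩
  rw [laplace_apply, Real.exp_le_one_iff, neg_nonpos]
  exact integral_nonneg (nonneg_of_mem_testCone h0 ψ.2)

/-- The functions `ν ↦ exp (-∫ ψ dν)` form a multiplicative family. -/
def laplaceMonoid (h0 : ∀ k x, 0 ≤ h k x) : Submonoid (MBase h →ᵇ ℝ) where
  carrier := Set.range (laplace h0)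
  one_mem' := ⟨0, by ext ν; simp⟩
  mul_mem' := by
    rintro _ _ ⟨φ, rfl⟩ ⟨ψ, rfl⟩
    refine ⟨φ + ψ, ?_⟩
    ext ν
    simp only [laplace_apply, BoundedContinuousFunction.coe_mul, Pi.mul_apply, AddSubmonoid.coe_add,
      BoundedContinuousFunction.coe_add, Pi.add_apply]
    rw [integral_add (integrable_of_mem_testCone h0 ν φ.2) (integrable_of_mem_testCone h0 ν ψ.2),
      neg_add, Real.exp_add]

/-- The finite measure with density `h k` with respect to `ν`. -/
def weighted (ν : MBase h) (k : ℕ) : Measure X :=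
  ν.1.withDensity fun x => ENNReal.ofReal (h k x)

instance (ν : MBase h) (k : ℕ) : IsFiniteMeasure (ν.weighted k) :=
  isFiniteMeasure_withDensity (ν.2 k).ne

lemma lintegral_weighted (ν : MBase h) (k : ℕ) {f : X → ℝ≥0∞} (hf : Measurable f) :
    ∫⁻ x, f x ∂ν.weighted k = ∫⁻ x, ENNReal.ofReal (h k x) * f x ∂ν.1 :=
  lintegral_withDensity_eq_lintegral_mul _ (by fun_prop) hf

lemma integral_weighted (h0 : ∀ k x, 0 ≤ h k x) (ν : MBase h) (k : ℕ) (f : X → ℝ) :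
    ∫ x, f x ∂ν.weighted k = ∫ x, f x * h k x ∂ν.1 := by
  rw [weighted, integral_withDensity_eq_integral_toReal_smul (by fun_prop) (by simp)]
  refine integral_congr_ae (Eventually.of_forall fun x => ?_)
  simp [ENNReal.toReal_ofReal (h0 k x), mul_comm]

end Basic

section Reconstruction

lemma measurableSet_firstPos (k : ℕ) : MeasurableSet (firstPos h k) :=
  MeasurableSet.disjointed (fun k => (isOpen_lt continuous_const (h k).continuous).measurableSet) k

/-- The measure which has density `(h k)⁻¹` with respect to `m k` where `k` is the first index
with `h k > 0`. -/
def glue (h : ℕ → X →ᵇ ℝ) (m : ℕ → Measure X) : Measure X :=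
  Measure.sum fun k => ((m k).restrict (firstPos h k)).withDensity
    fun x => (ENNReal.ofReal (h k x))⁻¹

lemma lintegral_glue (m : ℕ → Measure X) {f : X → ℝ≥0∞} (hf : Measurable f) :
    ∫⁻ x, f x ∂glue h m
      = ∑' k, ∫⁻ x in firstPos h k, (ENNReal.ofReal (h k x))⁻¹ * f x ∂m k := by
  rw [glue, lintegral_sum_measure]
  refine tsum_congr fun k => ?_
  exact lintegral_withDensity_eq_lintegral_mul _ (by fun_prop) hf

/-- On `firstPos h k` the density `h k` is positive and finite, so multiplying by it and then
dividing changes nothing; these sets partition the space. -/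
lemma glue_weighted (hpos : ∀ x, ∃ k, 0 < h k x) (ν : MBase h) : glue h ν.weighted = ν.1 := by
  ext A hA
  have hm : Measurable (A.indicator fun _ => (1 : ℝ≥0∞)) := measurable_const.indicator hA
  rw [← lintegral_indicator_one hA, ← lintegral_indicator_one hA]
  change ∫⁻ x, A.indicator (fun _ => (1 : ℝ≥0∞)) x ∂_ = ∫⁻ x, A.indicator (fun _ => (1 : ℝ≥0∞)) x ∂_
  rw [lintegral_glue _ hm, ← setLIntegral_univ, ← iUnion_firstPos hpos,
    lintegral_iUnion measurableSet_firstPos pairwise_disjoint_firstPos]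
  refine tsum_congr fun k => ?_
  rw [weighted, restrict_withDensity (measurableSet_firstPos k),
    lintegral_withDensity_eq_lintegral_mul _ (by fun_prop) (by fun_prop)]
  refine setLIntegral_congr_fun (measurableSet_firstPos k) fun x hx => ?_
  have := pos_of_mem_firstPos hx
  simp only [Pi.mul_apply]
  rw [← mul_assoc, ENNReal.mul_inv_cancel (by simpa using this) ENNReal.ofReal_ne_top, one_mul]

/-- The symmetry condition `hm` characterizes the sequences that come from a single measure: on
`firstPos h k`, dividing `h j • m k = h k • m j` by `h k` leaves `m j`. -/
lemma withDensity_glue (hpos : ∀ x, ∃ k, 0 < h k x) {m : ℕ → Measure X}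
    (hm : ∀ j k, (m k).withDensity (fun x => ENNReal.ofReal (h j x))
      = (m j).withDensity fun x => ENNReal.ofReal (h k x)) (j : ℕ) :
    (glue h m).withDensity (fun x => ENNReal.ofReal (h j x)) = m j := by
  ext A hA
  rw [withDensity_apply _ hA, ← lintegral_indicator hA, lintegral_glue _
    (Measurable.indicator (by fun_prop) hA), ← lintegral_indicator_one hA,
    ← setLIntegral_univ (μ := m j), ← iUnion_firstPos hpos,
    lintegral_iUnion measurableSet_firstPos pairwise_disjoint_firstPos]
  refine tsum_congr fun k => ?_
  have hg : Measurable fun x => (ENNReal.ofReal (h k x))⁻¹ * A.indicator 1 x :=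
    Measurable.mul (by fun_prop) (measurable_one.indicator hA)
  calc ∫⁻ x in firstPos h k, (ENNReal.ofReal (h k x))⁻¹
        * A.indicator (fun x => ENNReal.ofReal (h j x)) x ∂m k
      = ∫⁻ x in firstPos h k, (ENNReal.ofReal (h k x))⁻¹ * A.indicator 1 x
          ∂(m k).withDensity (fun x => ENNReal.ofReal (h j x)) := by
        rw [restrict_withDensity (measurableSet_firstPos k),
          lintegral_withDensity_eq_lintegral_mul _ (by fun_prop) hg]
        refine lintegral_congr fun x => ?_
        by_cases hx : x ∈ A <;> simp [hx, mul_comm]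
    _ = ∫⁻ x in firstPos h k, A.indicator 1 x ∂m j := by
        rw [hm j k, restrict_withDensity (measurableSet_firstPos k),
          lintegral_withDensity_eq_lintegral_mul _ (by fun_prop) hg]
        refine setLIntegral_congr_fun (measurableSet_firstPos k) fun x hx => ?_
        have := pos_of_mem_firstPos hx
        simp only [Pi.mul_apply]
        rw [← mul_assoc, ENNReal.mul_inv_cancel (by simpa using this) ENNReal.ofReal_ne_top,
          one_mul]

end Reconstruction

section Topology

variable [PolishSpace X]

lemma ext_of_integral (h0 : ∀ k x, 0 ≤ h k x) (hpos : ∀ x, ∃ k, 0 < h k x) {ν ν' : MBase h}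
    (heq : ∀ k (f : X →ᵇ ℝ), ∫ x, f x * h k x ∂ν.1 = ∫ x, f x * h k x ∂ν'.1) : ν = ν' := by
  refine Subtype.ext ?_
  rw [← glue_weighted hpos ν, ← glue_weighted hpos ν']
  congr 1
  ext1 k
  refine ext_of_forall_integral_eq_of_IsFiniteMeasure fun f => ?_
  rw [integral_weighted h0, integral_weighted h0]
  exact heq k f

/-- Countably many Laplace functionals induce the topology. -/
lemma exists_isInducing_laplace (h0 : ∀ k x, 0 ≤ h k x) :
    ∃ ψ : ℕ × ℕ → testCone h, IsInducing fun (ν : MBase h) i => laplace h0 (ψ i) ν := by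
  obtain ⟨φ, hφ0, hφ⟩ := exists_countable_convergenceDetermining X
  refine ⟨fun q => ⟨φ q.1 * h q.2, mul_mem_testCone_of_generator q.2 (hφ0 q.1)⟩, ?_⟩
  have h1 : IsInducing fun (ν : MBase h) (q : ℕ × ℕ) => ∫ x, φ q.1 x * h q.2 x ∂ν.1 := by
    have hcont : Continuous fun (ν : MBase h) (q : ℕ × ℕ) => ∫ x, φ q.1 x * h q.2 x ∂ν.1 :=
      continuous_pi fun q => continuous_integral_mul_weight q.2 (φ q.1)
    refine isInducing_iff_nhds.mpr fun ν => le_antisymm hcont.continuousAt.le_comap ?_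
    rw [nhds_induced, ← tendsto_iff_comap, tendsto_pi_nhds]
    rintro ⟨k, f⟩
    -- The filter is pulled back from a countable product of lines, hence countably generated, and
    -- sequences suffice. For these the countable family `φ` determines weak convergence of the
    -- measures `weighted k`.
    refine tendsto_of_seq_tendsto fun u hu => ?_
    have hu' := tendsto_pi_nhds.mp (tendsto_comap_iff.mp hu)
    simp only [Function.comp_def] at hu' ⊢
    simp only [← integral_weighted h0] at hu' ⊢
    exact hφ (fun n => (u n).weighted k) (ν.weighted k) (fun n => inferInstance) inferInstance
      (fun i => hu' (i, k)) f
  have h2 : IsInducing fun t : ℝ => Real.exp (-t) := by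
    have : IsInducing fun t : ℝ => -t := (Homeomorph.neg ℝ).isInducing
    exact Real.isOpenEmbedding_exp.isInducing.comp this
  exact (IsInducing.piMap (f := fun (_ : ℕ × ℕ) (t : ℝ) => Real.exp (-t)) fun _ => h2).comp h1

lemma t2Space (h0 : ∀ k x, 0 ≤ h k x) (hpos : ∀ x, ∃ k, 0 < h k x) : T2Space (MBase h) := by
  refine T2Space.of_injective_continuous
    (f := fun (ν : MBase h) (q : ℕ × (X →ᵇ ℝ)) => ∫ x, q.2 x * h q.1 x ∂ν.1)
    (fun ν ν' hνν' => ext_of_integral h0 hpos fun k f => congrFun hνν' (k, f))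
    continuous_induced_dom

lemma metrizableSpace (h0 : ∀ k x, 0 ≤ h k x) (hpos : ∀ x, ∃ k, 0 < h k x) :
    TopologicalSpace.MetrizableSpace (MBase h) := by
  have := t2Space h0 hpos
  obtain ⟨ψ, hψ⟩ := exists_isInducing_laplace h0
  have := hψ.pseudoMetrizableSpace
  exact ⟨⟩

/-- Convergence of the Laplace functionals implies weak convergence. -/
theorem tendsto_of_laplace (h0 : ∀ k x, 0 ≤ h k x) {R : ℕ → ProbabilityMeasure (MBase h)}
    {R₀ : ProbabilityMeasure (MBase h)}
    (hR : ∀ ψ : testCone h, Tendsto (fun n => ∫ ν, laplace h0 ψ ν ∂(R n : Measure (MBase h))) atTop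
      (𝓝 (∫ ν, laplace h0 ψ ν ∂(R₀ : Measure (MBase h))))) :
    Tendsto R atTop (𝓝 R₀) := by
  obtain ⟨ψ, hψ⟩ := exists_isInducing_laplace h0
  refine tendsto_of_isInducing (fun i => laplace h0 (ψ i)) (fun i => laplace_mem_Icc h0 (ψ i)) hψ
    (laplaceMonoid h0) (fun i => ⟨ψ i, rfl⟩) ?_
  rintro _ ⟨φ, rfl⟩
  exact hR φ

/-- The Laplace functional determines a probability measure. -/
theorem eq_of_laplace (h0 : ∀ k x, 0 ≤ h k x) (hpos : ∀ x, ∃ k, 0 < h k x)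
    {R R₀ : ProbabilityMeasure (MBase h)}
    (hR : ∀ ψ : testCone h, ∫ ν, laplace h0 ψ ν ∂(R : Measure (MBase h))
      = ∫ ν, laplace h0 ψ ν ∂(R₀ : Measure (MBase h))) : R = R₀ := by
  have := metrizableSpace h0 hpos
  -- The constant sequence `R` converges both to `R` and, by its Laplace functionals, to `R₀`.
  refine tendsto_nhds_unique (tendsto_const_nhds (f := atTop (α := ℕ)))
    (tendsto_of_laplace h0 (R := fun _ => R) fun ψ => ?_)
  rw [hR ψ]
  exact tendsto_const_nhds

/-- The evaluation maps are Borel measurable. -/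
lemma measurable_val (h0 : ∀ k x, 0 ≤ h k x) (hpos : ∀ x, ∃ k, 0 < h k x) :
    Measurable fun ν : MBase h => ν.1 := by
  have hw (k : ℕ) : Measurable fun ν : MBase h => ν.weighted k := by
    refine measurable_measure_of_lintegral fun f => ?_
    have (ν : MBase h) : ∫⁻ x, f x ∂ν.weighted k
        = ENNReal.ofReal (∫ x, (f x : ℝ) * h k x ∂ν.1) := by
      rw [← integral_weighted h0 ν k, lintegral_coe_eq_integral]
      exact (f.comp (fun r : ℝ≥0 => (r : ℝ)) isometry_subtype_coe.lipschitz).integrable _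
    simp only [this]
    exact (continuous_integral_mul_weight k
      (f.comp (fun r : ℝ≥0 => (r : ℝ)) isometry_subtype_coe.lipschitz)).measurable.ennreal_ofReal
  refine Measure.measurable_of_measurable_coe _ fun A hA => ?_
  -- Evaluation at `A` is recovered from the finite measures `weighted k`, whose measurability has
  -- just been obtained from continuous functionals.
  have (ν : MBase h) : ν.1 A = ∑' k, ∫⁻ x, (firstPos h k).indicator
      (fun x => (ENNReal.ofReal (h k x))⁻¹ * A.indicator 1 x) x ∂ν.weighted k := by
    rw [← lintegral_indicator_one hA, ← glue_weighted hpos ν,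
      lintegral_glue _ (measurable_one.indicator hA)]
    exact tsum_congr fun k => (lintegral_indicator (measurableSet_firstPos k) _).symm
  simp only [this]
  refine Measurable.tsum fun k => ?_
  refine (Measure.measurable_lintegral ?_).comp (hw k)
  exact (Measurable.mul (by fun_prop) (measurable_one.indicator hA)).indicator
    (measurableSet_firstPos k)

/-- A map into the measures is Borel measurable if all its evaluations are measurable. -/
lemma measurable_of_measurable_val (h0 : ∀ k x, 0 ≤ h k x) {Ω : Type*} [MeasurableSpace Ω]
    {Y : Ω → MBase h} (hY : Measurable fun ω => (Y ω).1) : Measurable Y := by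
  obtain ⟨ψ, hψ⟩ := exists_isInducing_laplace h0
  have : Measurable fun ω i => laplace h0 (ψ i) (Y ω) := by
    rw [measurable_pi_iff]
    intro i
    refine Real.measurable_exp.comp (Measurable.neg ?_)
    have hint (ω : Ω) : ∫ x, (ψ i).1 x ∂(Y ω).1
        = (∫⁻ x, ENNReal.ofReal ((ψ i).1 x) ∂(Y ω).1).toReal :=
      integral_eq_lintegral_of_nonneg_ae
        (Eventually.of_forall (nonneg_of_mem_testCone h0 (ψ i).2))
        (ψ i).1.continuous.aestronglyMeasurable
    simp only [hint]
    exact ((Measure.measurable_lintegral (by fun_prop)).comp hY).ennreal_toReal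
  -- Open sets are preimages of open sets of a countable product of lines, so measurability of
  -- countably many Laplace functionals is enough.
  refine measurable_of_isOpen fun U hU => ?_
  obtain ⟨V, hV, rfl⟩ := hψ.isOpen_iff.mp hU
  exact this hV.measurableSet

end Topology

end MBase

/-! ### Compact sets of measures -/

/-- Antitone sequences of continuous functions tending to zero whose small values single out
totally bounded sets. -/
lemma exists_antitone_tendsto_zero_subset_balls (X : Type*) [MetricSpace X]
    [SecondCountableTopology X] {r : ℝ} (hr : 0 < r) :
    ∃ φ : ℕ → X →ᵇ ℝ, (∀ i x, 0 ≤ φ i x) ∧ (∀ x, Antitone fun i => φ i x) ∧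
      (∀ x, Tendsto (fun i => φ i x) atTop (𝓝 0)) ∧
      ∀ i, ∃ F : Set X, F.Finite ∧ {x | φ i x ≤ 1 / 2} ⊆ ⋃ y ∈ F, Metric.ball y r := by
  rcases isEmpty_or_nonempty X with hX | hX
  · exact ⟨0, fun i x => hX.elim x, fun x => hX.elim x, fun x => hX.elim x,
      fun i => ⟨∅, Set.finite_empty, fun x _ => hX.elim x⟩⟩
  obtain ⟨s, hs⟩ := TopologicalSpace.exists_dense_seq X
  let F : ℕ → Set X := fun i => s '' Set.Iic i
  have hFfin (i) : (F i).Finite := (Set.finite_Iic i).image s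
  have hFne (i) : (F i).Nonempty := ⟨s 0, 0, Nat.zero_le i, rfl⟩
  have hFmono : Monotone F := fun i j hij => Set.image_mono (Set.Iic_subset_Iic.mpr hij)
  -- The distance to the first `i + 1` points of a dense sequence, in units of `r` and truncated at
  -- `1`. A value at most `1 / 2` places the point within `r` of one of these points.
  let φ : ℕ → X →ᵇ ℝ := fun i => BoundedContinuousFunction.ofNormedAddCommGroup
    (fun x => min 1 (r⁻¹ * Metric.infDist x (F i)))
    (continuous_const.min (continuous_const.mul (Metric.continuous_infDist_pt _))) 1 (fun x => by
      rw [Real.norm_of_nonneg (le_min zero_le_one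
        (mul_nonneg (inv_nonneg.mpr hr.le) Metric.infDist_nonneg))]
      exact min_le_left _ _)
  have hφ (i x) : φ i x = min 1 (r⁻¹ * Metric.infDist x (F i)) := rfl
  have hφ0 (i x) : 0 ≤ φ i x :=
    le_min zero_le_one (mul_nonneg (inv_nonneg.mpr hr.le) Metric.infDist_nonneg)
  have hanti (x) : Antitone fun i => φ i x := fun i j hij => by
    simp only [hφ]
    have := Metric.infDist_le_infDist_of_subset (x := x) (hFmono hij) (hFne i)
    gcongr
  refine ⟨φ, hφ0, hanti, fun x => ?_, fun i => ⟨F i, hFfin i, fun x hx => ?_⟩⟩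
  · rw [Metric.tendsto_atTop]
    intro ε hε
    obtain ⟨_, ⟨i, rfl⟩, hy⟩ := Metric.mem_closure_iff.mp (hs x) (r * ε) (by positivity)
    refine ⟨i, fun j hj => ?_⟩
    rw [Real.dist_0_eq_abs, abs_of_nonneg (hφ0 j x)]
    refine (hanti x hj).trans_lt ((min_le_right _ _).trans_lt ?_)
    calc r⁻¹ * Metric.infDist x (F i) ≤ r⁻¹ * dist x (s i) := by
          gcongr
          exact Metric.infDist_le_dist_of_mem ⟨i, Set.mem_Iic.mpr le_rfl, rfl⟩
      _ < r⁻¹ * (r * ε) := by gcongr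
      _ = ε := by field_simp
  · have hx' : min 1 (r⁻¹ * Metric.infDist x (F i)) ≤ 1 / 2 := hx
    have h1 : r⁻¹ * Metric.infDist x (F i) < 1 := by
      rcases min_le_iff.mp hx' with h | h
      · norm_num at h
      · linarith
    have h2 : Metric.infDist x (F i) < r := by
      rwa [inv_mul_lt_iff₀ hr, mul_one] at h1
    obtain ⟨y, hy, hxy⟩ := (Metric.infDist_lt_iff (hFne i)).mp h2
    exact Set.mem_biUnion hy hxy

namespace MBase

variable {X : Type*} [TopologicalSpace X] [MeasurableSpace X] [BorelSpace X] {h : ℕ → X →ᵇ ℝ}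

/-- The sequence of finite measures with densities `h k`. -/
def toFiniteMeasures (ν : MBase h) (k : ℕ) : FiniteMeasure X := ⟨ν.weighted k, inferInstance⟩

lemma integral_toFiniteMeasures (h0 : ∀ k x, 0 ≤ h k x) (ν : MBase h) (k : ℕ) (f : X →ᵇ ℝ) :
    ∫ x, f x ∂(ν.toFiniteMeasures k : Measure X) = ∫ x, f x * h k x ∂ν.1 :=
  integral_weighted h0 ν k f

lemma isInducing_toFiniteMeasures (h0 : ∀ k x, 0 ≤ h k x) :
    IsInducing (toFiniteMeasures (h := h)) := by
  refine isInducing_iff_nhds.mpr fun ν => le_antisymm (tendsto_iff_comap.mp ?_) ?_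
  · refine tendsto_pi_nhds.mpr fun k => ?_
    refine FiniteMeasure.tendsto_iff_forall_integral_tendsto.mpr fun f => ?_
    simp only [integral_toFiniteMeasures h0]
    exact (continuous_integral_mul_weight k f).continuousAt
  · rw [nhds_induced, ← tendsto_iff_comap, tendsto_pi_nhds]
    rintro ⟨k, f⟩
    have h1 := tendsto_pi_nhds.mp
      (tendsto_comap (f := toFiniteMeasures (h := h)) (x := 𝓝 ν.toFiniteMeasures)) k
    simpa only [integral_toFiniteMeasures h0] using
      FiniteMeasure.tendsto_iff_forall_integral_tendsto.mp h1 f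

variable [PolishSpace X]

/-- The range is cut out by the conditions ∫ f h_j dm_k = ∫ f h_k dm_j: they are closed, and by
`withDensity_glue` they suffice for `m` to come from one measure. Closedness brings compactness back
from the product of spaces of finite measures. -/
lemma isClosedEmbedding_toFiniteMeasures (h0 : ∀ k x, 0 ≤ h k x) (hpos : ∀ x, ∃ k, 0 < h k x) :
    IsClosedEmbedding (toFiniteMeasures (h := h)) := by
  refine ⟨⟨isInducing_toFiniteMeasures h0, fun ν ν' hνν' => ?_⟩, ?_⟩
  · refine ext_of_integral h0 hpos fun k f => ?_
    rw [← integral_toFiniteMeasures h0, ← integral_toFiniteMeasures h0, hνν']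
  have hrange : Set.range (toFiniteMeasures (h := h)) = ⋂ (j : ℕ) (k : ℕ) (f : X →ᵇ ℝ),
      {m : ℕ → FiniteMeasure X | ∫ x, (f * h j) x ∂(m k : Measure X)
        = ∫ x, (f * h k) x ∂(m j : Measure X)} := by
    refine Set.Subset.antisymm ?_ fun m hm => ?_
    · rintro _ ⟨ν, rfl⟩
      simp only [Set.mem_iInter, Set.mem_ofPred_eq]
      intro j k f
      rw [integral_toFiniteMeasures h0, integral_toFiniteMeasures h0]
      refine integral_congr_ae (Eventually.of_forall fun x => ?_)
      simp only [BoundedContinuousFunction.coe_mul, Pi.mul_apply]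
      ring
    · simp only [Set.mem_iInter, Set.mem_ofPred_eq] at hm
      have hfin (μ : Measure X) [IsFiniteMeasure μ] (j : ℕ) :
          IsFiniteMeasure (μ.withDensity fun x => ENNReal.ofReal (h j x)) := by
        refine isFiniteMeasure_withDensity ?_
        have := ((h j).integrable μ).2
        rw [hasFiniteIntegral_iff_ofReal (Eventually.of_forall (h0 j))] at this
        exact this.ne
      have hsymm (j k) : (m k : Measure X).withDensity (fun x => ENNReal.ofReal (h j x))
          = (m j : Measure X).withDensity fun x => ENNReal.ofReal (h k x) := by
        have := hfin (m k) j
        have := hfin (m j) k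
        refine ext_of_forall_integral_eq_of_IsFiniteMeasure fun f => ?_
        have key (μ : Measure X) (j : ℕ) :
            ∫ x, f x ∂(μ.withDensity fun x => ENNReal.ofReal (h j x))
              = ∫ x, (f * h j) x ∂μ := by
          rw [integral_withDensity_eq_integral_toReal_smul (by fun_prop) (by simp)]
          refine integral_congr_ae (Eventually.of_forall fun x => ?_)
          simp [ENNReal.toReal_ofReal (h0 j x), mul_comm]
        rw [key, key, hm j k f]
      have hglue := withDensity_glue hpos hsymm
      refine ⟨⟨glue h fun k => (m k : Measure X), fun k => ?_⟩, ?_⟩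
      · rw [← setLIntegral_univ, ← withDensity_apply _ MeasurableSet.univ, hglue k]
        exact measure_lt_top _ _
      · ext1 k
        exact Subtype.ext (hglue k)
  rw [hrange]
  refine isClosed_iInter fun j => isClosed_iInter fun k => isClosed_iInter fun f => ?_
  refine isClosed_eq ?_ ?_
  · exact (FiniteMeasure.continuous_integral_boundedContinuousFunction (f * h j)).comp
      (continuous_apply k)
  · exact (FiniteMeasure.continuous_integral_boundedContinuousFunction (f * h k)).comp
      (continuous_apply j)

/-- A criterion for compactness. -/
lemma isCompact_setOf_weighted_le (h0 : ∀ k x, 0 ≤ h k x) (hpos : ∀ x, ∃ k, 0 < h k x)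
    (C : ℕ → ℝ≥0) {K : ℕ → ℕ → Set X} (hK : ∀ k j, IsCompact (K k j)) {u : ℕ → ℝ≥0}
    (hu : Tendsto u atTop (𝓝 0)) :
    IsCompact {ν : MBase h | ∀ k, ν.weighted k Set.univ ≤ C k ∧
      ∀ j, ν.weighted k (K k j)ᶜ ≤ u j} := by
  -- Prokhorov's criterion in each coordinate; the product is then compact by Tychonoff's theorem.
  have h1 (k : ℕ) := isCompact_setOfPred_finiteMeasure_mass_le_compl_isCompact_le (C k) hu (hK k)
    (Or.inl inferInstance)
  have h2 := (isClosedEmbedding_toFiniteMeasures h0 hpos).isCompact_preimage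
    (isCompact_univ_pi h1)
  convert h2 using 1
  ext ν
  simp only [Set.mem_ofPred_eq, Set.mem_preimage, Set.mem_pi, Set.mem_univ, true_imp_iff]
  refine forall_congr' fun k => ?_
  have hc (A : Set X) (c : ℝ≥0) : ν.weighted k A ≤ c ↔ ν.toFiniteMeasures k A ≤ c := by
    rw [← ENNReal.coe_le_coe, FiniteMeasure.ennreal_coeFn_eq_coeFn_toMeasure]
    rfl
  exact and_congr (hc _ _) (forall_congr' fun j => hc _ _)

end MBase

/-! ### Tightness and a continuity theorem for Laplace functionals -/

namespace MBase

variable {X : Type*} [TopologicalSpace X] [MeasurableSpace X] [BorelSpace X] {h : ℕ → X →ᵇ ℝ}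

/-- Markov's inequality for 1 - exp(-t): where t > 1 this is at least 1 - 1/e ≥ 1/2, whence the
factor 2. -/
lemma measure_one_lt_integral_le (h0 : ∀ k x, 0 ≤ h k x) (R : ProbabilityMeasure (MBase h))
    (ψ : testCone h) :
    (R : Measure (MBase h)) {ν | 1 < ∫ x, ψ.1 x ∂ν.1}
      ≤ ENNReal.ofReal (2 * (1 - ∫ ν, laplace h0 ψ ν ∂(R : Measure (MBase h)))) := by
  have hint := (laplace h0 ψ).integrable (R : Measure (MBase h))
  have hint' : Integrable (fun ν => 2 * (1 - laplace h0 ψ ν)) (R : Measure (MBase h)) :=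
    ((integrable_const _).sub hint).const_mul 2
  have h1 : 2 * (1 - ∫ ν, laplace h0 ψ ν ∂(R : Measure (MBase h)))
      = ∫ ν, 2 * (1 - laplace h0 ψ ν) ∂(R : Measure (MBase h)) := by
    rw [integral_const_mul, integral_sub (integrable_const _) hint]
    simp
  have hnn (ν : MBase h) : 0 ≤ 2 * (1 - laplace h0 ψ ν) := by
    linarith [(laplace_mem_Icc h0 ψ ν).2]
  rw [h1, ofReal_integral_eq_lintegral_ofReal hint' (Eventually.of_forall hnn)]
  have hmeas : MeasurableSet {ν : MBase h | 1 < ∫ x, ψ.1 x ∂ν.1} :=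
    (isOpen_lt continuous_const (continuous_integral_of_mem_testCone h0 ψ.2)).measurableSet
  rw [← lintegral_indicator_one hmeas]
  refine lintegral_mono fun ν => ?_
  by_cases hν : 1 < ∫ x, ψ.1 x ∂ν.1
  · have : ν ∈ {ν : MBase h | 1 < ∫ x, ψ.1 x ∂ν.1} := hν
    simp only [this, Set.indicator_of_mem, Pi.one_apply, ENNReal.one_le_ofReal, laplace_apply]
    have h2 : Real.exp (-∫ x, ψ.1 x ∂ν.1) ≤ Real.exp (-1) := Real.exp_le_exp.mpr (by linarith)
    have h3 : Real.exp (-1) ≤ 1 / 2 := by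
      rw [Real.exp_neg, one_div]
      exact inv_anti₀ (by norm_num) (by linarith [Real.add_one_le_exp 1])
    linarith
  · have : ν ∉ {ν : MBase h | 1 < ∫ x, ψ.1 x ∂ν.1} := hν
    simp [this]

section

variable {R : ℕ → ProbabilityMeasure (MBase h)} {ℓ : testCone h → ℝ}

/-- Uniform smallness of the Laplace functionals along antitone null sequences. -/
lemma exists_forall_one_sub_laplace_le (h0 : ∀ k x, 0 ≤ h k x)
    (hR : ∀ ψ : testCone h, Tendsto (fun n => ∫ ν, laplace h0 ψ ν ∂(R n : Measure (MBase h))) atTop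
      (𝓝 (ℓ ψ)))
    (k : ℕ) {φ : ℕ → X →ᵇ ℝ} (hφ0 : ∀ i x, 0 ≤ φ i x) (hanti : ∀ x, Antitone fun i => φ i x)
    (hlim : ∀ x, Tendsto (fun i => φ i x) atTop (𝓝 0))
    (hℓ : Tendsto (fun i => ℓ ⟨φ i * h k, mul_mem_testCone_of_generator k (hφ0 i)⟩) atTop (𝓝 1))
    {ε : ℝ} (hε : 0 < ε) :
    ∃ i, ∀ n, 1 - ∫ ν, laplace h0 ⟨φ i * h k, mul_mem_testCone_of_generator k (hφ0 i)⟩ ν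
      ∂(R n : Measure (MBase h)) ≤ ε := by
  set ψ : ℕ → testCone h := fun i => ⟨φ i * h k, mul_mem_testCone_of_generator k (hφ0 i)⟩ with hψ
  have hψanti (ν : MBase h) : Antitone fun i => ∫ x, (ψ i).1 x ∂ν.1 := fun i j hij =>
    integral_mono (integrable_of_mem_testCone h0 ν (ψ j).2)
      (integrable_of_mem_testCone h0 ν (ψ i).2)
      fun x => mul_le_mul_of_nonneg_right (hanti x hij) (h0 k x)
  have hψlim (ν : MBase h) : Tendsto (fun i => ∫ x, (ψ i).1 x ∂ν.1) atTop (𝓝 0) := by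
    have := tendsto_integral_of_dominated_convergence (μ := ν.1) (F := fun i => (ψ i).1)
      (f := fun _ => 0) (fun x => φ 0 x * h k x)
      (fun i => (ψ i).1.continuous.aestronglyMeasurable) (ν.integrable_mul_weight h0 k (φ 0))
      (fun i => Eventually.of_forall fun x => ?_) (Eventually.of_forall fun x => ?_)
    · simpa using this
    · rw [Real.norm_of_nonneg (nonneg_of_mem_testCone h0 (ψ i).2 x)]
      exact mul_le_mul_of_nonneg_right (hanti x (Nat.zero_le i)) (h0 k x)
    · rw [← zero_mul (h k x)]
      exact (hlim x).mul_const (h k x)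
  have hmono (n : ℕ) : Monotone fun i => ∫ ν, laplace h0 (ψ i) ν ∂(R n : Measure (MBase h)) :=
    fun i j hij => integral_mono ((laplace h0 _).integrable _) ((laplace h0 _).integrable _)
      fun ν => Real.exp_le_exp.mpr (neg_le_neg (hψanti ν hij))
  have hone (n : ℕ) : Tendsto (fun i => ∫ ν, laplace h0 (ψ i) ν ∂(R n : Measure (MBase h))) atTop
      (𝓝 1) := by
    have := tendsto_integral_of_dominated_convergence (μ := (R n : Measure (MBase h)))
      (F := fun i => laplace h0 (ψ i)) (f := fun _ => 1) (fun _ => 1)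
      (fun i => (laplace h0 (ψ i)).continuous.aestronglyMeasurable) (integrable_const _)
      (fun i => Eventually.of_forall fun ν => ?_) (Eventually.of_forall fun ν => ?_)
    · simpa using this
    · rw [Real.norm_of_nonneg (laplace_mem_Icc h0 _ ν).1]
      exact (laplace_mem_Icc h0 _ ν).2
    · have := (Real.continuous_exp.tendsto _).comp (hψlim ν).neg
      rwa [neg_zero, Real.exp_zero] at this
  -- The limit `ℓ` gives one index that serves all `n ≥ N`, and each of the finitely many remaining
  -- `n` has its own. By monotonicity in `i` the largest index serves all of them.
  obtain ⟨i₀, hi₀⟩ := (hℓ.eventually_const_lt (show 1 - ε < 1 by linarith)).exists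
  obtain ⟨N, hN⟩ := eventually_atTop.mp ((hR (ψ i₀)).eventually_const_lt hi₀)
  have hfin : ∀ n : ℕ, ∃ i, 1 - ε < ∫ ν, laplace h0 (ψ i) ν ∂(R n : Measure (MBase h)) :=
    fun n => ((hone n).eventually_const_lt (show 1 - ε < 1 by linarith)).exists
  choose I hI using hfin
  refine ⟨max i₀ ((Finset.range N).sup I), fun n => ?_⟩
  have key : 1 - ε < ∫ ν, laplace h0 (ψ (max i₀ ((Finset.range N).sup I))) ν
      ∂(R n : Measure (MBase h)) := by
    rcases le_or_gt N n with hn | hn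
    · exact (hN n hn).trans_le (hmono n (le_max_left _ _))
    · exact (hI n).trans_le (hmono n ((Finset.le_sup (Finset.mem_range.mpr hn)).trans
        (le_max_right _ _)))
  linarith

/-- Uniform tail bounds along antitone null sequences. -/
lemma exists_forall_measure_lt_integral_le (h0 : ∀ k x, 0 ≤ h k x)
    (hR : ∀ ψ : testCone h, Tendsto (fun n => ∫ ν, laplace h0 ψ ν ∂(R n : Measure (MBase h))) atTop
      (𝓝 (ℓ ψ)))
    (hℓ : ∀ (k : ℕ) (φ : ℕ → X →ᵇ ℝ) (hφ0 : ∀ i x, 0 ≤ φ i x), (∀ x, Antitone fun i => φ i x) →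
      (∀ x, Tendsto (fun i => φ i x) atTop (𝓝 0)) →
      Tendsto (fun i => ℓ ⟨φ i * h k, mul_mem_testCone_of_generator k (hφ0 i)⟩) atTop (𝓝 1))
    (k : ℕ) {φ : ℕ → X →ᵇ ℝ} (hφ0 : ∀ i x, 0 ≤ φ i x) (hanti : ∀ x, Antitone fun i => φ i x)
    (hlim : ∀ x, Tendsto (fun i => φ i x) atTop (𝓝 0)) {δ : ℝ} (hδ : 0 < δ) {ε : ℝ≥0∞}
    (hε : 0 < ε) :
    ∃ i, ∀ n, (R n : Measure (MBase h)) {ν | δ < ∫ x, φ i x * h k x ∂ν.1} ≤ ε := by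
  obtain ⟨ε', hε'0, hε'⟩ : ∃ ε' : ℝ≥0, 0 < ε' ∧ (ε' : ℝ≥0∞) ≤ ε := by
    obtain ⟨e, he0, he⟩ := ENNReal.lt_iff_exists_nnreal_btwn.mp hε
    exact ⟨e, by exact_mod_cast he0, he.le⟩
  -- Rescaling moves the threshold `δ` to `1`. The Laplace bound `ε' / 2` used below absorbs the
  -- factor 2 of `measure_one_lt_integral_le`.
  let φ' : ℕ → X →ᵇ ℝ := fun i => δ⁻¹ • φ i
  have hφ' (i x) : φ' i x = δ⁻¹ * φ i x := rfl
  have hφ'0 (i x) : 0 ≤ φ' i x := mul_nonneg (inv_nonneg.mpr hδ.le) (hφ0 i x)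
  have hanti' (x) : Antitone fun i => φ' i x := fun i j hij =>
    mul_le_mul_of_nonneg_left (hanti x hij) (inv_nonneg.mpr hδ.le)
  have hlim' (x) : Tendsto (fun i => φ' i x) atTop (𝓝 0) := by
    simpa [hφ'] using (hlim x).const_mul δ⁻¹
  obtain ⟨i, hi⟩ := exists_forall_one_sub_laplace_le h0 hR k hφ'0 hanti' hlim'
    (hℓ k φ' hφ'0 hanti' hlim') (ε := ε' / 2) (by positivity)
  refine ⟨i, fun n => ?_⟩
  have hset : {ν : MBase h | δ < ∫ x, φ i x * h k x ∂ν.1}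
      = {ν : MBase h | 1 < ∫ x, (φ' i * h k) x ∂ν.1} := by
    ext ν
    have : ∫ x, (φ' i * h k) x ∂ν.1 = δ⁻¹ * ∫ x, φ i x * h k x ∂ν.1 := by
      rw [← integral_const_mul]
      refine integral_congr_ae (Eventually.of_forall fun x => ?_)
      simp [hφ', mul_assoc]
    simp only [Set.mem_ofPred_eq, this]
    rw [lt_inv_mul_iff₀ hδ, mul_one]
  rw [hset]
  refine (measure_one_lt_integral_le h0 (R n)
    ⟨φ' i * h k, mul_mem_testCone_of_generator k (hφ'0 i)⟩).trans (le_trans ?_ hε')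
  rw [← ENNReal.ofReal_coe_nnreal]
  refine ENNReal.ofReal_le_ofReal ?_
  linarith [hi n]

variable [PolishSpace X]

/-- Tightness from convergence of the Laplace functionals to a continuous limit. -/
lemma isTightMeasureSet_of_laplace (h0 : ∀ k x, 0 ≤ h k x) (hpos : ∀ x, ∃ k, 0 < h k x)
    (hR : ∀ ψ : testCone h, Tendsto (fun n => ∫ ν, laplace h0 ψ ν ∂(R n : Measure (MBase h))) atTop
      (𝓝 (ℓ ψ)))
    (hℓ : ∀ (k : ℕ) (φ : ℕ → X →ᵇ ℝ) (hφ0 : ∀ i x, 0 ≤ φ i x), (∀ x, Antitone fun i => φ i x) →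
      (∀ x, Tendsto (fun i => φ i x) atTop (𝓝 0)) →
      Tendsto (fun i => ℓ ⟨φ i * h k, mul_mem_testCone_of_generator k (hφ0 i)⟩) atTop (𝓝 1)) :
    IsTightMeasureSet {(μ : Measure (MBase h)) | μ ∈ Set.range R} := by
  let := TopologicalSpace.upgradeIsCompletelyMetrizable X
  rw [isTightMeasureSet_iff_exists_isCompact_measure_compl_le]
  intro ε hε
  have htail := fun k {φ : ℕ → X →ᵇ ℝ} => exists_forall_measure_lt_integral_le h0 hR hℓ k (φ := φ)
  -- Half of `ε` is distributed over the mass bounds, indexed by `k`, and half over the tail bounds,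
  -- indexed by triples `(k, j, l)`: weight, tail level `1 / (j + 1)`, and ball radius `1 / (l +
  -- 1)`.
  obtain ⟨ε₁, hε₁0, hε₁⟩ := ENNReal.exists_pos_sum_of_countable' (ε := ε / 2)
    (by simpa using hε.ne') ℕ
  obtain ⟨ε₂, hε₂0, hε₂⟩ := ENNReal.exists_pos_sum_of_countable' (ε := ε / 2)
    (by simpa using hε.ne') (ℕ × ℕ × ℕ)
  -- bounds on the total masses
  have hmass (k : ℕ) : ∃ C : ℝ≥0, 0 < C ∧ ∀ n, (R n : Measure (MBase h))
      {ν | (C : ℝ) < ∫ x, h k x ∂ν.1} ≤ ε₁ k := by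
    -- The constants `1 / (i + 1)` are an antitone null sequence; for them the tail bound at level
    -- `1` says that the total mass exceeds `i + 1` with small probability.
    obtain ⟨i, hi⟩ := htail k (φ := fun i => BoundedContinuousFunction.const X (1 / ((i : ℝ) + 1)))
      (fun i x => by simp; positivity) (fun x i j hij => by
        simp only [BoundedContinuousFunction.const_apply]
        gcongr) (fun x => by
        simpa using tendsto_one_div_add_atTop_nhds_zero_nat (𝕜 := ℝ)) one_pos (hε₁0 k)
    refine ⟨i + 1, by positivity, fun n => (measure_mono fun ν hν => ?_).trans (hi n)⟩
    have hν' : (i : ℝ) + 1 < ∫ x, h k x ∂ν.1 := by simpa using hν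
    simp only [BoundedContinuousFunction.const_apply, Set.mem_ofPred_eq]
    rw [integral_const_mul, one_div, lt_inv_mul_iff₀ (by positivity), mul_one]
    exact hν'
  choose C hC0 hC using hmass
  -- bounds on the mass outside totally bounded sets
  choose φ hφ0 hanti hlim F hF hφF using fun l : ℕ =>
    exists_antitone_tendsto_zero_subset_balls X (r := 1 / ((l : ℝ) + 1)) (by positivity)
  -- The allowances `δ j l` add up over `l` to less than the tail level `1 / (j + 1)`. They are
  -- halved in `hout` because Markov's inequality is applied at height `1 / 2`.
  have hδ (j : ℕ) : ∃ δ : ℕ → ℝ≥0, (∀ l, 0 < δ l) ∧ ∑' l, (δ l : ℝ≥0∞) < 1 / ((j : ℝ≥0∞) + 1) :=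
    ENNReal.exists_pos_sum_of_countable (by simp) ℕ
  choose δ hδ0 hδ using hδ
  have hout (q : ℕ × ℕ × ℕ) : ∃ i, ∀ n, (R n : Measure (MBase h))
      {ν | (δ q.2.1 q.2.2 : ℝ) / 2 < ∫ x, φ q.2.2 i x * h q.1 x ∂ν.1} ≤ ε₂ q :=
    htail q.1 (hφ0 q.2.2) (hanti q.2.2) (hlim q.2.2) (half_pos (hδ0 _ _)) (hε₂0 q)
  choose I hI using hout
  -- Closed, and for every `l` covered by finitely many balls of radius `1 / (l + 1)`: hence compact
  -- in a complete space.
  let K : ℕ → ℕ → Set X := fun k j => ⋂ l, {x | φ l (I (k, j, l)) x ≤ 1 / 2}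
  have hK (k j) : IsCompact (K k j) := by
    refine isCompact_iff_totallyBounded_isComplete.mpr ⟨?_,
      (isClosed_iInter fun l => isClosed_le (φ l _).continuous continuous_const).isComplete⟩
    rw [Metric.totallyBounded_iff]
    intro r hr
    obtain ⟨l, hl⟩ := exists_nat_one_div_lt hr
    refine ⟨F l (I (k, j, l)), hF _ _, fun x hx => ?_⟩
    obtain ⟨y, hy, hxy⟩ := Set.mem_iUnion₂.mp (hφF l _ (Set.mem_iInter.mp hx l))
    exact Set.mem_iUnion₂.mpr ⟨y, hy, Metric.ball_subset_ball hl.le hxy⟩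
  have hu : Tendsto (fun j : ℕ => 1 / ((j : ℝ≥0) + 1)) atTop (𝓝 0) :=
    tendsto_one_div_add_atTop_nhds_zero_nat
  refine ⟨_, isCompact_setOf_weighted_le h0 hpos C hK hu, ?_⟩
  rintro _ ⟨_, ⟨n, rfl⟩, rfl⟩
  have hsub : {ν : MBase h | ∀ k, ν.weighted k Set.univ ≤ C k ∧
        ∀ j, ν.weighted k (K k j)ᶜ ≤ (1 / ((j : ℝ≥0) + 1) : ℝ≥0)}ᶜ
      ⊆ (⋃ k, {ν | (C k : ℝ) < ∫ x, h k x ∂ν.1}) ∪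
        ⋃ q : ℕ × ℕ × ℕ, {ν | (δ q.2.1 q.2.2 : ℝ) / 2 < ∫ x, φ q.2.2 (I q) x * h q.1 x ∂ν.1} := by
    intro ν hν
    by_contra hcon
    simp only [Set.mem_union, Set.mem_iUnion, Set.mem_ofPred_eq, not_or, not_exists, not_lt]
      at hcon
    refine hν fun k => ⟨?_, fun j => ?_⟩
    · have h1 := ν.lintegral_weighted k (f := fun _ => 1) measurable_const
      simp only [lintegral_const, one_mul, mul_one] at h1
      rw [h1, ← ofReal_integral_eq_lintegral_ofReal (ν.integrable_weight h0 k)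
        (Eventually.of_forall (h0 k)), ← ENNReal.ofReal_coe_nnreal]
      exact ENNReal.ofReal_le_ofReal (hcon.1 k)
    · have hl (l : ℕ) : ν.weighted k {x | φ l (I (k, j, l)) x ≤ 1 / 2}ᶜ ≤ δ j l := by
        have h1 := hcon.2 (k, j, l)
        simp only at h1
        rw [← integral_weighted h0] at h1
        have h2 := mul_meas_ge_le_integral_of_nonneg (μ := ν.weighted k)
          (Eventually.of_forall (hφ0 l (I (k, j, l)))) ((φ l (I (k, j, l))).integrable _) (1 / 2)
        have h3 : (ν.weighted k).real {x | φ l (I (k, j, l)) x ≤ 1 / 2}ᶜ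
            ≤ (ν.weighted k).real {x | 1 / 2 ≤ φ l (I (k, j, l)) x} :=
          measureReal_mono fun x hx => by
            simp only [Set.mem_compl_iff, Set.mem_ofPred_eq, not_le] at hx ⊢
            exact hx.le
        rw [← ENNReal.ofReal_coe_nnreal, ← ofReal_measureReal]
        exact ENNReal.ofReal_le_ofReal (by linarith)
      calc ν.weighted k (K k j)ᶜ
          ≤ ∑' l, ν.weighted k {x | φ l (I (k, j, l)) x ≤ 1 / 2}ᶜ := by
            rw [Set.compl_iInter]; exact measure_iUnion_le _
        _ ≤ ∑' l, (δ j l : ℝ≥0∞) := ENNReal.tsum_le_tsum hl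
        _ ≤ 1 / ((j : ℝ≥0∞) + 1) := (hδ j).le
        _ = (1 / ((j : ℝ≥0) + 1) : ℝ≥0) := by
            rw [ENNReal.coe_div (by positivity)]; simp
  calc (R n : Measure (MBase h)) _ ≤ _ := measure_mono hsub
    _ ≤ _ := measure_union_le _ _
    _ ≤ ∑' k, ε₁ k + ∑' q, ε₂ q := by
        refine add_le_add ((measure_iUnion_le _).trans (ENNReal.tsum_le_tsum fun k => hC k n))
          ((measure_iUnion_le _).trans (ENNReal.tsum_le_tsum fun q => hI q n))
    _ ≤ ε / 2 + ε / 2 := add_le_add hε₁.le hε₂.le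
    _ = ε := ENNReal.add_halves ε

/-- Convergence of the Laplace functionals to a limit that is continuous along antitone null
sequences implies weak convergence. -/
theorem exists_tendsto_of_laplace (h0 : ∀ k x, 0 ≤ h k x) (hpos : ∀ x, ∃ k, 0 < h k x)
    (hR : ∀ ψ : testCone h, Tendsto (fun n => ∫ ν, laplace h0 ψ ν ∂(R n : Measure (MBase h))) atTop
      (𝓝 (ℓ ψ)))
    (hℓ : ∀ (k : ℕ) (φ : ℕ → X →ᵇ ℝ) (hφ0 : ∀ i x, 0 ≤ φ i x), (∀ x, Antitone fun i => φ i x) →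
      (∀ x, Tendsto (fun i => φ i x) atTop (𝓝 0)) →
      Tendsto (fun i => ℓ ⟨φ i * h k, mul_mem_testCone_of_generator k (hφ0 i)⟩) atTop (𝓝 1)) :
    ∃ R₀ : ProbabilityMeasure (MBase h), Tendsto R atTop (𝓝 R₀) := by
  have := t2Space h0 hpos
  have hcomp := isCompact_closure_of_isTightMeasureSet
    (isTightMeasureSet_of_laplace h0 hpos hR hℓ)
  -- Along an ultrafilter finer than `atTop` the tight laws converge to some `R₀`. Its Laplace
  -- functional must be `ℓ`, so the whole sequence converges to `R₀`.
  let U : Ultrafilter ℕ := Ultrafilter.of atTop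
  obtain ⟨R₀, -, hR₀⟩ := hcomp.ultrafilter_le_nhds (U.map R)
    (le_principal_iff.mpr (Ultrafilter.mem_map.mpr
      (mem_of_superset univ_mem fun n _ => subset_closure ⟨n, rfl⟩)))
  refine ⟨R₀, tendsto_of_laplace h0 fun ψ => ?_⟩
  have h1 : Tendsto (fun n => ∫ ν, laplace h0 ψ ν ∂(R n : Measure (MBase h))) U
      (𝓝 (∫ ν, laplace h0 ψ ν ∂(R₀ : Measure (MBase h)))) :=
    ProbabilityMeasure.tendsto_iff_forall_integral_tendsto.mp hR₀ (laplace h0 ψ)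
  rw [tendsto_nhds_unique h1 ((hR ψ).mono_left (Ultrafilter.of_le atTop))]
  exact hR ψ

end

end MBase

/-! ### The Laplace functional of a Poisson random measure -/

/-- The function `x ↦ exp (-x)` on `[0, ∞]`. -/
def expNeg (x : ℝ≥0∞) : ℝ≥0∞ := EReal.exp (-(x : EReal))

@[simp] lemma expNeg_zero : expNeg 0 = 1 := by simp [expNeg]

@[simp] lemma expNeg_top : expNeg ∞ = 0 := by simp [expNeg]

lemma expNeg_ofReal {r : ℝ} (hr : 0 ≤ r) :
    expNeg (ENNReal.ofReal r) = ENNReal.ofReal (Real.exp (-r)) := by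
  rw [expNeg, EReal.coe_ennreal_ofReal, max_eq_left hr, ← EReal.coe_neg, EReal.exp_coe]

lemma expNeg_add (x y : ℝ≥0∞) : expNeg (x + y) = expNeg x * expNeg y := by
  rw [expNeg, EReal.coe_ennreal_add, EReal.neg_add (by simp) (by simp), sub_eq_add_neg,
    EReal.exp_add]
  rfl

lemma strictAnti_expNeg : StrictAnti expNeg := fun _ _ hxy =>
  EReal.exp_strictMono (EReal.neg_lt_neg_iff.mpr (EReal.coe_ennreal_lt_coe_ennreal_iff.mpr hxy))

lemma continuous_expNeg : Continuous expNeg :=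
  ENNReal.continuous_exp.comp (continuous_neg.comp continuous_coe_ennreal_ereal)

@[fun_prop] lemma measurable_expNeg : Measurable expNeg := continuous_expNeg.measurable

lemma expNeg_le_one (x : ℝ≥0∞) : expNeg x ≤ 1 :=
  expNeg_zero ▸ strictAnti_expNeg.antitone (zero_le (a := x))

lemma expNeg_ne_top (x : ℝ≥0∞) : expNeg x ≠ ∞ := ne_top_of_le_ne_top ENNReal.one_ne_top
  (expNeg_le_one x)

lemma expNeg_sum {ι : Type*} (s : Finset ι) (f : ι → ℝ≥0∞) :
    expNeg (∑ i ∈ s, f i) = ∏ i ∈ s, expNeg (f i) := by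
  classical
  induction s using Finset.induction_on with
  | empty => simp
  | insert i s hi ih => rw [Finset.sum_insert hi, Finset.prod_insert hi, expNeg_add, ih]

lemma expNeg_mul_natCast (a : ℝ≥0∞) (n : ℕ) : expNeg (a * n) = expNeg a ^ n := by
  induction n with
  | zero => simp
  | succ n ih => rw [Nat.cast_succ, mul_add, mul_one, expNeg_add, ih, pow_succ]

/-- The probability generating function of the Poisson distribution. -/
lemma lintegral_pow_poissonMeasure (r : ℝ≥0) {c : ℝ≥0∞} (hc : c ≤ 1) :
    ∫⁻ n, c ^ n ∂poissonMeasure r = expNeg ((1 - c) * r) := by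
  lift c to ℝ≥0 using ne_top_of_le_ne_top ENNReal.one_ne_top hc
  have hc' : c ≤ 1 := by exact_mod_cast hc
  have h1 : ∫⁻ n, (c : ℝ≥0∞) ^ n ∂poissonMeasure r
      = ∑' n : ℕ, ENNReal.ofReal (Real.exp (-r) * ((r * c : ℝ) ^ n / n.factorial)) := by
    rw [poissonMeasure, lintegral_sum_measure]
    refine tsum_congr fun n => ?_
    rw [lintegral_smul_measure, lintegral_dirac, smul_eq_mul, ← ENNReal.coe_pow,
      ← ENNReal.ofReal_coe_nnreal, ← ENNReal.ofReal_mul (by positivity)]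
    congr 1
    push_cast
    rw [mul_pow]
    ring
  have h2 : HasSum (fun n : ℕ => Real.exp (-r) * ((r * c : ℝ) ^ n / n.factorial))
      (Real.exp (-r) * Real.exp (r * c)) := by
    have := NormedSpace.expSeries_div_hasSum_exp (r * c : ℝ)
    rw [← Real.exp_eq_exp_ℝ] at this
    exact this.mul_left _
  rw [h1, ← ENNReal.ofReal_tsum_of_nonneg (fun n => by positivity) h2.summable, h2.tsum_eq,
    ← Real.exp_add]
  have h3 : ((1 : ℝ≥0∞) - c) * r = ENNReal.ofReal ((1 - c) * r) := by
    rw [ENNReal.ofReal_mul (by simpa using hc'), ENNReal.ofReal_sub _ c.coe_nonneg]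
    simp
  rw [h3, expNeg_ofReal (mul_nonneg (by simpa using hc') r.coe_nonneg)]
  congr 2
  ring

lemma lintegral_expNeg_poissonMeasure (a : ℝ≥0∞) (r : ℝ≥0) :
    ∫⁻ y, expNeg (a * y) ∂(poissonMeasure r).map (fun n : ℕ => (n : ℝ≥0∞))
      = expNeg ((1 - expNeg a) * r) := by
  rw [lintegral_map (by fun_prop) .of_discrete]
  simp only [expNeg_mul_natCast]
  exact lintegral_pow_poissonMeasure r (expNeg_le_one a)

section Laplace

variable {Ω X : Type*} [MeasurableSpace Ω] [MeasurableSpace X] {P : Measure Ω}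
  [IsProbabilityMeasure P] {N : Ω → Measure X} {ν : Measure X}

/-- The law of `N A` is prescribed only when `ν A < ∞`; for `a = 0` both sides are 1 whatever `ν A`
is, since `0 * ∞ = 0`. -/
lemma IsPoissonRandomMeasure.lintegral_expNeg_mul (hN : IsPoissonRandomMeasure P N ν)
    (hmeas : Measurable N) {A : Set X} (hA : MeasurableSet A) {a : ℝ≥0∞}
    (ha : a = 0 ∨ ν A < ∞) :
    ∫⁻ ω, expNeg (a * N ω A) ∂P = expNeg ((1 - expNeg a) * ν A) := by
  rcases ha with rfl | hfin
  · simp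
  · have hNA : Measurable fun ω => N ω A := (Measure.measurable_coe hA).comp hmeas
    have h1 := lintegral_map (μ := P) (f := fun y => expNeg (a * y)) (by fun_prop) hNA
    rw [← h1, hN.poisson A hA hfin, lintegral_expNeg_poissonMeasure,
      ENNReal.coe_toNNReal hfin.ne]

/-- The level sets of `s` are disjoint, so independence factors the expectation into one-set
formulas. -/
lemma IsPoissonRandomMeasure.lintegral_expNeg_simpleFunc (hN : IsPoissonRandomMeasure P N ν)
    (hmeas : Measurable N) (s : SimpleFunc X ℝ≥0∞)
    (hs : ∀ r, r = 0 ∨ ν (s ⁻¹' {r}) < ∞) :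
    ∫⁻ ω, expNeg (∫⁻ x, s x ∂N ω) ∂P = expNeg (∫⁻ x, (1 - expNeg (s x)) ∂ν) := by
  -- Independence is given for sequences of sets, so the finitely many values are coded injectively
  -- by integers; `A n` is the level set of the value with code `n`, and is empty if there is none.
  obtain ⟨enc, henc⟩ := Set.countable_iff_exists_injOn.mp s.range.countable_toSet
  let A : ℕ → Set X := fun n => s ⁻¹' {r | r ∈ s.range ∧ enc r = n}
  have hA (n) : MeasurableSet (A n) := s.measurableSet_preimage _
  have hAr (r : s.range) : A (enc r) = s ⁻¹' {(r : ℝ≥0∞)} := by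
    ext x
    simp only [A, Set.mem_preimage, Set.mem_ofPred_eq, Set.mem_singleton_iff]
    refine ⟨fun hx => henc hx.1 r.2 hx.2, fun hx => ⟨hx ▸ r.2, by rw [hx]⟩⟩
  have hAd : Pairwise (Function.onFun Disjoint A) := by
    intro i j hij
    refine Set.disjoint_left.mpr fun x hx hx' => hij ?_
    exact hx.2.symm.trans hx'.2
  have hind : iIndepFun (fun (r : s.range) ω => expNeg (r * N ω (A (enc r)))) P :=
    ((hN.indep A hA hAd).precomp (g := fun r : s.range => enc r)
      (fun r r' hrr' => Subtype.ext (henc r.2 r'.2 hrr'))).comp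
      (fun r y => expNeg (r * y)) fun r => by fun_prop
  have hNm (n) : Measurable fun ω => N ω (A n) := (Measure.measurable_coe (hA n)).comp hmeas
  have h1 (ω : Ω) : expNeg (∫⁻ x, s x ∂N ω) = ∏ r : s.range, expNeg (r * N ω (A (enc r))) := by
    rw [SimpleFunc.lintegral_eq_lintegral, SimpleFunc.lintegral, expNeg_sum,
      ← Finset.prod_coe_sort]
    exact Finset.prod_congr rfl fun r _ => by rw [hAr]
  simp only [h1]
  rw [lintegral_prod_eq_prod_lintegral_of_indepFun _ _ hind fun r => by fun_prop]
  have h2 : ∫⁻ x, (1 - expNeg (s x)) ∂ν = ∑ r : s.range, (1 - expNeg r) * ν (A (enc r)) := by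
    have : ∀ x, 1 - expNeg (s x) = s.map (fun r => 1 - expNeg r) x := fun x => rfl
    simp only [this]
    rw [SimpleFunc.lintegral_eq_lintegral, SimpleFunc.map_lintegral, ← Finset.sum_coe_sort]
    exact Finset.sum_congr rfl fun r _ => by rw [hAr]
  rw [h2, expNeg_sum]
  refine Finset.prod_congr rfl fun r _ => ?_
  exact hN.lintegral_expNeg_mul hmeas (hA _) (hAr r ▸ hs r)

/-- The Laplace functional of a Poisson random measure. -/
theorem IsPoissonRandomMeasure.lintegral_expNeg [SigmaFinite ν]
    (hN : IsPoissonRandomMeasure P N ν) (hmeas : Measurable N) {f : X → ℝ≥0∞}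
    (hf : Measurable f) :
    ∫⁻ ω, expNeg (∫⁻ x, f x ∂N ω) ∂P = expNeg (∫⁻ x, (1 - expNeg (f x)) ∂ν) := by
  -- Restricting to the spanning sets makes the level sets of nonzero values have finite measure,
  -- and keeps the approximation monotone.
  let s : ℕ → SimpleFunc X ℝ≥0∞ := fun n => (SimpleFunc.eapprox f n).restrict (spanningSets ν n)
  have hsm (n) : MeasurableSet (spanningSets ν n) := measurableSet_spanningSets ν n
  have hs (n x) : s n x = (spanningSets ν n).indicator (SimpleFunc.eapprox f n) x :=
    SimpleFunc.restrict_apply _ (hsm n) x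
  have hmono (x) : Monotone fun n => s n x := by
    intro i j hij
    simp only [hs]
    refine (Set.indicator_le_indicator_of_subset (monotone_spanningSets ν hij)
      (fun _ => zero_le) x).trans ?_
    exact Set.indicator_le_indicator (SimpleFunc.monotone_eapprox f hij x)
  have hlim (x) : Tendsto (fun n => s n x) atTop (𝓝 (f x)) := by
    have h1 : Tendsto (fun n => SimpleFunc.eapprox f n x) atTop (𝓝 (f x)) := by
      rw [← SimpleFunc.iSup_eapprox_apply hf x]
      exact tendsto_atTop_iSup fun i j hij => SimpleFunc.monotone_eapprox f hij x
    refine h1.congr' ?_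
    filter_upwards [eventually_ge_atTop (spanningSetsIndex ν x)] with n hn
    rw [hs, Set.indicator_of_mem]
    exact monotone_spanningSets ν hn (mem_spanningSetsIndex ν x)
  have hsfin (n r) : r = 0 ∨ ν (s n ⁻¹' {r}) < ∞ := by
    refine or_iff_not_imp_left.mpr fun hr => ?_
    refine (measure_mono fun x hx => ?_).trans_lt (measure_spanningSets_lt_top ν n)
    by_contra hx'
    rw [Set.mem_preimage, Set.mem_singleton_iff, hs, Set.indicator_of_notMem hx'] at hx
    exact hr hx.symm
  have hint (μ : Measure X) : Tendsto (fun n => ∫⁻ x, s n x ∂μ) atTop (𝓝 (∫⁻ x, f x ∂μ)) :=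
    lintegral_tendsto_of_tendsto_of_monotone (fun n => (s n).measurable.aemeasurable)
      (Eventually.of_forall hmono) (Eventually.of_forall hlim)
  have hL : Tendsto (fun n => ∫⁻ ω, expNeg (∫⁻ x, s n x ∂N ω) ∂P) atTop
      (𝓝 (∫⁻ ω, expNeg (∫⁻ x, f x ∂N ω) ∂P)) := by
    refine tendsto_lintegral_of_dominated_convergence (fun _ => 1) (fun n => ?_)
      (fun n => Eventually.of_forall fun ω => expNeg_le_one _) (by simp)
      (Eventually.of_forall fun ω => (continuous_expNeg.tendsto _).comp (hint (N ω)))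
    exact measurable_expNeg.comp ((Measure.measurable_lintegral (s n).measurable).comp hmeas)
  have hRt : Tendsto (fun n => expNeg (∫⁻ x, (1 - expNeg (s n x)) ∂ν)) atTop
      (𝓝 (expNeg (∫⁻ x, (1 - expNeg (f x)) ∂ν))) := by
    refine (continuous_expNeg.tendsto _).comp ?_
    refine lintegral_tendsto_of_tendsto_of_monotone
      (fun n => (Measurable.const_sub (measurable_expNeg.comp (s n).measurable) 1).aemeasurable)
      (Eventually.of_forall fun x i j hij =>
        tsub_le_tsub_left (strictAnti_expNeg.antitone (hmono x hij)) 1)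
      (Eventually.of_forall fun x => ?_)
    exact ENNReal.Tendsto.sub tendsto_const_nhds ((continuous_expNeg.tendsto _).comp (hlim x))
      (Or.inl ENNReal.one_ne_top)
  refine tendsto_nhds_unique hL (hRt.congr fun n => ?_)
  exact (hN.lintegral_expNeg_simpleFunc hmeas (s n) (hsfin n)).symm

end Laplace

/-! ### Recognizing Poisson random measures by their Laplace functional -/

section Moments

variable {ι : Type*} [Fintype ι]

lemma isInducing_toReal_expNeg : IsInducing fun x : ℝ≥0∞ => (expNeg x).toReal := by
  have hc : Continuous fun x : ℝ≥0∞ => (expNeg x).toReal :=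
    ENNReal.continuousOn_toReal.comp_continuous continuous_expNeg fun x => expNeg_ne_top x
  refine (hc.isClosedEmbedding fun x y hxy => strictAnti_expNeg.injective ?_).isInducing
  exact (ENNReal.toReal_eq_toReal_iff' (expNeg_ne_top x) (expNeg_ne_top y)).mp hxy

/-- The bounded continuous function `y ↦ exp (-∑ i, a i * y i)` on `[0, ∞] ^ ι`. -/
def expNegSum (a : ι → ℕ) : (ι → ℝ≥0∞) →ᵇ ℝ :=
  BoundedContinuousFunction.mkOfCompact ⟨fun y => ∏ i, (expNeg (y i)).toReal ^ a i, by
    refine continuous_finsetProd _ fun i _ => Continuous.pow ?_ _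
    exact isInducing_toReal_expNeg.continuous.comp (continuous_apply i)⟩

lemma expNegSum_apply (a : ι → ℕ) (y : ι → ℝ≥0∞) :
    expNegSum a y = (expNeg (∑ i, (a i : ℝ≥0∞) * y i)).toReal := by
  rw [expNeg_sum, ENNReal.toReal_prod]
  refine Finset.prod_congr rfl fun i _ => ?_
  rw [mul_comm, expNeg_mul_natCast, ENNReal.toReal_pow]

/-- A probability measure on `[0, ∞] ^ ι` is determined by its Laplace transform at the points with
integer coordinates. -/
lemma eq_of_lintegral_expNeg {P P' : Measure (ι → ℝ≥0∞)} [IsProbabilityMeasure P]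
    [IsProbabilityMeasure P']
    (hPP' : ∀ a : ι → ℕ, ∫⁻ y, expNeg (∑ i, (a i : ℝ≥0∞) * y i) ∂P
      = ∫⁻ y, expNeg (∑ i, (a i : ℝ≥0∞) * y i) ∂P') : P = P' := by
  classical
  -- Adding exponents multiplies the functions, so integer exponents already give a multiplicative
  -- family; the unit vectors give the coordinates, which induce the topology.
  let M : Submonoid ((ι → ℝ≥0∞) →ᵇ ℝ) :=
    { carrier := Set.range expNegSum
      one_mem' := ⟨0, by ext y; simp [expNegSum]⟩
      mul_mem' := by
        rintro _ _ ⟨a, rfl⟩ ⟨b, rfl⟩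
        exact ⟨a + b, by ext y; simp [expNegSum, pow_add, Finset.prod_mul_distrib]⟩ }
  have hsingle (i : ι) (y : ι → ℝ≥0∞) : expNegSum (Pi.single i 1) y = (expNeg (y i)).toReal := by
    rw [expNegSum_apply]
    simp [Pi.single_apply]
  have hind : IsInducing fun (y : ι → ℝ≥0∞) i => expNegSum (Pi.single i 1) y := by
    simp only [hsingle]
    exact IsInducing.piMap (f := fun (_ : ι) (x : ℝ≥0∞) => (expNeg x).toReal)
      fun _ => isInducing_toReal_expNeg
  let p : ProbabilityMeasure (ι → ℝ≥0∞) := ⟨P, inferInstance⟩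
  let p' : ProbabilityMeasure (ι → ℝ≥0∞) := ⟨P', inferInstance⟩
  have key : p = p' := by
    refine tendsto_nhds_unique (tendsto_const_nhds (f := atTop (α := ℕ)))
      (tendsto_of_isInducing (fun i => expNegSum (Pi.single i 1)) (fun i y => ?_) hind M
        (fun i => ⟨_, rfl⟩) ?_)
    · rw [hsingle]
      refine ⟨ENNReal.toReal_nonneg, ?_⟩
      exact ENNReal.toReal_mono ENNReal.one_ne_top (expNeg_le_one _)
    · rintro _ ⟨a, rfl⟩
      have hint (μ : Measure (ι → ℝ≥0∞)) :
          ∫ y, expNegSum a y ∂μ = (∫⁻ y, expNeg (∑ i, (a i : ℝ≥0∞) * y i) ∂μ).toReal := by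
        simp only [expNegSum_apply]
        exact integral_toReal (Measurable.aemeasurable (by fun_prop)) (Eventually.of_forall fun y => (expNeg_ne_top _).lt_top)
      simp only [p, p', ProbabilityMeasure.coe_mk, hint, hPP' a]
      exact tendsto_const_nhds
  exact congrArg ProbabilityMeasure.toMeasure key

end Moments

section OfLaplace

variable {Ω X : Type*} [MeasurableSpace Ω] [MeasurableSpace X] {P : Measure Ω}
  {N : Ω → Measure X} {ν : Measure X}

/-- The sets are disjoint, so at each point at most one indicator is nonzero, and 1 - exp(-∑ a_i
1_{A_i}) = ∑ (1 - exp(-a_i)) 1_{A_i}. -/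
lemma lintegral_expNeg_sum_of_laplace
    (hL : ∀ f : X → ℝ≥0∞, Measurable f →
      ∫⁻ ω, expNeg (∫⁻ x, f x ∂N ω) ∂P = expNeg (∫⁻ x, (1 - expNeg (f x)) ∂ν))
    {ι : Type*} [Fintype ι] {A : ι → Set X} (hA : ∀ i, MeasurableSet (A i))
    (hd : Pairwise (Function.onFun Disjoint A)) (a : ι → ℕ) :
    ∫⁻ ω, expNeg (∑ i, (a i : ℝ≥0∞) * N ω (A i)) ∂P
      = ∏ i, expNeg ((1 - expNeg (a i)) * ν (A i)) := by
  classical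
  have hmeas : ∀ i ∈ Finset.univ, Measurable ((A i).indicator fun _ : X => (a i : ℝ≥0∞)) :=
    fun i _ => measurable_const.indicator (hA i)
  have h1 := hL (fun x => ∑ i, (A i).indicator (fun _ => (a i : ℝ≥0∞)) x)
    (Finset.measurable_sum _ hmeas)
  have h2 (μ : Measure X) : ∫⁻ x, ∑ i, (A i).indicator (fun _ => (a i : ℝ≥0∞)) x ∂μ
      = ∑ i, (a i : ℝ≥0∞) * μ (A i) := by
    rw [lintegral_finsetSum _ hmeas]
    exact Finset.sum_congr rfl fun i _ => lintegral_indicator_const (hA i) _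
  simp only [h2] at h1
  rw [h1, ← expNeg_sum]
  congr 1
  have h3 (x : X) : 1 - expNeg (∑ i, (A i).indicator (fun _ => (a i : ℝ≥0∞)) x)
      = ∑ i, (A i).indicator (fun _ => 1 - expNeg (a i)) x := by
    by_cases hx : ∃ i, x ∈ A i
    · obtain ⟨i, hi⟩ := hx
      have hne (j) (hj : j ≠ i) : x ∉ A j := fun hxj => Set.disjoint_left.mp (hd hj) hxj hi
      rw [Finset.sum_eq_single i (fun j _ hj => Set.indicator_of_notMem (hne j hj) _) (by simp),
        Finset.sum_eq_single i (fun j _ hj => Set.indicator_of_notMem (hne j hj) _) (by simp),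
        Set.indicator_of_mem hi, Set.indicator_of_mem hi]
    · push Not at hx
      simp [hx]
  simp only [h3]
  rw [lintegral_finsetSum _ fun i _ => measurable_const.indicator (hA i)]
  exact Finset.sum_congr rfl fun i _ => lintegral_indicator_const (hA i) _

/-- A random counting measure with the Laplace functional of a Poisson random measure is a Poisson
random measure. -/
theorem isPoissonRandomMeasure_of_laplace [IsProbabilityMeasure P] (hmeas : Measurable N)
    (hcount : ∀ᵐ ω ∂P, ∀ A, MeasurableSet A → ∃ n : ℕ∞, N ω A = (n : ℝ≥0∞))
    (hL : ∀ f : X → ℝ≥0∞, Measurable f →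
      ∫⁻ ω, expNeg (∫⁻ x, f x ∂N ω) ∂P = expNeg (∫⁻ x, (1 - expNeg (f x)) ∂ν)) :
    IsPoissonRandomMeasure P N ν where
  counting := hcount
  poisson A hA hfin := by
    have hNA : Measurable fun ω => N ω A := (Measure.measurable_coe hA).comp hmeas
    -- A single random variable is treated as a vector indexed by `Unit`, so that
    -- `eq_of_lintegral_expNeg` applies.
    have hcm : Measurable fun (y : ℝ≥0∞) (_ : Unit) => y := by fun_prop
    have : IsProbabilityMeasure (P.map fun ω => N ω A) :=
      Measure.isProbabilityMeasure_map hNA.aemeasurable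
    have := Measure.isProbabilityMeasure_map (μ := P.map fun ω => N ω A) hcm.aemeasurable
    have := Measure.isProbabilityMeasure_map
      (μ := (poissonMeasure (ν A).toNNReal).map (fun n : ℕ => (n : ℝ≥0∞))) hcm.aemeasurable
    have key : (P.map fun ω => N ω A).map (fun (y : ℝ≥0∞) (_ : Unit) => y)
        = ((poissonMeasure (ν A).toNNReal).map (fun n : ℕ => (n : ℝ≥0∞))).map
          (fun (y : ℝ≥0∞) (_ : Unit) => y) := by
      refine eq_of_lintegral_expNeg fun a => ?_
      rw [lintegral_map (by fun_prop) hcm, lintegral_map (by fun_prop) hcm,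
        lintegral_map (by fun_prop) hNA]
      have := lintegral_expNeg_sum_of_laplace hL (A := fun _ : Unit => A) (fun _ => hA)
        (fun i j hij => (hij rfl).elim) a
      simp only [Finset.univ_unique, PUnit.default_eq_unit, Finset.sum_singleton,
        Finset.prod_singleton] at this ⊢
      rw [this, lintegral_expNeg_poissonMeasure, ENNReal.coe_toNNReal hfin.ne]
    have h2 := congrArg (fun μ => μ.map fun z : Unit → ℝ≥0∞ => z ()) key
    simp only at h2
    rw [Measure.map_map (by fun_prop) hcm, Measure.map_map (by fun_prop) hcm] at h2
    simpa [Function.comp_def] using h2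
  indep A hA hd := by
    rw [iIndepFun_iff_finset]
    intro s
    have hNA (i : s) : Measurable fun ω => N ω (A i) := (Measure.measurable_coe (hA i)).comp hmeas
    have hds : Pairwise (Function.onFun Disjoint fun i : s => A i) := fun i j hij =>
      hd fun h => hij (Subtype.ext h)
    change iIndepFun (fun (i : s) ω => N ω (A i)) P
    rw [iIndepFun_iff_map_fun_eq_pi_map fun i => (hNA i).aemeasurable]
    have (i : s) : IsProbabilityMeasure (P.map fun ω => N ω (A i)) :=
      Measure.isProbabilityMeasure_map (hNA i).aemeasurable
    have hj : Measurable fun ω (i : s) => N ω (A i) := measurable_pi_iff.mpr hNA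
    have := Measure.isProbabilityMeasure_map (μ := P) hj.aemeasurable
    -- Independence means that the joint law is the product of the marginals; their Laplace
    -- transforms agree because the joint one factors.
    refine eq_of_lintegral_expNeg fun a => ?_
    rw [lintegral_map (by fun_prop) hj, lintegral_expNeg_sum_of_laplace hL (fun i : s => hA i) hds]
    simp only [expNeg_sum]
    have hpi : iIndepFun (fun (i : s) (y : s → ℝ≥0∞) => expNeg ((a i : ℝ≥0∞) * y i))
        (Measure.pi fun i : s => P.map fun ω => N ω (A i)) :=
      iIndepFun_pi (X := fun (i : s) (y : ℝ≥0∞) => expNeg ((a i : ℝ≥0∞) * y))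
        fun i => by fun_prop
    rw [lintegral_prod_eq_prod_lintegral_of_indepFun _ _ hpi fun i => by fun_prop]
    refine Finset.prod_congr rfl fun i _ => ?_
    have h1 := (measurePreserving_eval (fun i : s => P.map fun ω => N ω (A i)) i).lintegral_comp
      (f := fun y => expNeg ((a i : ℝ≥0∞) * y)) (by fun_prop)
    simp only [Function.eval] at h1
    rw [h1, lintegral_map (by fun_prop) (hNA i)]
    have h2 := lintegral_expNeg_sum_of_laplace hL (A := fun _ : Unit => A i) (fun _ => hA i)
        (fun i j hij => (hij rfl).elim) (fun _ => a i)
    simp only [Finset.univ_unique, PUnit.default_eq_unit, Finset.sum_singleton,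
        Finset.prod_singleton] at h2
    rw [h2]

end OfLaplace

universe u

/-! ### Existence of Poisson random measures -/

section Construction

variable {X : Type*} [MeasurableSpace X]

/-- The sum of the point masses at the first `n` points of a sequence. -/
def pointSum (q : ℕ × (ℕ → X)) : Measure X := ∑ j ∈ Finset.range q.1, Measure.dirac (q.2 j)

lemma lintegral_pointSum (q : ℕ × (ℕ → X)) {f : X → ℝ≥0∞} (hf : Measurable f) :
    ∫⁻ x, f x ∂pointSum q = ∑ j ∈ Finset.range q.1, f (q.2 j) := by
  rw [pointSum, lintegral_finsetSum_measure]
  exact Finset.sum_congr rfl fun j _ => lintegral_dirac' _ hf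

lemma measurable_lintegral_pointSum {f : X → ℝ≥0∞} (hf : Measurable f) :
    Measurable fun q : ℕ × (ℕ → X) => ∫⁻ x, f x ∂pointSum q := by
  simp only [lintegral_pointSum _ hf]
  refine measurable_from_prod_countable_right fun n => ?_
  change Measurable fun z : ℕ → X => ∑ j ∈ Finset.range n, f (z j)
  exact Finset.measurable_sum _ fun j _ => hf.comp (measurable_pi_apply j)

/-- A Poisson number of independent points with law `p`. -/
def poissonPoints (r : ℝ≥0) (p : Measure X) [IsProbabilityMeasure p] : Measure (ℕ × (ℕ → X)) :=
  (poissonMeasure r).prod (Measure.infinitePi fun _ : ℕ => p)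

instance (r : ℝ≥0) (p : Measure X) [IsProbabilityMeasure p] :
    IsProbabilityMeasure (poissonPoints r p) := by
  unfold poissonPoints; infer_instance

lemma lintegral_expNeg_pointSum (r : ℝ≥0) (p : Measure X) [IsProbabilityMeasure p]
    {f : X → ℝ≥0∞} (hf : Measurable f) :
    ∫⁻ q, expNeg (∫⁻ x, f x ∂pointSum q) ∂poissonPoints r p
      = expNeg (r * ∫⁻ x, (1 - expNeg (f x)) ∂p) := by
  have hm : Measurable fun q : ℕ × (ℕ → X) => expNeg (∫⁻ x, f x ∂pointSum q) :=
    measurable_expNeg.comp (measurable_lintegral_pointSum hf)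
  have hmf : Measurable fun x => expNeg (f x) := measurable_expNeg.comp hf
  rw [poissonPoints, lintegral_prod _ hm.aemeasurable]
  have h1 (n : ℕ) : ∫⁻ z, expNeg (∫⁻ x, f x ∂pointSum (n, z)) ∂Measure.infinitePi (fun _ : ℕ => p)
      = (∫⁻ x, expNeg (f x) ∂p) ^ n := by
    have hind : iIndepFun (fun (j : ℕ) (z : ℕ → X) => expNeg (f (z j)))
        (Measure.infinitePi fun _ : ℕ => p) :=
      iIndepFun_infinitePi (X := fun (_ : ℕ) x => expNeg (f x)) fun _ => hmf
    simp only [lintegral_pointSum _ hf, expNeg_sum]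
    rw [lintegral_prod_eq_prod_lintegral_of_indepFun _ _ hind
      fun j => hmf.comp (measurable_pi_apply j)]
    have h2 (j : ℕ) : ∫⁻ z, expNeg (f (z j)) ∂Measure.infinitePi (fun _ : ℕ => p)
        = ∫⁻ x, expNeg (f x) ∂p := by
      conv_rhs => rw [← Measure.infinitePi_map_eval (fun _ : ℕ => p) j]
      rw [lintegral_map hmf (measurable_pi_apply j)]
    simp [h2]
  have hle : ∫⁻ x, expNeg (f x) ∂p ≤ 1 :=
    (lintegral_mono fun x => expNeg_le_one (f x)).trans (by simp)
  simp only [h1]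
  rw [lintegral_pow_poissonMeasure r hle, mul_comm, lintegral_sub hmf
    (ne_top_of_le_ne_top ENNReal.one_ne_top hle) (Eventually.of_forall fun x => expNeg_le_one _)]
  simp

/-- The superposition of a sequence of finite point configurations. -/
def superposition (ω : ℕ → ℕ × (ℕ → X)) : Measure X := Measure.sum fun i => pointSum (ω i)

lemma lintegral_superposition (ω : ℕ → ℕ × (ℕ → X)) (f : X → ℝ≥0∞) :
    ∫⁻ x, f x ∂superposition ω = ∑' i, ∫⁻ x, f x ∂pointSum (ω i) :=
  lintegral_sum_measure _ _

lemma measurable_superposition : Measurable (superposition (X := X)) := by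
  refine Measure.measurable_of_measurable_coe _ fun A hA => ?_
  simp only [← lintegral_indicator_one hA, lintegral_superposition]
  refine Measurable.tsum fun i => ?_
  exact (measurable_lintegral_pointSum (measurable_one.indicator hA)).comp (measurable_pi_apply i)

lemma exists_superposition_apply_eq_toENNReal (ω : ℕ → ℕ × (ℕ → X)) {A : Set X}
    (hA : MeasurableSet A) : ∃ n : ℕ∞, superposition ω A = (n : ℝ≥0∞) := by
  have h1 : superposition ω A
      = ∑' q : (i : ℕ) × Fin (ω i).1, A.indicator (fun _ => (1 : ℝ≥0∞)) ((ω q.1).2 q.2) := by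
    rw [← lintegral_indicator_one hA, lintegral_superposition, ENNReal.tsum_sigma
      fun i (j : Fin (ω i).1) => A.indicator (fun _ => (1 : ℝ≥0∞)) ((ω i).2 j)]
    refine tsum_congr fun i => ?_
    rw [lintegral_pointSum _ (measurable_one.indicator hA), Finset.sum_range, tsum_fintype]
    rfl
  let T : Set ((i : ℕ) × Fin (ω i).1) := {q | (ω q.1).2 q.2 ∈ A}
  refine ⟨ENat.card T, ?_⟩
  rw [h1, ← ENNReal.tsum_one, tsum_subtype T (fun _ => (1 : ℝ≥0∞))]
  rfl

/-- Existence of Poisson random measures with s-finite mean measure. -/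
theorem exists_isPoissonRandomMeasure {X : Type u} [MeasurableSpace X] (ν : Measure X)
    [SFinite ν] :
    ∃ (Ω : Type u) (_ : MeasurableSpace Ω) (P : Measure Ω) (N : Ω → Measure X),
      IsProbabilityMeasure P ∧ Measurable N ∧ IsPoissonRandomMeasure P N ν := by
  rcases isEmpty_or_nonempty X with hX | ⟨⟨x₀⟩⟩
  · refine ⟨PUnit, inferInstance, Measure.dirac PUnit.unit, 0, inferInstance, measurable_const, ?_⟩
    refine isPoissonRandomMeasure_of_laplace measurable_const
      (Eventually.of_forall fun ω A _ => ⟨0, by simp⟩) fun f _ => ?_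
    simp [Measure.eq_zero_of_isEmpty]
  let m : ℕ → Measure X := sfiniteSeq ν
  -- Each finite piece of `ν` is normalized to a probability measure from which points are drawn; a
  -- zero piece gets a dummy point mass, which then carries zero points almost surely.
  have hp (i : ℕ) : ∃ p : Measure X, IsProbabilityMeasure p ∧ m i = m i Set.univ • p := by
    by_cases hm : m i = 0
    · exact ⟨Measure.dirac x₀, inferInstance, by simp [hm]⟩
    · have h1 : m i Set.univ ≠ 0 := by simpa using hm
      refine ⟨(m i Set.univ)⁻¹ • m i, ⟨?_⟩, ?_⟩
      · simp [ENNReal.inv_mul_cancel h1 (measure_ne_top _ _)]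
      · rw [smul_smul, ENNReal.mul_inv_cancel h1 (measure_ne_top _ _), one_smul]
  choose p hp hmp using hp
  let P : Measure (ℕ → ℕ × (ℕ → X)) :=
    Measure.infinitePi fun i => poissonPoints (m i Set.univ).toNNReal (p i)
  have hms := measurable_superposition (X := X)
  refine ⟨_, inferInstance, P, superposition, inferInstance, hms, ?_⟩
  refine isPoissonRandomMeasure_of_laplace hms
    (Eventually.of_forall fun ω A hA => exists_superposition_apply_eq_toENNReal ω hA) fun f hf => ?_
  have hG : Measurable fun q : ℕ × (ℕ → X) => expNeg (∫⁻ x, f x ∂pointSum q) :=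
    measurable_expNeg.comp (measurable_lintegral_pointSum hf)
  have hone (i : ℕ) : ∫⁻ ω, expNeg (∫⁻ x, f x ∂pointSum (ω i)) ∂P
      = expNeg (∫⁻ x, (1 - expNeg (f x)) ∂m i) := by
    have h1 := lintegral_map (μ := P) hG (measurable_pi_apply i)
    rw [Measure.infinitePi_map_eval, lintegral_expNeg_pointSum _ _ hf] at h1
    rw [← h1, hmp i, lintegral_smul_measure]
    simp [← hmp i]
  have hfinite (n : ℕ) :
      ∫⁻ ω, expNeg (∑ i ∈ Finset.range n, ∫⁻ x, f x ∂pointSum (ω i)) ∂P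
        = expNeg (∑ i ∈ Finset.range n, ∫⁻ x, (1 - expNeg (f x)) ∂m i) := by
    have hind : iIndepFun (fun (i : ℕ) (ω : ℕ → ℕ × (ℕ → X)) =>
        expNeg (∫⁻ x, f x ∂pointSum (ω i))) P :=
      iIndepFun_infinitePi (X := fun (_ : ℕ) q => expNeg (∫⁻ x, f x ∂pointSum q)) fun _ => hG
    simp only [expNeg_sum]
    rw [lintegral_prod_eq_prod_lintegral_of_indepFun _ _ hind
      fun i => hG.comp (measurable_pi_apply i)]
    exact Finset.prod_congr rfl fun i _ => hone i
  have hL : Tendsto (fun n => ∫⁻ ω, expNeg (∑ i ∈ Finset.range n, ∫⁻ x, f x ∂pointSum (ω i)) ∂P)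
      atTop (𝓝 (∫⁻ ω, expNeg (∫⁻ x, f x ∂superposition ω) ∂P)) := by
    refine tendsto_lintegral_of_dominated_convergence (fun _ => 1) (fun n => ?_)
      (fun n => Eventually.of_forall fun ω => expNeg_le_one _) (by simp)
      (Eventually.of_forall fun ω => (continuous_expNeg.tendsto _).comp ?_)
    · exact measurable_expNeg.comp (Finset.measurable_sum _ fun i _ =>
        (measurable_lintegral_pointSum hf).comp (measurable_pi_apply i))
    · rw [lintegral_superposition]
      exact ENNReal.tendsto_nat_tsum _
  have hR : Tendsto (fun n => expNeg (∑ i ∈ Finset.range n, ∫⁻ x, (1 - expNeg (f x)) ∂m i)) atTop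
      (𝓝 (expNeg (∫⁻ x, (1 - expNeg (f x)) ∂ν))) := by
    refine (continuous_expNeg.tendsto _).comp ?_
    conv_rhs => rw [← sum_sfiniteSeq ν, lintegral_sum_measure]
    exact ENNReal.tendsto_nat_tsum _
  exact tendsto_nhds_unique hL (hR.congr fun n => (hfinite n).symm)

end Construction

/-! ### σ-finiteness, and measurability of the set of counting measures -/

namespace MBase

section FinitePart

variable {X : Type*} [TopologicalSpace X] {h : ℕ → X →ᵇ ℝ}

/-- The points at which `k` is the first index with `h k > 0` and `h k ≥ 1 / (n + 1)`. -/
def finitePart (h : ℕ → X →ᵇ ℝ) (k n : ℕ) : Set X :=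
  firstPos h k ∩ {x | 1 / ((n : ℝ) + 1) ≤ h k x}

lemma monotone_finitePart (k : ℕ) : Monotone (finitePart h k) := by
  intro i j hij x hx
  have h1 : 1 / ((j : ℝ) + 1) ≤ 1 / ((i : ℝ) + 1) := by gcongr
  exact ⟨hx.1, h1.trans hx.2⟩

lemma iUnion_finitePart (k : ℕ) : ⋃ n, finitePart h k n = firstPos h k := by
  refine Set.Subset.antisymm (Set.iUnion_subset fun n => Set.inter_subset_left) fun x hx => ?_
  obtain ⟨n, hn⟩ := exists_nat_one_div_lt (pos_of_mem_firstPos hx)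
  exact Set.mem_iUnion.mpr ⟨n, hx, hn.le⟩

end FinitePart

variable {X : Type*} [TopologicalSpace X] [MeasurableSpace X] [BorelSpace X] {h : ℕ → X →ᵇ ℝ}

lemma measurableSet_finitePart (k n : ℕ) : MeasurableSet (finitePart h k n) :=
  (measurableSet_firstPos k).inter (isClosed_le continuous_const (h k).continuous).measurableSet

lemma measure_finitePart_lt_top (ν : MBase h) (k n : ℕ) : ν.1 (finitePart h k n) < ∞ := by
  have hn : (0 : ℝ) < 1 / ((n : ℝ) + 1) := by positivity
  refine (measure_mono fun x hx => ?_).trans_lt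
    ((meas_ge_le_lintegral_div (μ := ν.1) (f := fun x => ENNReal.ofReal (h k x))
      (Measurable.aemeasurable (by fun_prop)) (ENNReal.ofReal_pos.mpr hn).ne'
      ENNReal.ofReal_ne_top).trans_lt
      (ENNReal.div_lt_top (ν.2 k).ne (ENNReal.ofReal_pos.mpr hn).ne'))
  exact ENNReal.ofReal_le_ofReal hx.2

/-- By Markov's inequality `ν` is finite where `h k ≥ 1 / (n + 1)`, and countably many such pieces
cover the space. -/
lemma sigmaFinite (hpos : ∀ x, ∃ k, 0 < h k x) (ν : MBase h) : SigmaFinite ν.1 := by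
  refine ⟨⟨⟨fun i => finitePart h i.unpair.1 i.unpair.2, fun _ => trivial,
    fun i => ν.measure_finitePart_lt_top _ _, ?_⟩⟩⟩
  rw [Set.iUnion_unpair fun k n => finitePart h k n]
  simp only [iUnion_finitePart]
  exact iUnion_firstPos hpos

/-- A limit of values in `{0, 1, 2, …, ∞}` is such a value. -/
lemma mem_range_toENNReal_of_tendsto {u : ℕ → ℝ≥0∞} {a : ℝ≥0∞}
    (hu : ∀ n, u n ∈ Set.range ENat.toENNReal) (ha : Tendsto u atTop (𝓝 a)) :
    a ∈ Set.range ENat.toENNReal :=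
  ENat.isClosedEmbedding_toENNReal.isClosed_range.mem_of_tendsto ha (Eventually.of_forall hu)

lemma tsum_mem_range_toENNReal {u : ℕ → ℝ≥0∞} (hu : ∀ n, u n ∈ Set.range ENat.toENNReal) :
    ∑' n, u n ∈ Set.range ENat.toENNReal := by
  refine mem_range_toENNReal_of_tendsto (fun n => ?_) (ENNReal.tendsto_nat_tsum u)
  induction n with
  | zero => exact ⟨0, by simp⟩
  | succ n ih =>
    obtain ⟨a, ha⟩ := ih
    obtain ⟨b, hb⟩ := hu n
    exact ⟨a + b, by rw [Finset.sum_range_succ, ENat.toENNReal_add, ha, hb]⟩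

/-- Integrality of a measure can be tested on a generating algebra. -/
lemma forall_mem_range_toENNReal_of_generateFrom (hpos : ∀ x, ∃ k, 0 < h k x) (ν : MBase h)
    {𝒜 : Set (Set X)} (hgen : ‹MeasurableSpace X› = MeasurableSpace.generateFrom 𝒜)
    (hpi : IsPiSystem 𝒜) (huniv : Set.univ ∈ 𝒜)
    (hint : ∀ k n, ∀ A ∈ 𝒜, ν.1 (finitePart h k n ∩ A) ∈ Set.range ENat.toENNReal)
    {A : Set X} (hA : MeasurableSet A) : ν.1 A ∈ Set.range ENat.toENNReal := by
  have hfin (k n : ℕ) (A : Set X) : ν.1 (finitePart h k n ∩ A) ≠ ∞ :=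
    ((measure_mono Set.inter_subset_left).trans_lt (ν.measure_finitePart_lt_top k n)).ne
  have hpart (k n : ℕ) (A : Set X) (hA : MeasurableSet A) :
      ν.1 (finitePart h k n ∩ A) ∈ Set.range ENat.toENNReal := by
    induction A, hA using MeasurableSpace.induction_on_inter hgen hpi with
    | empty => exact ⟨0, by simp⟩
    | basic A hA => exact hint k n A hA
    | compl A hA ih =>
      -- Inside a finite part the measure of a complement is a difference of finite integers; this
      -- is where the whole space must belong to `𝒜`.
      obtain ⟨a, ha⟩ := ih
      obtain ⟨b, hb⟩ := hint k n _ huniv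
      refine ⟨b - a, ?_⟩
      rw [ENat.toENNReal_sub, ha, hb, Set.inter_univ,
        ← measure_sdiff Set.inter_subset_left
          ((measurableSet_finitePart k n).inter hA).nullMeasurableSet (hfin k n A)]
      congr 1
      ext x; simp only [Set.mem_sdiff, Set.mem_inter_iff, Set.mem_compl_iff]; tauto
    | iUnion f hd hf ih =>
      rw [Set.inter_iUnion, measure_iUnion
        (fun i j hij => (hd hij).mono Set.inter_subset_right Set.inter_subset_right)
        fun i => (measurableSet_finitePart k n).inter (hf i)]
      exact tsum_mem_range_toENNReal ih
  have hfirst (k : ℕ) : ν.1 (firstPos h k ∩ A) ∈ Set.range ENat.toENNReal := by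
    refine mem_range_toENNReal_of_tendsto (fun n => hpart k n A hA) ?_
    rw [← iUnion_finitePart, Set.iUnion_inter]
    exact tendsto_measure_iUnion_atTop fun i j hij =>
      Set.inter_subset_inter_left _ (monotone_finitePart k hij)
  have hA' : A = ⋃ k, firstPos h k ∩ A := by
    rw [← Set.iUnion_inter, iUnion_firstPos hpos, Set.univ_inter]
  rw [hA', measure_iUnion (fun i j hij => (pairwise_disjoint_firstPos hij).mono
    Set.inter_subset_left Set.inter_subset_left) fun k => (measurableSet_firstPos k).inter hA]
  exact tsum_mem_range_toENNReal hfirst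

/-- The counting measures form a Borel set. -/
lemma measurableSet_setOf_counting [PolishSpace X] (h0 : ∀ k x, 0 ≤ h k x)
    (hpos : ∀ x, ∃ k, 0 < h k x) :
    MeasurableSet {ν : MBase h | ∀ A, MeasurableSet A → ∃ n : ℕ∞, ν.1 A = (n : ℝ≥0∞)} := by
  let 𝒜 : Set (Set X) := generateSetAlgebra (TopologicalSpace.countableBasis X)
  have halg : IsSetAlgebra 𝒜 := isSetAlgebra_generateSetAlgebra
  have hgen : ‹MeasurableSpace X› = MeasurableSpace.generateFrom 𝒜 := by
    rw [generateFrom_generateSetAlgebra_eq, BorelSpace.measurable_eq (α := X)]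
    exact (TopologicalSpace.isBasis_countableBasis X).borel_eq_generateFrom
  have hcount : 𝒜.Countable :=
    countable_generateSetAlgebra (TopologicalSpace.countable_countableBasis X)
  have hmeas (A) (hA : A ∈ 𝒜) : MeasurableSet A := by
    rw [hgen]; exact MeasurableSpace.measurableSet_generateFrom hA
  -- A countable generating algebra reduces integrality on all Borel sets to countably many
  -- conditions, each of them measurable.
  have hset : {ν : MBase h | ∀ A, MeasurableSet A → ∃ n : ℕ∞, ν.1 A = (n : ℝ≥0∞)}
      = ⋂ (k : ℕ) (n : ℕ), ⋂ A ∈ 𝒜,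
        {ν : MBase h | ν.1 (finitePart h k n ∩ A) ∈ Set.range ENat.toENNReal} := by
    ext ν
    simp only [Set.mem_iInter, Set.mem_ofPred_eq]
    constructor
    · intro hν k n A hA
      obtain ⟨a, ha⟩ := hν _ ((measurableSet_finitePart k n).inter (hmeas A hA))
      exact ⟨a, ha.symm⟩
    · intro hν A hA
      obtain ⟨a, ha⟩ := ν.forall_mem_range_toENNReal_of_generateFrom hpos hgen
        halg.isSetRing.isSetSemiring.isPiSystem halg.univ_mem hν hA
      exact ⟨a, ha.symm⟩
  rw [hset]
  refine MeasurableSet.iInter fun k => MeasurableSet.iInter fun n =>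
    MeasurableSet.biInter hcount fun A hA => ?_
  exact ((Measure.measurable_coe ((measurableSet_finitePart k n).inter (hmeas A hA))).comp
    (measurable_val h0 hpos)) ENat.isClosedEmbedding_toENNReal.isClosed_range.measurableSet

end MBase

/-! ### Lebesgue measure and cutoffs on the half-line -/

section HalfLine

lemma lebesgueHalfLine_Iic (K : ℝ≥0) : lebesgueHalfLine (Set.Iic K) = K := by
  have hemb : MeasurableEmbedding fun u : ℝ≥0 => (u : ℝ) :=
    MeasurableEmbedding.subtype_coe measurableSet_Ici
  rw [lebesgueHalfLine, hemb.comap_apply]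
  have : (fun u : ℝ≥0 => (u : ℝ)) '' Set.Iic K = Set.Icc (0 : ℝ) K := by
    ext r
    constructor
    · rintro ⟨u, hu, rfl⟩
      exact ⟨u.2, NNReal.coe_le_coe.mpr hu⟩
    · rintro ⟨h0, hK⟩
      exact ⟨⟨r, h0⟩, NNReal.coe_le_coe.mp hK, rfl⟩
  rw [this, Real.volume_Icc, sub_zero, ENNReal.ofReal_coe_nnreal]

instance : SigmaFinite lebesgueHalfLine := by
  refine ⟨⟨⟨fun n : ℕ => Set.Iic (n : ℝ≥0), fun _ => trivial, fun n => ?_, ?_⟩⟩⟩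
  · rw [lebesgueHalfLine_Iic]; exact ENNReal.coe_lt_top
  · exact Set.iUnion_eq_univ_iff.mpr fun u => exists_nat_ge u

/-- A continuous function on `[0, ∞)` which is `1` on `[0, m]` and `0` on `[m + 1, ∞)`. -/
def cutoff (m : ℕ) : ℝ≥0 →ᵇ ℝ :=
  BoundedContinuousFunction.ofNormedAddCommGroup (fun u => min 1 (max 0 ((m : ℝ) + 1 - u)))
    (by fun_prop) 1 (fun u => by
      rw [Real.norm_of_nonneg (le_min zero_le_one (le_max_left _ _))]
      exact min_le_left _ _)

lemma cutoff_apply (m : ℕ) (u : ℝ≥0) : cutoff m u = min 1 (max 0 ((m : ℝ) + 1 - u)) := rfl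

lemma cutoff_nonneg (m : ℕ) (u : ℝ≥0) : 0 ≤ cutoff m u := le_min zero_le_one (le_max_left _ _)

lemma cutoff_le_one (m : ℕ) (u : ℝ≥0) : cutoff m u ≤ 1 := min_le_left _ _

lemma cutoff_eq_one {m : ℕ} {u : ℝ≥0} (hu : u ≤ m) : cutoff m u = 1 := by
  have : (u : ℝ) ≤ m := by exact_mod_cast hu
  rw [cutoff_apply, max_eq_right (by linarith), min_eq_left (by linarith)]

lemma cutoff_eq_zero {m : ℕ} {u : ℝ≥0} (hu : (m : ℝ≥0) + 1 < u) : cutoff m u = 0 := by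
  have : (m : ℝ) + 1 < u := by exact_mod_cast hu
  rw [cutoff_apply, max_eq_left (by linarith), min_eq_right (by linarith)]

lemma cutoff_le_indicator (m : ℕ) (u : ℝ≥0) :
    cutoff m u ≤ (Set.Iic ((m : ℝ≥0) + 1)).indicator (fun _ => (1 : ℝ)) u := by
  by_cases hu : u ≤ (m : ℝ≥0) + 1
  · rw [Set.indicator_of_mem (Set.mem_Iic.mpr hu)]; exact cutoff_le_one m u
  · rw [Set.indicator_of_notMem (by simpa using hu), cutoff_eq_zero (not_le.mp hu)]

lemma integrable_indicator_Iic (K : ℝ≥0) :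
    Integrable ((Set.Iic K).indicator fun _ => (1 : ℝ)) lebesgueHalfLine := by
  rw [integrable_indicator_iff measurableSet_Iic]
  exact integrableOn_const (by rw [lebesgueHalfLine_Iic]; exact ENNReal.coe_ne_top)

lemma integrable_cutoff (m : ℕ) : Integrable (cutoff m) lebesgueHalfLine := by
  refine (integrable_indicator_Iic ((m : ℝ≥0) + 1)).mono'
    (cutoff m).continuous.aestronglyMeasurable (Eventually.of_forall fun u => ?_)
  rw [Real.norm_of_nonneg (cutoff_nonneg m u)]
  exact cutoff_le_indicator m u

/-- The exact value of the integral is irrelevant; only its growth with `m` matters, which makes the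
normalized cutoff uniformly small. -/
lemma le_integral_cutoff (m : ℕ) : (m : ℝ) ≤ ∫ u, cutoff m u ∂lebesgueHalfLine := by
  have h1 : ∫ u, (Set.Iic (m : ℝ≥0)).indicator (fun _ => (1 : ℝ)) u ∂lebesgueHalfLine = m := by
    rw [integral_indicator_const _ measurableSet_Iic, Measure.real, lebesgueHalfLine_Iic]
    simp
  rw [← h1]
  refine integral_mono (integrable_indicator_Iic _) (integrable_cutoff m) fun u => ?_
  by_cases hu : u ≤ (m : ℝ≥0)
  · rw [Set.indicator_of_mem (Set.mem_Iic.mpr hu), cutoff_eq_one hu]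
  · rw [Set.indicator_of_notMem (by simpa using hu)]; exact cutoff_nonneg m u

end HalfLine

/-! ### Measures on the strip as a base space with weights h_k(x) χ_m(u) -/

section Strip

variable {S : Type*} [TopologicalSpace S]

/-- A bounded continuous function on `S`, as a function on `S × [0, ∞)`. -/
def onStrip (φ : S →ᵇ ℝ) : (S × ℝ≥0) →ᵇ ℝ := φ.compContinuous ⟨Prod.fst, continuous_fst⟩

@[simp] lemma onStrip_apply (φ : S →ᵇ ℝ) (p : S × ℝ≥0) : onStrip φ p = φ p.1 := rfl

/-- The function `cutoff m`, as a function on `S × [0, ∞)`. -/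
def stripCutoff (S : Type*) [TopologicalSpace S] (m : ℕ) : (S × ℝ≥0) →ᵇ ℝ :=
  (cutoff m).compContinuous ⟨Prod.snd, continuous_snd⟩

@[simp] lemma stripCutoff_apply (m : ℕ) (p : S × ℝ≥0) : stripCutoff S m p = cutoff m p.2 := rfl

/-- The functions `(x, u) ↦ h k x * cutoff m u`, as a sequence. -/
def stripWeight (h : ℕ → S →ᵇ ℝ) (n : ℕ) : (S × ℝ≥0) →ᵇ ℝ :=
  onStrip (h n.unpair.1) * stripCutoff S n.unpair.2

lemma stripWeight_apply (h : ℕ → S →ᵇ ℝ) (n : ℕ) (p : S × ℝ≥0) :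
    stripWeight h n p = h n.unpair.1 p.1 * cutoff n.unpair.2 p.2 := rfl

variable {h : ℕ → S →ᵇ ℝ}

lemma stripWeight_nonneg (h0 : ∀ k x, 0 ≤ h k x) (n : ℕ) (p : S × ℝ≥0) : 0 ≤ stripWeight h n p :=
  mul_nonneg (h0 _ _) (cutoff_nonneg _ _)

lemma exists_stripWeight_pos (hpos : ∀ x, ∃ k, 0 < h k x) (p : S × ℝ≥0) :
    ∃ n, 0 < stripWeight h n p := by
  obtain ⟨k, hk⟩ := hpos p.1
  obtain ⟨m, hm⟩ := exists_nat_ge p.2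
  refine ⟨Nat.pair k m, ?_⟩
  rw [stripWeight_apply, Nat.unpair_pair, cutoff_eq_one hm, mul_one]
  exact hk

variable [MeasurableSpace S]

variable [BorelSpace S]

/-- The measures on the strip are the measures belonging to the weights `h k x * cutoff m u`. -/
def MStrip.equivBase (h0 : ∀ k x, 0 ≤ h k x) : MStrip h ≃ MBase (stripWeight h) where
  toFun μ := ⟨μ.1, fun n => by
    refine lt_of_le_of_lt ?_ (μ.2 n.unpair.1 ((n.unpair.2 : ℝ≥0) + 1))
    rw [← lintegral_indicator (MeasurableSet.univ.prod measurableSet_Iic)]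
    refine lintegral_mono fun p => ?_
    by_cases hp : p.2 ≤ (n.unpair.2 : ℝ≥0) + 1
    · have hmem : p ∈ Set.univ ×ˢ Set.Iic ((n.unpair.2 : ℝ≥0) + 1) := ⟨trivial, hp⟩
      rw [Set.indicator_of_mem hmem, stripWeight_apply]
      exact ENNReal.ofReal_le_ofReal (mul_le_of_le_one_right (h0 _ _) (cutoff_le_one _ _))
    · rw [stripWeight_apply, cutoff_eq_zero (not_le.mp hp)]
      simp⟩
  invFun μ := ⟨μ.1, fun k K => by
    obtain ⟨m, hm⟩ := exists_nat_ge K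
    refine lt_of_le_of_lt ?_ (μ.2 (Nat.pair k m))
    rw [← lintegral_indicator (MeasurableSet.univ.prod measurableSet_Iic)]
    refine lintegral_mono fun p => ?_
    by_cases hp : p.2 ≤ K
    · have hmem : p ∈ Set.univ ×ˢ Set.Iic K := ⟨trivial, hp⟩
      rw [Set.indicator_of_mem hmem, stripWeight_apply, Nat.unpair_pair,
        cutoff_eq_one (hp.trans hm), mul_one]
    · rw [Set.indicator_of_notMem fun hmem => hp hmem.2]
      exact zero_le⟩
  left_inv _ := rfl
  right_inv _ := rfl

/-- The identification of the two spaces of measures is a homeomorphism. -/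
def MStrip.homeoBase (h0 : ∀ k x, 0 ≤ h k x) : MStrip h ≃ₜ MBase (stripWeight h) where
  toEquiv := MStrip.equivBase h0
  continuous_toFun := by
    refine continuous_induced_rng.mpr (continuous_pi fun q => ?_)
    have hc : Continuous fun (μ : MStrip h) (q : ℕ × StripTest S) =>
      ∫ p, q.2.1 p * h q.1 p.1 ∂μ.1 := continuous_induced_dom
    -- The cutoff in the weight is moved into the test function, which makes its support bounded.
    let f : StripTest S := ⟨q.2 * stripCutoff S q.1.unpair.2, (q.1.unpair.2 : ℝ≥0) + 1,
      fun x u hu => by simp [cutoff_eq_zero hu]⟩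
    have h2 := (continuous_apply (q.1.unpair.1, f)).comp hc
    convert h2 using 2 with μ
    refine integral_congr_ae (Eventually.of_forall fun p => ?_)
    simp only [f, stripWeight_apply, BoundedContinuousFunction.coe_mul, Pi.mul_apply,
      stripCutoff_apply]
    ring
  continuous_invFun := by
    refine continuous_induced_rng.mpr (continuous_pi fun q => ?_)
    obtain ⟨K, hK⟩ := q.2.2
    obtain ⟨m, hm⟩ := exists_nat_ge K
    -- The cutoff with `m ≥ K` equals 1 on the support of the test function, so inserting it costs
    -- nothing.
    have h2 := MBase.continuous_integral_mul_weight (h := stripWeight h) (Nat.pair q.1 m) q.2.1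
    convert h2 using 2 with μ
    refine integral_congr_ae (Eventually.of_forall fun p => ?_)
    simp only [stripWeight_apply, Nat.unpair_pair]
    by_cases hp : p.2 ≤ K
    · rw [cutoff_eq_one (hp.trans hm), mul_one]
    · rw [show q.2.1 p = 0 from hK p.1 p.2 (not_le.mp hp), zero_mul, zero_mul]

/-- The function `μ ↦ exp (-∫ f dμ)`. -/
def MStrip.laplace (h0 : ∀ k x, 0 ≤ h k x) (f : testCone (stripWeight h)) : MStrip h →ᵇ ℝ :=
  (MBase.laplace (stripWeight_nonneg h0) f).compContinuous
    ⟨MStrip.homeoBase h0, (MStrip.homeoBase h0).continuous⟩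

lemma MStrip.laplace_apply (h0 : ∀ k x, 0 ≤ h k x) (f : testCone (stripWeight h)) (μ : MStrip h) :
    MStrip.laplace h0 f μ = Real.exp (-∫ p, f.1 p ∂μ.1) := rfl

variable [PolishSpace S]

lemma MStrip.metrizableSpace (h0 : ∀ k x, 0 ≤ h k x) (hpos : ∀ x, ∃ k, 0 < h k x) :
    TopologicalSpace.MetrizableSpace (MStrip h) :=
  have := MBase.metrizableSpace (stripWeight_nonneg h0) (exists_stripWeight_pos hpos)
  (MStrip.homeoBase h0).isEmbedding.metrizableSpace

lemma MStrip.measurable_val (h0 : ∀ k x, 0 ≤ h k x) (hpos : ∀ x, ∃ k, 0 < h k x) :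
    Measurable fun μ : MStrip h => μ.1 :=
  (MBase.measurable_val (stripWeight_nonneg h0) (exists_stripWeight_pos hpos)).comp
    (MStrip.homeoBase h0).continuous.measurable

lemma MStrip.measurable_of_measurable_val (h0 : ∀ k x, 0 ≤ h k x) {Ω : Type*} [MeasurableSpace Ω]
    {Y : Ω → MStrip h} (hY : Measurable fun ω => (Y ω).1) : Measurable Y :=
  (MStrip.homeoBase h0).symm.continuous.measurable.comp
    (MBase.measurable_of_measurable_val (stripWeight_nonneg h0)
      (Y := fun ω => MStrip.homeoBase h0 (Y ω)) hY)

lemma MStrip.measurableSet_setOf_counting (h0 : ∀ k x, 0 ≤ h k x) (hpos : ∀ x, ∃ k, 0 < h k x) :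
    MeasurableSet {μ : MStrip h | ∀ A, MeasurableSet A → ∃ n : ℕ∞, μ.1 A = (n : ℝ≥0∞)} :=
  (MStrip.homeoBase h0).continuous.measurable (MBase.measurableSet_setOf_counting
    (stripWeight_nonneg h0) (exists_stripWeight_pos hpos))

/-- Convergence of the Laplace functionals implies weak convergence. -/
theorem MStrip.tendsto_of_laplace (h0 : ∀ k x, 0 ≤ h k x) {Q : ℕ → ProbabilityMeasure (MStrip h)}
    {Q₀ : ProbabilityMeasure (MStrip h)}
    (hQ : ∀ f : testCone (stripWeight h),
      Tendsto (fun n => ∫ μ, MStrip.laplace h0 f μ ∂(Q n : Measure (MStrip h))) atTop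
        (𝓝 (∫ μ, MStrip.laplace h0 f μ ∂(Q₀ : Measure (MStrip h))))) :
    Tendsto Q atTop (𝓝 Q₀) := by
  have hT := (MStrip.homeoBase h0).continuous
  have hT' := (MStrip.homeoBase h0).symm.continuous
  have hmap (R : ProbabilityMeasure (MStrip h)) (f : testCone (stripWeight h)) :
      ∫ μ, MBase.laplace (stripWeight_nonneg h0) f μ
        ∂(R.map hT.measurable.aemeasurable : ProbabilityMeasure _)
      = ∫ μ, MStrip.laplace h0 f μ ∂(R : Measure (MStrip h)) := by
    rw [ProbabilityMeasure.toMeasure_map, integral_map hT.measurable.aemeasurable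
      (MBase.laplace (stripWeight_nonneg h0) f).continuous.aestronglyMeasurable]
    rfl
  have h1 : Tendsto (fun n => (Q n).map hT.measurable.aemeasurable) atTop
      (𝓝 (Q₀.map hT.measurable.aemeasurable)) :=
    MBase.tendsto_of_laplace (stripWeight_nonneg h0) fun f => by
      simpa only [hmap] using hQ f
  have h2 := ProbabilityMeasure.tendsto_map_of_tendsto_of_continuous _ _ h1 hT'
  have hback (R : ProbabilityMeasure (MStrip h)) :
      (R.map hT.measurable.aemeasurable).map hT'.measurable.aemeasurable = R := by
    refine Subtype.ext ?_
    change Measure.map _ (Measure.map _ _) = _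
    rw [Measure.map_map hT'.measurable hT.measurable]
    simp
  simpa only [hback] using h2

end Strip

/-! ### The transform between test functions on the strip and on the base -/

section TestFunctions

/-- Composition of a bounded continuous function with a function that is continuous on its range. -/
lemma exists_boundedContinuousFunction_comp {Y : Type*} [TopologicalSpace Y] (f : Y →ᵇ ℝ) {b : ℝ}
    (hf : ∀ y, f y ∈ Set.Icc 0 b) {ρ : ℝ → ℝ} (hρ : ContinuousOn ρ (Set.Icc 0 b)) :
    ∃ g : Y →ᵇ ℝ, ∀ y, g y = ρ (f y) := by
  obtain ⟨C, hC⟩ := (isCompact_Icc.image_of_continuousOn hρ).isBounded.exists_norm_le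
  exact ⟨BoundedContinuousFunction.ofNormedAddCommGroup (fun y => ρ (f y))
    (hρ.comp_continuous f.continuous hf) C fun y => hC _ ⟨_, hf y, rfl⟩, fun y => rfl⟩

variable {S : Type*} [TopologicalSpace S] {h : ℕ → S →ᵇ ℝ}

lemma onStrip_mul_stripCutoff_mem {ψ : S →ᵇ ℝ} (hψ : ψ ∈ testCone h) (m : ℕ) :
    onStrip ψ * stripCutoff S m ∈ testCone (stripWeight h) := by
  induction hψ using AddSubmonoid.closure_induction with
  | mem ψ hψ =>
    obtain ⟨k, φ, hφ, rfl⟩ := hψ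
    have : onStrip (φ * h k) * stripCutoff S m = onStrip φ * stripWeight h (Nat.pair k m) := by
      ext p
      simp [stripWeight_apply, mul_assoc]
    rw [this]
    exact mul_mem_testCone_of_generator _ fun p => hφ p.1
  | zero =>
    have : onStrip (0 : S →ᵇ ℝ) * stripCutoff S m = 0 := by ext p; simp
    rw [this]
    exact zero_mem _
  | add φ φ' _ _ ih ih₂ =>
    have : onStrip (φ + φ') * stripCutoff S m
        = onStrip φ * stripCutoff S m + onStrip φ' * stripCutoff S m := by ext p; simp [add_mul]
    rw [this]
    exact add_mem ih ih₂

/-- Test functions on the strip of the form `-log (1 - c * ψ x * cutoff m u)`. -/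
lemma exists_testCone_neg_log (h0 : ∀ k x, 0 ≤ h k x) {ψ : S →ᵇ ℝ} (hψ : ψ ∈ testCone h) (m : ℕ)
    {c : ℝ} (hc : 0 ≤ c) (hcψ : ∀ x, c * ψ x ≤ 1 / 2) :
    ∃ f ∈ testCone (stripWeight h), ∀ x u,
      f (x, u) = -Real.log (1 - c * ψ x * cutoff m u) := by
  let y : (S × ℝ≥0) →ᵇ ℝ := c • (onStrip ψ * stripCutoff S m)
  have hy (p) : y p = c * ψ p.1 * cutoff m p.2 := by
    simp [y, mul_assoc]
  have hψ0 (x) : 0 ≤ c * ψ x := mul_nonneg hc (nonneg_of_mem_testCone h0 hψ x)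
  have hyI (p) : y p ∈ Set.Icc (0 : ℝ) (1 / 2) := by
    rw [hy]
    exact ⟨mul_nonneg (hψ0 _) (cutoff_nonneg _ _),
      (mul_le_of_le_one_right (hψ0 _) (cutoff_le_one _ _)).trans (hcψ _)⟩
  -- The quotient -log(1 - t)/t, continued across t = 0 by `dslope`. It exhibits -log(1 - y) as a
  -- multiplier times `y`; the absolute value makes the multiplier visibly nonnegative without
  -- changing it where it is used.
  let ρ : ℝ → ℝ := fun t => |dslope (fun s => -Real.log (1 - s)) 0 t|
  have hdiff (t : ℝ) (ht : t ∈ Set.Iio (1 : ℝ)) :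
      DifferentiableAt ℝ (fun s => -Real.log (1 - s)) t := by
    have : 1 - t ≠ 0 := by have := Set.mem_Iio.mp ht; linarith
    fun_prop (disch := assumption)
  have hρ : ContinuousOn ρ (Set.Icc 0 (1 / 2)) := by
    refine ContinuousOn.abs (ContinuousOn.mono (s := Set.Iio (1 : ℝ)) ?_ ?_)
    · rw [continuousOn_dslope (isOpen_Iio.mem_nhds (by norm_num))]
      exact ⟨fun t ht => (hdiff t ht).continuousAt.continuousWithinAt, hdiff 0 (by norm_num)⟩
    · intro t ht
      exact Set.mem_Iio.mpr (by linarith [ht.2])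
  have hρmul (t : ℝ) (ht : t ∈ Set.Icc (0 : ℝ) (1 / 2)) : ρ t * t = -Real.log (1 - t) := by
    have h1 : (t - 0) • dslope (fun s => -Real.log (1 - s)) 0 t = -Real.log (1 - t) := by
      rw [sub_smul_dslope]; simp
    have h2 : 0 ≤ -Real.log (1 - t) := by
      have := Real.log_nonpos (x := 1 - t) (by linarith [ht.2]) (by linarith [ht.1])
      linarith
    rw [sub_zero, smul_eq_mul] at h1
    calc ρ t * t = |t * dslope (fun s => -Real.log (1 - s)) 0 t| := by
          rw [abs_mul, abs_of_nonneg ht.1, mul_comm]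
      _ = _ := by rw [h1, abs_of_nonneg h2]
  obtain ⟨g, hg⟩ := exists_boundedContinuousFunction_comp y hyI hρ
  refine ⟨(c • g) * (onStrip ψ * stripCutoff S m), mul_mem_testCone (fun p => ?_)
    (onStrip_mul_stripCutoff_mem hψ m), fun x u => ?_⟩
  · have hg0 : 0 ≤ g p := by rw [hg]; exact abs_nonneg _
    exact mul_nonneg hc hg0
  · have h1 := hρmul (y (x, u)) (hyI _)
    rw [← hg, hy] at h1
    rw [← h1]
    simp only [BoundedContinuousFunction.coe_mul, Pi.mul_apply, BoundedContinuousFunction.coe_smul,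
      smul_eq_mul, onStrip_apply, stripCutoff_apply]
    ring

/-- The function `ψ` on the base is obtained from the function `f` on the strip by integrating
`1 - exp (-f)` over the half-line. -/
def IsStripTransform (f : (S × ℝ≥0) →ᵇ ℝ) (ψ : S →ᵇ ℝ) : Prop :=
  ∀ x, Integrable (fun u => 1 - Real.exp (-f (x, u))) lebesgueHalfLine ∧
    ψ x = ∫ u, (1 - Real.exp (-f (x, u))) ∂lebesgueHalfLine

/-- For a generator r φ h_k χ_m the factor h_k comes out of the integral over `u`. What remains is
bounded, and continuous in `x` by dominated convergence, with dominating function ‖r φ‖ χ_m. -/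
lemma exists_testCone_integral [FirstCountableTopology S] {f : (S × ℝ≥0) →ᵇ ℝ}
    (hf : f ∈ testCone (stripWeight h)) {r : (S × ℝ≥0) →ᵇ ℝ} (hr : ∀ p, 0 ≤ r p) :
    ∃ ψ ∈ testCone h, ∀ x, Integrable (fun u => r (x, u) * f (x, u)) lebesgueHalfLine ∧
      ψ x = ∫ u, r (x, u) * f (x, u) ∂lebesgueHalfLine := by
  induction hf using AddSubmonoid.closure_induction with
  | mem f hf =>
    obtain ⟨n, φ, hφ, rfl⟩ := hf
    set k := n.unpair.1 with hk
    set m := n.unpair.2 with hm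
    have hnorm (x : S) (u : ℝ≥0) :
        ‖r (x, u) * φ (x, u) * cutoff m u‖ ≤ ‖r * φ‖ * cutoff m u := by
      rw [norm_mul, Real.norm_of_nonneg (cutoff_nonneg m u)]
      exact mul_le_mul_of_nonneg_right ((r * φ).norm_coe_le_norm (x, u)) (cutoff_nonneg m u)
    have hbound : Integrable (fun u => ‖r * φ‖ * cutoff m u) lebesgueHalfLine :=
      (integrable_cutoff m).const_mul _
    have hmeas (x : S) : AEStronglyMeasurable (fun u => r (x, u) * φ (x, u) * cutoff m u)
        lebesgueHalfLine := by
      refine Continuous.aestronglyMeasurable ?_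
      fun_prop
    have hint (x : S) : Integrable (fun u => r (x, u) * φ (x, u) * cutoff m u)
        lebesgueHalfLine :=
      hbound.mono' (hmeas x) (Eventually.of_forall (hnorm x))
    have hcont : Continuous fun x => ∫ u, r (x, u) * φ (x, u) * cutoff m u ∂lebesgueHalfLine := by
      refine continuous_of_dominated hmeas (fun x => Eventually.of_forall (hnorm x)) hbound
        (Eventually.of_forall fun u => ?_)
      fun_prop
    let a : S →ᵇ ℝ := BoundedContinuousFunction.ofNormedAddCommGroup _ hcont
      (∫ u, ‖r * φ‖ * cutoff m u ∂lebesgueHalfLine) fun x =>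
        norm_integral_le_of_norm_le hbound (Eventually.of_forall (hnorm x))
    have hfun (x : S) : (fun u => r (x, u) * (φ * stripWeight h n) (x, u))
        = fun u => r (x, u) * φ (x, u) * cutoff m u * h k x := by
      ext u
      simp only [BoundedContinuousFunction.coe_mul, Pi.mul_apply, stripWeight_apply, ← hk, ← hm]
      ring
    refine ⟨a * h k, mul_mem_testCone_of_generator k fun x => integral_nonneg fun u =>
      mul_nonneg (mul_nonneg (hr _) (hφ _)) (cutoff_nonneg m u), fun x => ?_⟩
    rw [hfun]
    exact ⟨(hint x).mul_const _, (integral_mul_const _ _).symm⟩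
  | zero => exact ⟨0, zero_mem _, fun x => by simp⟩
  | add f f' _ _ ih ih' =>
    obtain ⟨ψ, hψ, hψi⟩ := ih
    obtain ⟨ψ', hψ', hψi'⟩ := ih'
    refine ⟨ψ + ψ', add_mem hψ hψ', fun x => ?_⟩
    simp only [BoundedContinuousFunction.coe_add, Pi.add_apply, mul_add]
    refine ⟨(hψi x).1.add (hψi' x).1, ?_⟩
    rw [integral_add (hψi x).1 (hψi' x).1, (hψi x).2, (hψi' x).2]

/-- Every test function on the strip has a transform on the base. -/
lemma exists_isStripTransform [FirstCountableTopology S] (h0 : ∀ k x, 0 ≤ h k x)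
    (f : testCone (stripWeight h)) : ∃ ψ : testCone h, IsStripTransform f.1 ψ.1 := by
  have hf0 := nonneg_of_mem_testCone (stripWeight_nonneg h0) f.2
  have hfI (p) : f.1 p ∈ Set.Icc 0 ‖f.1‖ :=
    ⟨hf0 p, (le_abs_self _).trans (f.1.norm_coe_le_norm p)⟩
  -- The continuous quotient (1 - exp(-t))/t, so that 1 - exp(-f) becomes a nonnegative bounded
  -- continuous multiple of `f`.
  let ρ : ℝ → ℝ := fun t => |dslope (fun s => 1 - Real.exp (-s)) 0 t|
  have hρ : Continuous ρ := by
    refine Continuous.abs ?_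
    rw [← continuousOn_univ, continuousOn_dslope univ_mem]
    exact ⟨by fun_prop, by fun_prop⟩
  have hρmul (t : ℝ) (ht : 0 ≤ t) : ρ t * t = 1 - Real.exp (-t) := by
    have h1 : (t - 0) • dslope (fun s => 1 - Real.exp (-s)) 0 t = 1 - Real.exp (-t) := by
      rw [sub_smul_dslope]; simp
    have h2 : 0 ≤ 1 - Real.exp (-t) := by
      have := Real.exp_le_one_iff.mpr (neg_nonpos.mpr ht)
      linarith
    rw [sub_zero, smul_eq_mul] at h1
    calc ρ t * t = |t * dslope (fun s => 1 - Real.exp (-s)) 0 t| := by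
          rw [abs_mul, abs_of_nonneg ht, mul_comm]
      _ = _ := by rw [h1, abs_of_nonneg h2]
  obtain ⟨g, hg⟩ := exists_boundedContinuousFunction_comp f.1 hfI hρ.continuousOn
  obtain ⟨ψ, hψ, hψi⟩ := exists_testCone_integral f.2 (r := g)
    fun p => by rw [hg]; exact abs_nonneg _
  refine ⟨⟨ψ, hψ⟩, fun x => ?_⟩
  have : (fun u => 1 - Real.exp (-f.1 (x, u))) = fun u => g (x, u) * f.1 (x, u) := by
    ext u
    rw [hg, hρmul _ (hf0 _)]
  rw [this]
  exact hψi x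

/-- The functions `-log (1 - c * ψ x * cutoff m u)`, suitably normalized, have transform `ψ`. -/
lemma isStripTransform_of_neg_log {ψ : S →ᵇ ℝ} {m : ℕ} (hm : 0 < m)
    (hψ : ∀ x, 0 ≤ ψ x)
    (hcψ : ∀ x, (∫ u, cutoff m u ∂lebesgueHalfLine)⁻¹ * ψ x ≤ 1 / 2) {f : (S × ℝ≥0) →ᵇ ℝ}
    (hf : ∀ x u, f (x, u)
      = -Real.log (1 - (∫ u, cutoff m u ∂lebesgueHalfLine)⁻¹ * ψ x * cutoff m u)) :
    IsStripTransform f ψ := by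
  have hI : 0 < ∫ u, cutoff m u ∂lebesgueHalfLine :=
    lt_of_lt_of_le (by exact_mod_cast hm) (le_integral_cutoff m)
  set c := (∫ u, cutoff m u ∂lebesgueHalfLine)⁻¹ with hc
  intro x
  have hfun : (fun u => 1 - Real.exp (-f (x, u))) = fun u => c * ψ x * cutoff m u := by
    ext u
    have h0 : 0 ≤ c * ψ x := mul_nonneg (inv_nonneg.mpr hI.le) (hψ x)
    have h1 : c * ψ x * cutoff m u ≤ 1 / 2 :=
      (mul_le_of_le_one_right h0 (cutoff_le_one m u)).trans (hcψ x)
    rw [hf, neg_neg, Real.exp_log (by linarith)]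
    ring
  rw [hfun]
  refine ⟨(integrable_cutoff m).const_mul _, ?_⟩
  rw [integral_const_mul, hc]
  field_simp

end TestFunctions

/-! ### Poisson random measures on the strip, and their kernel -/

section PoissonIntegrals

lemma one_sub_expNeg_ofReal {r : ℝ} (hr : 0 ≤ r) :
    1 - expNeg (ENNReal.ofReal r) = ENNReal.ofReal (1 - Real.exp (-r)) := by
  rw [expNeg_ofReal hr, ENNReal.ofReal_sub _ (Real.exp_pos _).le, ENNReal.ofReal_one]

lemma one_sub_expNeg_le (y : ℝ≥0∞) : 1 - expNeg y ≤ y := by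
  rcases eq_or_ne y ∞ with rfl | hy
  · exact le_top
  · rw [← ENNReal.ofReal_toReal hy, one_sub_expNeg_ofReal ENNReal.toReal_nonneg]
    refine ENNReal.ofReal_le_ofReal ?_
    linarith [Real.add_one_le_exp (-y.toReal)]

/-- A function with finite integral with respect to the mean measure has almost surely finite
integral with respect to the Poisson random measure. -/
lemma IsPoissonRandomMeasure.ae_lintegral_lt_top {Ω X : Type*} [MeasurableSpace Ω]
    [MeasurableSpace X] {P : Measure Ω} [IsProbabilityMeasure P] {N : Ω → Measure X}
    {ν : Measure X} [SigmaFinite ν] (hN : IsPoissonRandomMeasure P N ν) (hmeas : Measurable N)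
    {f : X → ℝ≥0∞} (hf : Measurable f) (hfin : ∫⁻ x, f x ∂ν ≠ ∞) :
    ∀ᵐ ω ∂P, ∫⁻ x, f x ∂N ω < ∞ := by
  have hG : MeasurableSet {ω | ∫⁻ x, f x ∂N ω < ∞} :=
    measurableSet_lt ((Measure.measurable_lintegral hf).comp hmeas) measurable_const
  -- With t ↓ 0, exp(-t ∫ f dN) vanishes where the integral is infinite, so its expectation bounds
  -- the probability of finiteness from below; that expectation is at least exp(-t ∫ f dν), which
  -- tends to 1.
  let t : ℕ → ℝ≥0∞ := fun j => ((j : ℝ≥0∞) + 1)⁻¹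
  have ht0 (j) : t j ≠ 0 := ENNReal.inv_ne_zero.mpr (by finiteness)
  have hle (j : ℕ) : expNeg (t j * ∫⁻ x, f x ∂ν) ≤ P {ω | ∫⁻ x, f x ∂N ω < ∞} := by
    calc expNeg (t j * ∫⁻ x, f x ∂ν)
        ≤ expNeg (∫⁻ x, (1 - expNeg (t j * f x)) ∂ν) := by
          refine strictAnti_expNeg.antitone ?_
          rw [← lintegral_const_mul _ hf]
          exact lintegral_mono fun x => one_sub_expNeg_le _
      _ = ∫⁻ ω, expNeg (∫⁻ x, t j * f x ∂N ω) ∂P :=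
          (hN.lintegral_expNeg hmeas (hf.const_mul _)).symm
      _ ≤ ∫⁻ ω, {ω | ∫⁻ x, f x ∂N ω < ∞}.indicator 1 ω ∂P := by
          refine lintegral_mono fun ω => ?_
          by_cases hω : ∫⁻ x, f x ∂N ω < ∞
          · rw [Set.indicator_of_mem (by simpa using hω)]
            exact expNeg_le_one _
          · rw [lintegral_const_mul _ hf, not_lt_top_iff.mp hω, ENNReal.mul_top (ht0 j),
              expNeg_top]
            exact zero_le
      _ = _ := lintegral_indicator_one hG
  have hlim : Tendsto (fun j => expNeg (t j * ∫⁻ x, f x ∂ν)) atTop (𝓝 1) := by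
    have h1 : Tendsto t atTop (𝓝 0) := by
      have := (tendsto_add_atTop_iff_nat 1).mpr ENNReal.tendsto_inv_nat_nhds_zero
      simpa [t] using this
    have h2 := ENNReal.Tendsto.mul_const h1 (Or.inr hfin)
    rw [zero_mul] at h2
    have h3 := (continuous_expNeg.tendsto 0).comp h2
    rwa [expNeg_zero] at h3
  have h1 : P {ω | ∫⁻ x, f x ∂N ω < ∞} = 1 :=
    le_antisymm prob_le_one (le_of_tendsto' hlim hle)
  exact (mem_ae_iff_prob_eq_one hG).mpr h1

end PoissonIntegrals

section PoissonStrip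

variable {S : Type u} [TopologicalSpace S] [MeasurableSpace S] [BorelSpace S] {h : ℕ → S →ᵇ ℝ}

lemma MBase.lintegral_stripWeight_prod_ne_top (ν : MBase h) (h0 : ∀ k x, 0 ≤ h k x) (n : ℕ) :
    ∫⁻ p, ENNReal.ofReal (stripWeight h n p) ∂ν.1.prod lebesgueHalfLine ≠ ∞ := by
  simp only [stripWeight_apply, ENNReal.ofReal_mul (h0 _ _)]
  rw [lintegral_prod_mul (f := fun x => ENNReal.ofReal (h n.unpair.1 x))
    (g := fun u => ENNReal.ofReal (cutoff n.unpair.2 u))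
    (h n.unpair.1).continuous.measurable.ennreal_ofReal.aemeasurable
    (cutoff n.unpair.2).continuous.measurable.ennreal_ofReal.aemeasurable]
  refine ENNReal.mul_ne_top (ν.2 _).ne ?_
  exact (integrable_cutoff n.unpair.2).lintegral_lt_top.ne

variable [PolishSpace S]

/-- The Laplace functional of a Poisson random measure on the strip. -/
lemma integral_laplace_of_isPoissonRandomMeasure (h0 : ∀ k x, 0 ≤ h k x)
    (hpos : ∀ x, ∃ k, 0 < h k x) {Q : Measure (MStrip h)} [IsProbabilityMeasure Q]
    {ν : MBase h}
    (hQ : IsPoissonRandomMeasure Q (fun μ : MStrip h => μ.1) (ν.1.prod lebesgueHalfLine))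
    {f : testCone (stripWeight h)} {ψ : testCone h} (hfψ : IsStripTransform f.1 ψ.1) :
    ∫ μ, MStrip.laplace h0 f μ ∂Q = MBase.laplace h0 ψ ν := by
  have := MBase.sigmaFinite hpos ν
  have hf0 := nonneg_of_mem_testCone (stripWeight_nonneg h0) f.2
  have hψ0 := nonneg_of_mem_testCone h0 ψ.2
  have key := hQ.lintegral_expNeg (MStrip.measurable_val h0 hpos)
    (f := fun p => ENNReal.ofReal (f.1 p)) f.1.continuous.measurable.ennreal_ofReal
  have hL (μ : MStrip h) : expNeg (∫⁻ p, ENNReal.ofReal (f.1 p) ∂μ.1)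
      = ENNReal.ofReal (MStrip.laplace h0 f μ) := by
    have hint : Integrable f.1 μ.1 := MBase.integrable_of_mem_testCone (stripWeight_nonneg h0)
      (MStrip.homeoBase h0 μ) f.2
    rw [← ofReal_integral_eq_lintegral_ofReal hint (Eventually.of_forall hf0),
      expNeg_ofReal (integral_nonneg hf0), MStrip.laplace_apply]
  have hR : ∫⁻ p, (1 - expNeg (ENNReal.ofReal (f.1 p))) ∂ν.1.prod lebesgueHalfLine
      = ENNReal.ofReal (∫ x, ψ.1 x ∂ν.1) := by
    have hm : Measurable fun p => 1 - expNeg (ENNReal.ofReal (f.1 p)) := measurable_const.sub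
      (measurable_expNeg.comp f.1.continuous.measurable.ennreal_ofReal)
    rw [lintegral_prod _ hm.aemeasurable,
      ofReal_integral_eq_lintegral_ofReal (MBase.integrable_of_mem_testCone h0 ν ψ.2)
        (Eventually.of_forall hψ0)]
    refine lintegral_congr fun x => ?_
    simp only [one_sub_expNeg_ofReal (hf0 _)]
    rw [(hfψ x).2, ofReal_integral_eq_lintegral_ofReal (hfψ x).1 (Eventually.of_forall fun u => ?_)]
    exact sub_nonneg.mpr (Real.exp_le_one_iff.mpr (neg_nonpos.mpr (hf0 _)))
  rw [hR, expNeg_ofReal (integral_nonneg hψ0)] at key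
  simp only [hL] at key
  have hL0 (μ : MStrip h) : 0 ≤ MStrip.laplace h0 f μ := (Real.exp_pos _).le
  rw [integral_eq_lintegral_of_nonneg_ae (Eventually.of_forall hL0)
    (MStrip.laplace h0 f).continuous.measurable.aestronglyMeasurable, key,
    ENNReal.toReal_ofReal (Real.exp_pos _).le, MBase.laplace_apply]

/-- Poisson random measures with mean measure `ν × Λ` exist on the strip. -/
lemma MStrip.exists_isPoissonRandomMeasure (h0 : ∀ k x, 0 ≤ h k x) (hpos : ∀ x, ∃ k, 0 < h k x)
    (ν : MBase h) : ∃ Q : ProbabilityMeasure (MStrip h),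
      IsPoissonRandomMeasure (Q : Measure (MStrip h)) (fun μ : MStrip h => μ.1)
        (ν.1.prod lebesgueHalfLine) := by
  have := MBase.sigmaFinite hpos ν
  obtain ⟨Ω, _, P, N, hP, hNm, hN⟩ := _root_.exists_isPoissonRandomMeasure
    (ν.1.prod lebesgueHalfLine)
  -- The event that `N` satisfies the integrability conditions of the strip. It has probability 1,
  -- and off it `N` is replaced by the zero measure.
  let G : Set Ω := {ω | ∀ n, ∫⁻ p, ENNReal.ofReal (stripWeight h n p) ∂N ω < ∞}
  have hwm (n : ℕ) : Measurable fun p => ENNReal.ofReal (stripWeight h n p) :=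
    (stripWeight h n).continuous.measurable.ennreal_ofReal
  have hG : MeasurableSet G := by
    have : G = ⋂ n, {ω | ∫⁻ p, ENNReal.ofReal (stripWeight h n p) ∂N ω < ∞} := by
      ext ω
      simp [G]
    rw [this]
    exact MeasurableSet.iInter fun n => measurableSet_lt
      ((Measure.measurable_lintegral (hwm n)).comp hNm) measurable_const
  have hGae : ∀ᵐ ω ∂P, ω ∈ G := ae_all_iff.mpr fun n =>
    hN.ae_lintegral_lt_top hNm (hwm n) (ν.lintegral_stripWeight_prod_ne_top h0 n)
  classical
  let Y : Ω → MStrip h := fun ω => (MStrip.homeoBase h0).symm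
    ⟨if ω ∈ G then N ω else 0, by
      intro n
      split_ifs with hω
      · exact hω n
      · simp⟩
  have hYval (ω) : (Y ω).1 = if ω ∈ G then N ω else 0 := rfl
  have hYm : Measurable Y := by
    refine MStrip.measurable_of_measurable_val h0 ?_
    simp only [hYval]
    exact Measurable.ite hG hNm measurable_const
  have hYN : ∀ᵐ ω ∂P, (Y ω).1 = N ω := by
    filter_upwards [hGae] with ω hω
    rw [hYval, if_pos hω]
  have hQ : IsProbabilityMeasure (P.map Y) := Measure.isProbabilityMeasure_map hYm.aemeasurable
  refine ⟨⟨P.map Y, hQ⟩, ?_⟩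
  change IsPoissonRandomMeasure (P.map Y) _ _
  refine isPoissonRandomMeasure_of_laplace (MStrip.measurable_val h0 hpos) ?_ ?_
  -- An almost sure property passes to the image law because the counting measures form a Borel set.
  · refine (ae_map_iff hYm.aemeasurable (MStrip.measurableSet_setOf_counting h0 hpos)).mpr ?_
    filter_upwards [hYN, hN.counting] with ω h1 h2
    rw [h1]
    exact h2
  · intro f hf
    rw [← hN.lintegral_expNeg hNm hf]
    have hm : Measurable fun μ : MStrip h => expNeg (∫⁻ x, f x ∂μ.1) := measurable_expNeg.comp
      ((Measure.measurable_lintegral hf).comp (MStrip.measurable_val h0 hpos))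
    rw [lintegral_map hm hYm]
    refine lintegral_congr_ae ?_
    filter_upwards [hYN] with ω hω
    rw [hω]

/-- The laws of the Poisson random measures with mean measure `ν × Λ` form a Markov kernel. -/
theorem exists_poissonKernel (h0 : ∀ k x, 0 ≤ h k x) (hpos : ∀ x, ∃ k, 0 < h k x) :
    ∃ κ : Kernel (MBase h) (MStrip h), IsMarkovKernel κ ∧ ∀ ν : MBase h,
      IsPoissonRandomMeasure (κ ν) (fun μ : MStrip h => μ.1) (ν.1.prod lebesgueHalfLine) := by
  choose q hq using MStrip.exists_isPoissonRandomMeasure (h := h) h0 hpos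
  have := MBase.metrizableSpace h0 hpos
  have := MStrip.metrizableSpace h0 hpos
  -- The law depends continuously on `ν`: its Laplace functional at `f` is exp(-∫ ψ dν), a
  -- continuous function of `ν`. Measurability of the kernel follows.
  have hcont : Continuous q := by
    refine continuous_iff_seqContinuous.mpr fun ν ν₀ hν => ?_
    refine MStrip.tendsto_of_laplace h0 fun f => ?_
    obtain ⟨ψ, hψ⟩ := exists_isStripTransform h0 f
    simp only [Function.comp_apply, integral_laplace_of_isPoissonRandomMeasure h0 hpos (hq _) hψ]
    exact ((MBase.laplace h0 ψ).continuous.tendsto ν₀).comp hν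
  let _ := TopologicalSpace.metrizableSpaceMetric (MStrip h)
  have hmeas : Measurable fun ν => (q ν : Measure (MStrip h)) := by
    refine measurable_measure_of_lintegral fun f => Continuous.measurable ?_
    refine continuous_iff_continuousAt.mpr fun ν₀ => ?_
    exact (ProbabilityMeasure.tendsto_iff_forall_lintegral_tendsto.mp (hcont.tendsto ν₀)) f
  exact ⟨⟨fun ν => (q ν : Measure (MStrip h)), hmeas⟩, ⟨fun ν => (q ν).2⟩, hq⟩

end PoissonStrip

/-! ### Transfer of convergence between linked laws -/

section Linked

variable {S : Type*} [TopologicalSpace S] {h : ℕ → S →ᵇ ℝ}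

/-- Every test function on the base is the transform of an explicit test function on the strip. -/
lemma exists_neg_log_isStripTransform (h0 : ∀ k x, 0 ≤ h k x) (ψ : testCone h) {m : ℕ}
    (hm : 0 < m) (hmψ : ∀ x, 2 * ψ.1 x ≤ m) :
    ∃ f : testCone (stripWeight h), IsStripTransform f.1 ψ.1 ∧
      ∀ x u, (∫ u, cutoff m u ∂lebesgueHalfLine)⁻¹ * ψ.1 x * cutoff m u ≤ 1 / 2 ∧
        f.1 (x, u) = -Real.log
          (1 - (∫ u, cutoff m u ∂lebesgueHalfLine)⁻¹ * ψ.1 x * cutoff m u) := by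
  have hψ0 := nonneg_of_mem_testCone h0 ψ.2
  have hI : 0 < ∫ u, cutoff m u ∂lebesgueHalfLine :=
    lt_of_lt_of_le (by exact_mod_cast hm) (le_integral_cutoff m)
  -- The integral of the cutoff is at least `m ≥ 2 ψ`; the bound 1/2 keeps the argument of the
  -- logarithm away from 0.
  have hc (x : S) : (∫ u, cutoff m u ∂lebesgueHalfLine)⁻¹ * ψ.1 x ≤ 1 / 2 := by
    rw [inv_mul_le_iff₀ hI]
    linarith [hmψ x, le_integral_cutoff m]
  obtain ⟨f, hf, hfeq⟩ := exists_testCone_neg_log h0 ψ.2 m (inv_nonneg.mpr hI.le) hc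
  refine ⟨⟨f, hf⟩, isStripTransform_of_neg_log hm hψ0 hc hfeq, fun x u => ⟨?_, hfeq x u⟩⟩
  exact (mul_le_of_le_one_right (mul_nonneg (inv_nonneg.mpr hI.le) (hψ0 x))
    (cutoff_le_one m u)).trans (hc x)

lemma exists_nat_two_mul_le (ψ : S →ᵇ ℝ) : ∃ m : ℕ, 0 < m ∧ ∀ x, 2 * ψ x ≤ m := by
  obtain ⟨m, hm⟩ := exists_nat_ge (2 * ‖ψ‖)
  refine ⟨m + 1, m.succ_pos, fun x => ?_⟩
  have := (le_abs_self _).trans (ψ.norm_coe_le_norm x)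
  push_cast
  linarith

variable [MeasurableSpace S] [BorelSpace S]

/-- The Laplace functionals of `Q` and `R` are related as those of the laws of a conditionally
Poisson random measure and of its directing measure. -/
def LaplaceLinked (h0 : ∀ k x, 0 ≤ h k x) (Q : ProbabilityMeasure (MStrip h))
    (R : ProbabilityMeasure (MBase h)) : Prop :=
  ∀ (f : testCone (stripWeight h)) (ψ : testCone h), IsStripTransform f.1 ψ.1 →
    ∫ μ, MStrip.laplace h0 f μ ∂(Q : Measure (MStrip h))
      = ∫ ν, MBase.laplace h0 ψ ν ∂(R : Measure (MBase h))

/-- Continuity at zero of Laplace functionals, for the explicit test functions. -/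
lemma tendsto_integral_laplace_neg_log (h0 : ∀ k x, 0 ≤ h k x)
    {f : ℕ → testCone (stripWeight h)} {ψ : ℕ → S →ᵇ ℝ}
    {m : ℕ} {c : ℝ} (hc : 0 ≤ c)
    (hf : ∀ i x u, c * ψ i x * cutoff m u ≤ 1 / 2 ∧
      (f i).1 (x, u) = -Real.log (1 - c * ψ i x * cutoff m u))
    (hanti : ∀ x, Antitone fun i => ψ i x) (hlim : ∀ x, Tendsto (fun i => ψ i x) atTop (𝓝 0))
    (Q : ProbabilityMeasure (MStrip h)) :
    Tendsto (fun i => ∫ μ, MStrip.laplace h0 (f i) μ ∂(Q : Measure (MStrip h))) atTop (𝓝 1) := by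
  have hf0 (i) := nonneg_of_mem_testCone (stripWeight_nonneg h0) (f i).2
  have hfint (i) (μ : MStrip h) : Integrable (f i).1 μ.1 :=
    MBase.integrable_of_mem_testCone (stripWeight_nonneg h0) (MStrip.homeoBase h0 μ) (f i).2
  -- With `m` and `c` fixed, `f i` is monotone in `ψ i`, so the integrable function `f 0` dominates
  -- all of them.
  have hfle (i) (p) : (f i).1 p ≤ (f 0).1 p := by
    obtain ⟨x, u⟩ := p
    rw [(hf i x u).2, (hf 0 x u).2, neg_le_neg_iff]
    refine Real.log_le_log (by linarith [(hf 0 x u).1]) (sub_le_sub_left ?_ _)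
    exact mul_le_mul_of_nonneg_right (mul_le_mul_of_nonneg_left (hanti x (Nat.zero_le i)) hc)
      (cutoff_nonneg m u)
  have hflim (p) : Tendsto (fun i => (f i).1 p) atTop (𝓝 0) := by
    obtain ⟨x, u⟩ := p
    have h1 : Tendsto (fun i => 1 - c * ψ i x * cutoff m u) atTop (𝓝 1) := by
      have := (((hlim x).const_mul c).mul_const (cutoff m u)).const_sub 1
      simpa using this
    have h2 := ((Real.continuousAt_log one_ne_zero).tendsto.comp h1).neg
    rw [Real.log_one, neg_zero] at h2
    exact h2.congr fun i => ((hf i x u).2).symm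
  have hlap (μ : MStrip h) : Tendsto (fun i => MStrip.laplace h0 (f i) μ) atTop (𝓝 1) := by
    have h1 : Tendsto (fun i => ∫ p, (f i).1 p ∂μ.1) atTop (𝓝 (∫ _, (0 : ℝ) ∂μ.1)) := by
      refine tendsto_integral_of_dominated_convergence (f 0).1
        (fun i => (hfint i μ).aestronglyMeasurable) (hfint 0 μ)
        (fun i => Eventually.of_forall fun p => ?_) (Eventually.of_forall hflim)
      rw [Real.norm_of_nonneg (hf0 i p)]
      exact hfle i p
    rw [integral_zero] at h1
    have h2 := (Real.continuous_exp.tendsto _).comp h1.neg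
    rw [neg_zero, Real.exp_zero] at h2
    exact h2
  have h1 : Tendsto (fun i => ∫ μ, MStrip.laplace h0 (f i) μ ∂(Q : Measure (MStrip h))) atTop
      (𝓝 (∫ _, (1 : ℝ) ∂(Q : Measure (MStrip h)))) := by
    refine tendsto_integral_of_dominated_convergence (fun _ => 1)
      (fun i => (MStrip.laplace h0 (f i)).continuous.measurable.aestronglyMeasurable)
      (integrable_const _) (fun i => Eventually.of_forall fun μ => ?_)
      (Eventually.of_forall hlap)
    have := MBase.laplace_mem_Icc (stripWeight_nonneg h0) (f i) (MStrip.homeoBase h0 μ)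
    exact (Real.norm_of_nonneg this.1).le.trans this.2
  simpa using h1

variable [PolishSpace S] {h0 : ∀ k x, 0 ≤ h k x}
  {Q : ℕ → ProbabilityMeasure (MStrip h)} {Q₀ : ProbabilityMeasure (MStrip h)}
  {R : ℕ → ProbabilityMeasure (MBase h)} {R₀ R₁ : ProbabilityMeasure (MBase h)}

/-- Every test function on the strip has a transform on the base, so convergence of `R` controls all
Laplace functionals of `Q`. -/
lemma LaplaceLinked.tendsto (hQR : ∀ n, LaplaceLinked h0 (Q n) (R n))
    (hQR₀ : LaplaceLinked h0 Q₀ R₀) (hR : Tendsto R atTop (𝓝 R₀)) : Tendsto Q atTop (𝓝 Q₀) := by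
  refine MStrip.tendsto_of_laplace h0 fun f => ?_
  obtain ⟨ψ, hψ⟩ := exists_isStripTransform h0 f
  rw [hQR₀ f ψ hψ]
  simp only [hQR _ f ψ hψ]
  exact ProbabilityMeasure.tendsto_iff_forall_integral_tendsto.mp hR _

/-- Every test function on the base is a transform, so the Laplace functional of the base law can be
read off from `Q₀`. -/
lemma LaplaceLinked.unique (hpos : ∀ x, ∃ k, 0 < h k x) (hR₀ : LaplaceLinked h0 Q₀ R₀)
    (hR₁ : LaplaceLinked h0 Q₀ R₁) : R₀ = R₁ := by
  refine MBase.eq_of_laplace h0 hpos fun ψ => ?_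
  obtain ⟨m, hm, hmψ⟩ := exists_nat_two_mul_le ψ.1
  obtain ⟨f, hf, -⟩ := exists_neg_log_isStripTransform h0 ψ hm hmψ
  rw [← hR₀ f ψ hf, ← hR₁ f ψ hf]

/-- Convergence of the laws on the strip implies convergence of the laws on the base. -/
lemma LaplaceLinked.exists_tendsto (hpos : ∀ x, ∃ k, 0 < h k x)
    (hQR : ∀ n, LaplaceLinked h0 (Q n) (R n)) (hQ : Tendsto Q atTop (𝓝 Q₀)) :
    ∃ R₀, Tendsto R atTop (𝓝 R₀) := by
  have hlim {f : testCone (stripWeight h)} {ψ : testCone h} (hfψ : IsStripTransform f.1 ψ.1) :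
      Tendsto (fun n => ∫ ν, MBase.laplace h0 ψ ν ∂(R n : Measure (MBase h))) atTop
        (𝓝 (∫ μ, MStrip.laplace h0 f μ ∂(Q₀ : Measure (MStrip h)))) := by
    simp only [← hQR _ f ψ hfψ]
    exact ProbabilityMeasure.tendsto_iff_forall_integral_tendsto.mp hQ _
  have hex (ψ : testCone h) : ∃ f : testCone (stripWeight h), IsStripTransform f.1 ψ.1 := by
    obtain ⟨m, hm, hmψ⟩ := exists_nat_two_mul_le ψ.1
    obtain ⟨f, hf, -⟩ := exists_neg_log_isStripTransform h0 ψ hm hmψ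
    exact ⟨f, hf⟩
  choose F hF using hex
  refine MBase.exists_tendsto_of_laplace h0 hpos (fun ψ => hlim (hF ψ)) fun k φ hφ0 hanti hφ => ?_
  set ψ : ℕ → testCone h := fun i => ⟨φ i * h k, mul_mem_testCone_of_generator k (hφ0 i)⟩ with hψ
  have hψanti (x) : Antitone fun i => (ψ i).1 x := fun i j hij =>
    mul_le_mul_of_nonneg_right (hanti x hij) (h0 k x)
  have hψlim (x) : Tendsto (fun i => (ψ i).1 x) atTop (𝓝 0) := by
    have := (hφ x).mul_const (h k x)
    rwa [zero_mul] at this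
  -- One `m` serves the whole sequence, since `ψ 0` dominates every `ψ i`; dominated convergence
  -- requires this common cutoff.
  obtain ⟨m, hm, hmψ⟩ := exists_nat_two_mul_le (ψ 0).1
  have hmψ' (i) (x) : 2 * (ψ i).1 x ≤ m :=
    (mul_le_mul_of_nonneg_left (hψanti x (Nat.zero_le i)) zero_le_two).trans (hmψ x)
  choose G hG hGeq using fun i => exists_neg_log_isStripTransform h0 (ψ i) hm (hmψ' i)
  -- The preimages `F (ψ i)` are arbitrary and need not be comparable. They may be exchanged for the
  -- explicit `G i`, since both expressions are limits of the same base functionals.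
  have heq (i) : ∫ μ, MStrip.laplace h0 (F (ψ i)) μ ∂(Q₀ : Measure (MStrip h))
      = ∫ μ, MStrip.laplace h0 (G i) μ ∂(Q₀ : Measure (MStrip h)) :=
    tendsto_nhds_unique (hlim (hF (ψ i))) (hlim (hG i))
  change Tendsto (fun i => ∫ μ, MStrip.laplace h0 (F (ψ i)) μ ∂(Q₀ : Measure (MStrip h))) atTop _
  simp only [heq]
  exact tendsto_integral_laplace_neg_log h0
    (inv_nonneg.mpr (integral_nonneg (cutoff_nonneg m))) hGeq hψanti hψlim Q₀

end Linked

/-! ### Conditionally Poisson pairs are linked, and every base law has a partner -/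

section Cox

variable {S : Type*} [TopologicalSpace S] [MeasurableSpace S] [BorelSpace S] [PolishSpace S]
  {h : ℕ → S →ᵇ ℝ}

/-- Disintegrate along `Ξ`: given the value `ν`, the Poisson formula gives exp(-∫ ψ dν), and
integrating over the law of `Ξ` gives the relation. -/
lemma IsConditionallyPoisson.laplaceLinked (h0 : ∀ k x, 0 ≤ h k x) (hpos : ∀ x, ∃ k, 0 < h k x)
    {Ω : Type*} [MeasurableSpace Ω] {P : Measure Ω} [IsProbabilityMeasure P] {ξ : Ω → MStrip h}
    {Ξ : Ω → MBase h} (hc : IsConditionallyPoisson P ξ Ξ) :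
    LaplaceLinked h0 ⟨P.map ξ, Measure.isProbabilityMeasure_map hc.1⟩
      ⟨P.map Ξ, Measure.isProbabilityMeasure_map hc.2.1⟩ := by
  intro f ψ hfψ
  have hξ := hc.1
  have hΞ := hc.2.1
  obtain ⟨-, -, κ, hκ, hmap, hpois⟩ := hc
  have : IsProbabilityMeasure (P.map Ξ) := Measure.isProbabilityMeasure_map hΞ
  have hsnd : P.map ξ = ((P.map Ξ) ⊗ₘ κ).map Prod.snd := by
    rw [← hmap, AEMeasurable.map_map_of_aemeasurable measurable_snd.aemeasurable
      (hΞ.prodMk hξ)]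
    rfl
  have hm : Measurable (MStrip.laplace h0 f) := (MStrip.laplace h0 f).continuous.measurable
  change ∫ μ, MStrip.laplace h0 f μ ∂P.map ξ = ∫ ν, MBase.laplace h0 ψ ν ∂P.map Ξ
  rw [hsnd, integral_map measurable_snd.aemeasurable hm.aestronglyMeasurable,
    Measure.integral_compProd]
  · refine integral_congr_ae ?_
    filter_upwards [hpois] with ν hν
    exact integral_laplace_of_isPoissonRandomMeasure h0 hpos hν hfψ
  · refine Integrable.of_bound (hm.comp measurable_snd).aestronglyMeasurable
      ‖MStrip.laplace h0 f‖ (Eventually.of_forall fun p => ?_)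
    exact (MStrip.laplace h0 f).norm_coe_le_norm p.2

lemma IsConditionallyPoissonLaw.laplaceLinked (h0 : ∀ k x, 0 ≤ h k x)
    (hpos : ∀ x, ∃ k, 0 < h k x) {Q : ProbabilityMeasure (MStrip h)}
    {R : ProbabilityMeasure (MBase h)}
    (hc : IsConditionallyPoissonLaw (Q : Measure (MStrip h)) (R : Measure (MBase h))) :
    LaplaceLinked h0 Q R := by
  obtain ⟨ρ, hR, hQ, hρ⟩ := hc
  have : IsProbabilityMeasure ρ := by
    refine ⟨?_⟩
    have h1 : ρ.map Prod.fst Set.univ = 1 := by rw [hR]; exact measure_univ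
    rwa [Measure.map_apply measurable_fst MeasurableSet.univ, Set.preimage_univ] at h1
  have hQ' : Q = ⟨ρ.map Prod.snd, Measure.isProbabilityMeasure_map hρ.1⟩ := Subtype.ext hQ.symm
  have hR' : R = ⟨ρ.map Prod.fst, Measure.isProbabilityMeasure_map hρ.2.1⟩ := Subtype.ext hR.symm
  rw [hQ', hR']
  exact hρ.laplaceLinked h0 hpos

/-- Every random measure on the base directs some conditionally Poisson random measure. -/
lemma exists_isConditionallyPoissonLaw (h0 : ∀ k x, 0 ≤ h k x) (hpos : ∀ x, ∃ k, 0 < h k x)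
    (R : ProbabilityMeasure (MBase h)) : ∃ Q : ProbabilityMeasure (MStrip h),
      IsConditionallyPoissonLaw (Q : Measure (MStrip h)) (R : Measure (MBase h)) := by
  obtain ⟨κ, hκ, hpois⟩ := exists_poissonKernel (h := h) h0 hpos
  have hfst : ((R : Measure (MBase h)) ⊗ₘ κ).map Prod.fst = R := Measure.fst_compProd _ _
  refine ⟨⟨((R : Measure (MBase h)) ⊗ₘ κ).map Prod.snd,
    Measure.isProbabilityMeasure_map measurable_snd.aemeasurable⟩,
    (R : Measure (MBase h)) ⊗ₘ κ, hfst, rfl, measurable_snd.aemeasurable,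
    measurable_fst.aemeasurable, κ, hκ, ?_, Eventually.of_forall hpois⟩
  rw [hfst]
  exact Measure.map_id

end Cox

end

theorem mainTheorem5 {S : Type*} [MetricSpace S] [CompleteSpace S]
    [TopologicalSpace.SeparableSpace S] [MeasurableSpace S] [BorelSpace S]
    (h : ℕ → S →ᵇ ℝ) (h_nonneg : ∀ k x, 0 ≤ h k x) (h_le_one : ∀ k x, h k x ≤ 1)
    (h_pos : ∀ x, ∃ k, 0 < h k x)
    {Ω : ℕ → Type*} [∀ n, MeasurableSpace (Ω n)]
    (P : (n : ℕ) → Measure (Ω n)) [∀ n, IsProbabilityMeasure (P n)]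
    (ξ : (n : ℕ) → Ω n → MStrip h) (Ξ : (n : ℕ) → Ω n → MBase h)
    (hcox : ∀ n, IsConditionallyPoisson (P n) (ξ n) (Ξ n)) :
    ((∃ Q : ProbabilityMeasure (MStrip h),
        TendstoInDistribution ξ atTop id P (Q : Measure (MStrip h))) ↔
      (∃ R : ProbabilityMeasure (MBase h),
        TendstoInDistribution Ξ atTop id P (R : Measure (MBase h)))) ∧
    (∀ {Ω₁ Ω₂ : Type*} [MeasurableSpace Ω₁] [MeasurableSpace Ω₂]
      (P₁ : Measure Ω₁) [IsProbabilityMeasure P₁] (P₂ : Measure Ω₂) [IsProbabilityMeasure P₂]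
      (ξ' : Ω₁ → MStrip h) (Ξ' : Ω₂ → MBase h),
      TendstoInDistribution ξ atTop ξ' P P₁ → TendstoInDistribution Ξ atTop Ξ' P P₂ →
        IsConditionallyPoissonLaw (P₁.map ξ') (P₂.map Ξ')) ∧
    (∀ {Ω₁ Ω₂ : Type*} [MeasurableSpace Ω₁] [MeasurableSpace Ω₂]
      (P₁ : Measure Ω₁) [IsProbabilityMeasure P₁] (P₂ : Measure Ω₂) [IsProbabilityMeasure P₂]
      (ξ' : Ω₁ → MStrip h) (Ξ' : Ω₂ → MBase h), AEMeasurable ξ' P₁ → AEMeasurable Ξ' P₂ →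
      IsConditionallyPoissonLaw (P₁.map ξ') (P₂.map Ξ') →
        (TendstoInDistribution ξ atTop ξ' P P₁ ↔ TendstoInDistribution Ξ atTop Ξ' P P₂)) := by

  have := UniformSpace.secondCountable_of_separable S
  have := MBase.metrizableSpace h_nonneg h_pos
  have := MStrip.metrizableSpace h_nonneg h_pos
  have hξ (n) : AEMeasurable (ξ n) (P n) := (hcox n).1
  have hΞ (n) : AEMeasurable (Ξ n) (P n) := (hcox n).2.1
  let lawξ : ℕ → ProbabilityMeasure (MStrip h) := fun n =>
    ⟨(P n).map (ξ n), Measure.isProbabilityMeasure_map (hξ n)⟩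
  let lawΞ : ℕ → ProbabilityMeasure (MBase h) := fun n =>
    ⟨(P n).map (Ξ n), Measure.isProbabilityMeasure_map (hΞ n)⟩
  have hlink (n) : LaplaceLinked h_nonneg (lawξ n) (lawΞ n) :=
    (hcox n).laplaceLinked h_nonneg h_pos
  have hprob₁ (Q : ProbabilityMeasure (MStrip h)) : (⟨(Q : Measure (MStrip h)).map id,
      Measure.isProbabilityMeasure_map aemeasurable_id⟩ : ProbabilityMeasure (MStrip h)) = Q :=
    Subtype.ext Measure.map_id
  have hprob₂ (R : ProbabilityMeasure (MBase h)) : (⟨(R : Measure (MBase h)).map id,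
      Measure.isProbabilityMeasure_map aemeasurable_id⟩ : ProbabilityMeasure (MBase h)) = R :=
    Subtype.ext Measure.map_id
  -- The Poisson mixture `Q'` over `R` is also a limit of the laws of `ξ n`, so it coincides with
  -- `Q`.
  have hlimit {Q : ProbabilityMeasure (MStrip h)} {R : ProbabilityMeasure (MBase h)}
      (hQ : Tendsto lawξ atTop (𝓝 Q)) (hR : Tendsto lawΞ atTop (𝓝 R)) :
      IsConditionallyPoissonLaw (Q : Measure (MStrip h)) (R : Measure (MBase h)) := by
    obtain ⟨Q', hQ'⟩ := exists_isConditionallyPoissonLaw h_nonneg h_pos R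
    rw [tendsto_nhds_unique hQ
      (LaplaceLinked.tendsto hlink (hQ'.laplaceLinked h_nonneg h_pos) hR)]
    exact hQ'
  refine ⟨⟨?_, ?_⟩, ?_, ?_⟩
  · rintro ⟨Q, hQ⟩
    obtain ⟨R, hR⟩ := LaplaceLinked.exists_tendsto h_pos hlink hQ.tendsto
    exact ⟨R, hΞ, aemeasurable_id, by rwa [hprob₂]⟩
  · rintro ⟨R, hR⟩
    have hR' := hR.tendsto
    rw [hprob₂] at hR'
    obtain ⟨Q, hQ⟩ := exists_isConditionallyPoissonLaw h_nonneg h_pos R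
    refine ⟨Q, hξ, aemeasurable_id, ?_⟩
    rw [hprob₁]
    exact LaplaceLinked.tendsto hlink (hQ.laplaceLinked h_nonneg h_pos) hR'
  · intro Ω₁ Ω₂ _ _ P₁ _ P₂ _ ξ' Ξ' h₁ h₂
    exact hlimit h₁.tendsto h₂.tendsto
  · intro Ω₁ Ω₂ _ _ P₁ _ P₂ _ ξ' Ξ' hξ' hΞ' hlaw
    have hl := IsConditionallyPoissonLaw.laplaceLinked h_nonneg h_pos
      (Q := ⟨P₁.map ξ', Measure.isProbabilityMeasure_map hξ'⟩)
      (R := ⟨P₂.map Ξ', Measure.isProbabilityMeasure_map hΞ'⟩) hlaw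
    refine ⟨fun h₁ => ⟨hΞ, hΞ', ?_⟩, fun h₂ => ⟨hξ, hξ', ?_⟩⟩
    -- The laws of `Ξ n` converge to some `R`. Both `R` and the law of `Ξ'` are linked to the law of
    -- `ξ'`, hence they are equal.
    · obtain ⟨R, hR⟩ := LaplaceLinked.exists_tendsto h_pos hlink h₁.tendsto
      rw [LaplaceLinked.unique h_pos hl
        ((hlimit h₁.tendsto hR).laplaceLinked h_nonneg h_pos)]
      exact hR
    · exact LaplaceLinked.tendsto hlink hl h₂.tendsto
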